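/- Let $k$ be a field of characteristic zero. For an integer $m\ge 2$ and a primitive $m$-th root of unity $q\in k$, let $T_{m^2}(q)$ be the Taft Hopf algebra: the $k$-algebra generated by $h,x$ subject to $h^m=1$, $x^m=0$, $xh=q\,hx$, with $\Delta(h)=h\otimes h$, $\Delta(x)=x\otimes h+1\otimes x$, $\varepsilon(h)=1$, $\varepsilon(x)=0$, $S(h)=h^{-1}$, $S(x)=-xh^{-1}$. A Hopf algebra $E$ over $k$ is said to factor through Hopf algebras $A$ and $B$ if there are injective Hopf algebra maps $i:A\to E$ and $j:B\to E$ such that the linear map $A\otimes B\to E$, $a\otimes b\mapsto i(a)j(b)$, is bijective. Let $m,n\ge 2$ be integers, let $q,\overline q\in k$ be primitive roots of unity of orders $m$ and $n$ respectively, let $d=\gcd(m,n)$, and let $\nu(d)=|U_d(k)|$ be the number of elements $\omega\in k$ with $\omega^d=1$. Let $\mathbb T_{n^2}(\overline q)$ denote the Taft Hopf algebra with parameters $n$ and $\overline q$. Then the number $\sharp^{n,m}_{\overline q,q}$ of isomorphism classes of Hopf algebras that factor through $\mathbb T_{n^2}(\overline q)$ and $T_{m^2}(q)$ is given by $$\sharp^{n,m}_{\overline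 q,q}=\begin{cases} 3, & \text{if } m=n=2,\\ \nu(d), & \text{if } m\ne n,\ \text{or } m=n\ge 3 \text{ and } \overline q\notin\{q,q^{n-1}\},\\ \frac{\nu(d)}{2}+1, & \text{if } m=n\ge 3,\ \overline q=q \text{ and } \nu(d) \text{ is even},\\ \frac{\nu(d)+1}{2}, & \text{if } m=n\ge 3,\ \overline q=q \text{ and } \nu(d)\text{ is odd},\\ \nu(d)+1, & \text{if } m=n\ge 3 \text{ and } \overline q=q^{n-1}. \end{cases}$$ -/

import Mathlib

open scoped TensorProduct

universe u

/-! ### The Taft algebras -/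

section TaftAlgebra

variable {k : Type u} [Field k]

/-- The two generators of a Taft algebra. -/
inductive TaftGen : Type
  | h
  | x

/-- The defining relations `h ^ m = 1`, `x ^ m = 0`, `x h = q h x` on the free algebra on `h`, `x`. -/
inductive TaftRel (q : k) (m : ℕ) : FreeAlgebra k TaftGen → FreeAlgebra k TaftGen → Prop
  | h_pow : TaftRel q m (FreeAlgebra.ι k TaftGen.h ^ m) 1
  | x_pow : TaftRel q m (FreeAlgebra.ι k TaftGen.x ^ m) 0
  | x_mul_h : TaftRel q m (FreeAlgebra.ι k TaftGen.x * FreeAlgebra.ι k TaftGen.h)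
      (q • (FreeAlgebra.ι k TaftGen.h * FreeAlgebra.ι k TaftGen.x))

/-- The associative unital `k`-algebra generated by `h`, `x` subject to
`h ^ m = 1`, `x ^ m = 0`, `x h = q h x`. -/
def TaftAlgebra (q : k) (m : ℕ) : Type u := RingQuot (TaftRel q m)

namespace TaftAlgebra

noncomputable instance instRing (q : k) (m : ℕ) : Ring (TaftAlgebra q m) :=
  inferInstanceAs (Ring (RingQuot (TaftRel q m)))

noncomputable instance instAlgebra (q : k) (m : ℕ) : Algebra k (TaftAlgebra q m) :=
  inferInstanceAs (Algebra k (RingQuot (TaftRel q m)))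

/-- The quotient map from the free algebra. -/
noncomputable def mk (q : k) (m : ℕ) : FreeAlgebra k TaftGen →ₐ[k] TaftAlgebra q m :=
  RingQuot.mkAlgHom k (TaftRel q m)

/-- The generator `h`. -/
noncomputable def h (q : k) (m : ℕ) : TaftAlgebra q m := mk q m (FreeAlgebra.ι k TaftGen.h)

/-- The generator `x`. -/
noncomputable def x (q : k) (m : ℕ) : TaftAlgebra q m := mk q m (FreeAlgebra.ι k TaftGen.x)

theorem h_pow (q : k) (m : ℕ) : h q m ^ m = 1 := by
  have := RingQuot.mkAlgHom_rel k (TaftRel.h_pow (q := q) (m := m))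
  rw [map_pow, map_one] at this
  exact this

theorem x_pow (q : k) (m : ℕ) : x q m ^ m = 0 := by
  have := RingQuot.mkAlgHom_rel k (TaftRel.x_pow (q := q) (m := m))
  rw [map_pow, map_zero] at this
  exact this

theorem x_mul_h (q : k) (m : ℕ) : x q m * h q m = q • (h q m * x q m) := by
  have := RingQuot.mkAlgHom_rel k (TaftRel.x_mul_h (q := q) (m := m))
  rw [map_mul, map_smul, map_mul] at this
  exact this

/-- The universal property of the Taft algebra. -/
noncomputable def lift {q : k} {m : ℕ} {B : Type*} [Ring B] [Algebra k B] (g y : B)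
    (hg : g ^ m = 1) (hy : y ^ m = 0) (hgy : y * g = q • (g * y)) : TaftAlgebra q m →ₐ[k] B :=
  RingQuot.liftAlgHom k
    ⟨FreeAlgebra.lift k (fun i => match i with | TaftGen.h => g | TaftGen.x => y), by
      intro a b hab
      cases hab with
      | h_pow => simpa using hg
      | x_pow => simpa using hy
      | x_mul_h => simpa using hgy⟩

section lift

variable {q : k} {m : ℕ} {B : Type*} [Ring B] [Algebra k B] (g y : B)
    (hg : g ^ m = 1) (hy : y ^ m = 0) (hgy : y * g = q • (g * y))

theorem lift_h : lift g y hg hy hgy (h q m) = g := by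
  unfold lift h mk
  exact (RingQuot.liftAlgHom_mkAlgHom_apply _ _ _ _).trans (by simp)

theorem lift_x : lift g y hg hy hgy (x q m) = y := by
  unfold lift x mk
  exact (RingQuot.liftAlgHom_mkAlgHom_apply _ _ _ _).trans (by simp)

end lift

/-- Induction principle: `h` and `x` generate the Taft algebra. -/
theorem induction {q : k} {m : ℕ} {P : TaftAlgebra q m → Prop}
    (scalar : ∀ c : k, P (algebraMap k _ c)) (gen_h : P (h q m)) (gen_x : P (x q m))
    (mul : ∀ a b, P a → P b → P (a * b)) (add : ∀ a b, P a → P b → P (a + b))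
    (a : TaftAlgebra q m) : P a := by
  obtain ⟨a, rfl⟩ : ∃ b, mk q m b = a := RingQuot.mkAlgHom_surjective k (TaftRel q m) a
  induction a using FreeAlgebra.induction with
  | grade0 r => rw [AlgHom.commutes]; exact scalar r
  | grade1 i =>
    cases i with
    | h => exact gen_h
    | x => exact gen_x
  | mul a b ha hb => rw [map_mul]; exact mul _ _ ha hb
  | add a b ha hb => rw [map_add]; exact add _ _ ha hb

theorem algHom_ext {q : k} {m : ℕ} {B : Type*} [Ring B] [Algebra k B]
    {f g : TaftAlgebra q m →ₐ[k] B} (hh : f (h q m) = g (h q m)) (hx : f (x q m) = g (x q m)) :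
    f = g := by
  ext a
  induction a using TaftAlgebra.induction with
  | scalar c => rw [AlgHom.commutes, AlgHom.commutes]
  | gen_h => exact hh
  | gen_x => exact hx
  | mul a b ha hb => rw [map_mul, map_mul, ha, hb]
  | add a b ha hb => rw [map_add, map_add, ha, hb]

/-! The `q`-binomial theorem at a primitive root of unity, needed for the comultiplication. -/

/-- The `q`-binomial coefficient of `a ^ i * b ^ j` in `(a + b) ^ (i + j)` when `b a = q a b`. -/
def qBinom (q : k) : ℕ → ℕ → k
  | 0, _ => 1
  | _ + 1, 0 => 1
  | i + 1, j + 1 => qBinom q i (j + 1) + q ^ (i + 1) * qBinom q (i + 1) j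

/-- The `q`-integer `1 + q + ⋯ + q ^ (n - 1)`. -/
def qInt (q : k) (n : ℕ) : k := ∑ i ∈ Finset.range n, q ^ i

/-- The `q`-factorial. -/
def qFact (q : k) (n : ℕ) : k := ∏ i ∈ Finset.range n, qInt q (i + 1)

theorem qBinom_zero_right (q : k) (i : ℕ) : qBinom q i 0 = 1 := by
  cases i <;> simp [qBinom]

theorem qInt_add (q : k) (i j : ℕ) : qInt q (i + j) = qInt q i + q ^ i * qInt q j := by
  simp only [qInt, Finset.sum_range_add, Finset.mul_sum, pow_add]

theorem qFact_succ (q : k) (n : ℕ) : qFact q (n + 1) = qFact q n * qInt q (n + 1) := by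
  simp only [qFact, Finset.prod_range_succ]

theorem qBinom_mul (q : k) (i j : ℕ) :
    qBinom q i j * (qFact q i * qFact q j) = qFact q (i + j) := by
  induction i generalizing j with
  | zero => simp [qBinom, qFact]
  | succ i ihi =>
    induction j with
    | zero => simp [qBinom, qFact]
    | succ j ihj =>
      have h1 := ihi (j + 1)
      have e1 : i + 1 + (j + 1) = (i + j + 1) + 1 := by ring
      have e2 : i + (j + 1) = i + j + 1 := by ring
      have e3 : i + 1 + j = i + j + 1 := by ring
      have h3 : qInt q (i + j + 1 + 1) = qInt q (i + 1) + q ^ (i + 1) * qInt q (j + 1) := by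
        rw [← qInt_add]; congr 1; ring
      rw [e2] at h1
      rw [e3] at ihj
      rw [e1, qFact_succ q (i + j + 1), h3, qBinom, qFact_succ q i, qFact_succ q j]
      rw [qFact_succ q j] at h1
      rw [qFact_succ q i] at ihj
      linear_combination (qInt q (i + 1)) * h1 + q ^ (i + 1) * qInt q (j + 1) * ihj

theorem mul_pow_of_qComm {B : Type*} [Ring B] [Algebra k B] {q : k} {a b : B}
    (hab : b * a = q • (a * b)) (i : ℕ) : b * a ^ i = q ^ i • (a ^ i * b) := by
  induction i with
  | zero => simp
  | succ i ih =>
    rw [pow_succ, ← mul_assoc, ih, smul_mul_assoc, mul_assoc, hab, mul_smul_comm, smul_smul,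
      mul_assoc, ← pow_succ]

theorem add_pow_of_qComm {B : Type*} [Ring B] [Algebra k B] {q : k} {a b : B}
    (hab : b * a = q • (a * b)) (n : ℕ) :
    (a + b) ^ n = ∑ p ∈ Finset.HasAntidiagonal.antidiagonal n, qBinom q p.1 p.2 • (a ^ p.1 * b ^ p.2) := by
  induction n with
  | zero => simp [qBinom]
  | succ n ih =>
    have hL : ∀ p : ℕ × ℕ, (a + b) * (qBinom q p.1 p.2 • (a ^ p.1 * b ^ p.2)) =
        qBinom q p.1 p.2 • (a ^ (p.1 + 1) * b ^ p.2) +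
          (q ^ p.1 * qBinom q p.1 p.2) • (a ^ p.1 * b ^ (p.2 + 1)) := by
      intro p
      rw [add_mul, mul_smul_comm, mul_smul_comm, ← mul_assoc, ← mul_assoc,
        mul_pow_of_qComm hab, smul_mul_assoc, smul_smul, mul_assoc _ b, ← pow_succ', ← pow_succ',
        mul_comm (q ^ p.1)]
    rw [pow_succ', ih, Finset.mul_sum, Finset.sum_congr rfl (fun p _ => hL p),
      Finset.sum_add_distrib]
    cases n with
    | zero => simp [Finset.Nat.antidiagonal_succ, qBinom, add_comm]
    | succ n =>
      rw [Finset.Nat.sum_antidiagonal_succ' (n := n)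
          (f := fun p : ℕ × ℕ => qBinom q p.1 p.2 • (a ^ (p.1 + 1) * b ^ p.2)),
        Finset.Nat.sum_antidiagonal_succ (n := n)
          (f := fun p : ℕ × ℕ => (q ^ p.1 * qBinom q p.1 p.2) • (a ^ p.1 * b ^ (p.2 + 1))),
        Finset.Nat.sum_antidiagonal_succ (n := n + 1), Finset.Nat.sum_antidiagonal_succ' (n := n)]
      simp only [qBinom, qBinom_zero_right, add_smul, Finset.sum_add_distrib]
      simp only [pow_zero, one_mul, mul_one]
      abel

theorem qInt_eq_zero {q : k} {m : ℕ} (hq : IsPrimitiveRoot q m) (hm : 1 < m) : qInt q m = 0 :=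
  hq.geom_sum_eq_zero hm

theorem qFact_ne_zero {q : k} {m : ℕ} (hq : IsPrimitiveRoot q m) {i : ℕ} (hi : i < m) :
    qFact q i ≠ 0 := by
  rw [qFact, Finset.prod_ne_zero_iff]
  intro j hj h0
  rw [Finset.mem_range] at hj
  have h1 : q ^ (j + 1) - 1 = 0 := by
    rw [← geom_sum_mul]
    rw [qInt] at h0
    rw [h0, zero_mul]
  exact hq.pow_ne_one_of_pos_of_lt (Nat.succ_ne_zero j) (by omega) (sub_eq_zero.mp h1)

theorem qBinom_eq_zero {q : k} {m : ℕ} (hq : IsPrimitiveRoot q m) {i j : ℕ} (hi : i ≠ 0)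
    (hj : j ≠ 0) (hij : i + j = m) : qBinom q i j = 0 := by
  have h0 : qFact q (i + j) = 0 := by
    obtain ⟨l, hl⟩ : ∃ l, i + j = l + 1 := ⟨i + j - 1, by omega⟩
    rw [hl, qFact_succ, ← hl, hij, qInt_eq_zero hq (by omega), mul_zero]
  have h1 := qBinom_mul q i j
  rw [h0] at h1
  exact (mul_eq_zero.mp h1).resolve_right
    (mul_ne_zero (qFact_ne_zero hq (by omega)) (qFact_ne_zero hq (by omega)))

theorem add_pow_eq_zero_of_qComm {B : Type*} [Ring B] [Algebra k B] {q : k} {m : ℕ}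
    (hq : IsPrimitiveRoot q m) {a b : B} (hab : b * a = q • (a * b)) (ha : a ^ m = 0)
    (hb : b ^ m = 0) : (a + b) ^ m = 0 := by
  rw [add_pow_of_qComm hab]
  refine Finset.sum_eq_zero fun p hp => ?_
  rw [Finset.HasAntidiagonal.mem_antidiagonal] at hp
  rcases Nat.eq_zero_or_pos p.1 with h1 | h1
  · have : p.2 = m := by omega
    rw [this, hb, mul_zero, smul_zero]
  rcases Nat.eq_zero_or_pos p.2 with h2 | h2
  · have : p.1 = m := by omega
    rw [this, ha, zero_mul, smul_zero]
  rw [qBinom_eq_zero hq h1.ne' h2.ne' hp, zero_smul]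

/-! The Hopf algebra structure. -/

section Hopf

variable (q : k) (m : ℕ)

/-- The comultiplication: `h ↦ h ⊗ h`, `x ↦ x ⊗ h + 1 ⊗ x`. -/
noncomputable def comulHom (hq : IsPrimitiveRoot q m) :
    TaftAlgebra q m →ₐ[k] TaftAlgebra q m ⊗[k] TaftAlgebra q m :=
  lift (h q m ⊗ₜ[k] h q m) (x q m ⊗ₜ[k] h q m + 1 ⊗ₜ[k] x q m)
    (by rw [Algebra.TensorProduct.tmul_pow, h_pow, Algebra.TensorProduct.one_def])
    (by
      refine add_pow_eq_zero_of_qComm hq ?_ ?_ ?_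
      · rw [Algebra.TensorProduct.tmul_mul_tmul, Algebra.TensorProduct.tmul_mul_tmul, x_mul_h,
          one_mul, mul_one, TensorProduct.tmul_smul]
      · rw [Algebra.TensorProduct.tmul_pow, x_pow, TensorProduct.zero_tmul]
      · rw [Algebra.TensorProduct.tmul_pow, x_pow, TensorProduct.tmul_zero])
    (by
      rw [add_mul, mul_add, smul_add]
      simp only [Algebra.TensorProduct.tmul_mul_tmul, x_mul_h, one_mul, mul_one,
        TensorProduct.tmul_smul, TensorProduct.smul_tmul'])

/-- The counit: `h ↦ 1`, `x ↦ 0`. -/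
noncomputable def counitHom (hm : m ≠ 0) : TaftAlgebra q m →ₐ[k] k :=
  lift 1 0 (one_pow m) (zero_pow hm) (by simp)

/-- The inverse of `h` is `h ^ (m - 1)`. -/
theorem h_mul_h_pow (hm : m ≠ 0) : h q m * h q m ^ (m - 1) = 1 := by
  rw [← pow_succ', Nat.sub_add_cancel (Nat.one_le_iff_ne_zero.mpr hm), h_pow]

theorem h_pow_mul_h (hm : m ≠ 0) : h q m ^ (m - 1) * h q m = 1 := by
  rw [← pow_succ, Nat.sub_add_cancel (Nat.one_le_iff_ne_zero.mpr hm), h_pow]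

theorem h_pow_mul_x (hm : m ≠ 0) :
    h q m ^ (m - 1) * x q m = q • (x q m * h q m ^ (m - 1)) := by
  have h1 : h q m ^ (m - 1) * (x q m * h q m) * h q m ^ (m - 1) =
      h q m ^ (m - 1) * (q • (h q m * x q m)) * h q m ^ (m - 1) := by rw [x_mul_h]
  rw [mul_assoc, mul_assoc, h_mul_h_pow q m hm, mul_one, mul_smul_comm, ← mul_assoc,
    h_pow_mul_h q m hm, one_mul, smul_mul_assoc] at h1
  exact h1

/-- The antipode, as an algebra homomorphism to the opposite algebra: `h ↦ h⁻¹`, `x ↦ -x h⁻¹`,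
where `h⁻¹ = h ^ (m - 1)`. -/
noncomputable def antipodeHom (hm : m ≠ 0) : TaftAlgebra q m →ₐ[k] (TaftAlgebra q m)ᵐᵒᵖ :=
  lift (MulOpposite.op (h q m ^ (m - 1))) (MulOpposite.op (-(x q m * h q m ^ (m - 1))))
    (by rw [← MulOpposite.op_pow, ← pow_mul, mul_comm, pow_mul, h_pow, one_pow,
      MulOpposite.op_one])
    (by
      have key : ∀ i : ℕ, ∃ c : k,
          (x q m * h q m ^ (m - 1)) ^ i = c • (x q m ^ i * (h q m ^ (m - 1)) ^ i) := by
        intro i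
        induction i with
        | zero => exact ⟨1, by simp⟩
        | succ i ih =>
          obtain ⟨c, hc⟩ := ih
          refine ⟨q ^ i * c, ?_⟩
          have hx := mul_pow_of_qComm (h_pow_mul_x q m hm) i
          rw [pow_succ', hc, mul_smul_comm, mul_assoc, ← mul_assoc (h q m ^ (m - 1)), hx,
            smul_mul_assoc, mul_smul_comm, smul_smul, mul_comm c, mul_assoc (x q m ^ i),
            ← pow_succ', ← mul_assoc, ← pow_succ']
      obtain ⟨c, hc⟩ := key m
      rw [← MulOpposite.op_pow, neg_pow, hc, x_pow, zero_mul, smul_zero, mul_zero,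
        MulOpposite.op_zero])
    (by
      rw [← MulOpposite.op_mul, ← MulOpposite.op_mul, ← MulOpposite.op_smul, mul_neg, neg_mul,
        smul_neg, ← mul_assoc, h_pow_mul_x q m hm, smul_mul_assoc])

/-- The antipode as a linear map. -/
noncomputable def antipodeLin (hm : m ≠ 0) : TaftAlgebra q m →ₗ[k] TaftAlgebra q m :=
  (MulOpposite.opLinearEquiv k).symm.toLinearMap ∘ₗ (antipodeHom q m hm).toLinearMap

theorem antipodeLin_mul (hm : m ≠ 0) (a b : TaftAlgebra q m) :
    antipodeLin q m hm (a * b) = antipodeLin q m hm b * antipodeLin q m hm a := by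
  simp [antipodeLin]

theorem antipodeLin_algebraMap (hm : m ≠ 0) (c : k) :
    antipodeLin q m hm (algebraMap k _ c) = algebraMap k _ c := by
  simp [antipodeLin, AlgHom.commutes]

theorem antipodeLin_h (hm : m ≠ 0) : antipodeLin q m hm (h q m) = h q m ^ (m - 1) := by
  simp [antipodeLin, antipodeHom, lift_h]

theorem antipodeLin_x (hm : m ≠ 0) :
    antipodeLin q m hm (x q m) = -(x q m * h q m ^ (m - 1)) := by
  simp [antipodeLin, antipodeHom, lift_x]

theorem comulHom_h (hq : IsPrimitiveRoot q m) :
    comulHom q m hq (h q m) = h q m ⊗ₜ[k] h q m := lift_h ..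

theorem comulHom_x (hq : IsPrimitiveRoot q m) :
    comulHom q m hq (x q m) = x q m ⊗ₜ[k] h q m + 1 ⊗ₜ[k] x q m := lift_x ..

theorem counitHom_h (hm : m ≠ 0) : counitHom q m hm (h q m) = 1 := lift_h ..

theorem counitHom_x (hm : m ≠ 0) : counitHom q m hm (x q m) = 0 := lift_x ..

/-- The bialgebra structure of the Taft algebra. -/
noncomputable instance instBialgebra [NeZero m] [hq : Fact (IsPrimitiveRoot q m)] :
    Bialgebra k (TaftAlgebra q m) :=
  Bialgebra.ofAlgHom (comulHom q m hq.out) (counitHom q m (NeZero.ne m))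
    (algHom_ext
      (by simp [comulHom_h])
      (by simp [comulHom_x, comulHom_h, TensorProduct.add_tmul, TensorProduct.tmul_add,
        Algebra.TensorProduct.one_def, add_assoc]))
    (algHom_ext
      (by simp [comulHom_h, counitHom_h])
      (by simp [comulHom_x, counitHom_x]))
    (algHom_ext
      (by simp [comulHom_h, counitHom_h])
      (by simp [comulHom_x, counitHom_h, counitHom_x]))

theorem comul_def [NeZero m] [hq : Fact (IsPrimitiveRoot q m)] (a : TaftAlgebra q m) :
    Coalgebra.comul (R := k) a = comulHom q m hq.out a := rfl

theorem counit_def [NeZero m] [hq : Fact (IsPrimitiveRoot q m)] (a : TaftAlgebra q m) :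
    Coalgebra.counit (R := k) a = counitHom q m (NeZero.ne m) a := rfl

theorem antipode_left_mul (hm : m ≠ 0) (t s : TaftAlgebra q m ⊗[k] TaftAlgebra q m) (c : k)
    (ht : LinearMap.mul' k _ ((antipodeLin q m hm).rTensor _ t) = algebraMap k _ c) :
    LinearMap.mul' k _ ((antipodeLin q m hm).rTensor _ (t * s)) =
      c • LinearMap.mul' k _ ((antipodeLin q m hm).rTensor _ s) := by
  have key : ∀ (t : TaftAlgebra q m ⊗[k] TaftAlgebra q m) (a b : TaftAlgebra q m),
      LinearMap.mul' k _ ((antipodeLin q m hm).rTensor _ (t * a ⊗ₜ[k] b)) =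
        antipodeLin q m hm a * LinearMap.mul' k _ ((antipodeLin q m hm).rTensor _ t) * b := by
    intro t a b
    induction t using TensorProduct.induction_on with
    | zero => simp
    | tmul y z => simp [antipodeLin_mul, mul_assoc]
    | add y z hy hz => rw [add_mul, map_add, map_add, hy, hz, map_add, map_add, mul_add, add_mul]
  induction s using TensorProduct.induction_on with
  | zero => simp
  | tmul a b =>
    rw [key, ht, ← Algebra.commutes, mul_assoc, Algebra.smul_def]
    simp
  | add y z hy hz => rw [mul_add, map_add, map_add, hy, hz, map_add, map_add, smul_add]

theorem antipode_right_mul (hm : m ≠ 0) (t s : TaftAlgebra q m ⊗[k] TaftAlgebra q m) (c : k)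
    (hs : LinearMap.mul' k _ ((antipodeLin q m hm).lTensor _ s) = algebraMap k _ c) :
    LinearMap.mul' k _ ((antipodeLin q m hm).lTensor _ (t * s)) =
      c • LinearMap.mul' k _ ((antipodeLin q m hm).lTensor _ t) := by
  have key : ∀ (s : TaftAlgebra q m ⊗[k] TaftAlgebra q m) (a b : TaftAlgebra q m),
      LinearMap.mul' k _ ((antipodeLin q m hm).lTensor _ (a ⊗ₜ[k] b * s)) =
        a * LinearMap.mul' k _ ((antipodeLin q m hm).lTensor _ s) * antipodeLin q m hm b := by
    intro s a b
    induction s using TensorProduct.induction_on with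
    | zero => simp
    | tmul y z => simp [antipodeLin_mul, mul_assoc]
    | add y z hy hz => rw [mul_add, map_add, map_add, hy, hz, map_add, map_add, mul_add, add_mul]
  induction t using TensorProduct.induction_on with
  | zero => simp
  | tmul a b =>
    rw [key, hs, ← Algebra.commutes, mul_assoc, Algebra.smul_def]
    simp
  | add y z hy hz => rw [add_mul, map_add, map_add, hy, hz, map_add, map_add, smul_add]

/-- The Hopf algebra structure of the Taft algebra. -/
noncomputable instance instHopfAlgebra [NeZero m] [hq : Fact (IsPrimitiveRoot q m)] :
    HopfAlgebra k (TaftAlgebra q m) where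
  antipode := antipodeLin q m (NeZero.ne m)
  mul_antipode_rTensor_comul := by
    ext a
    simp only [LinearMap.comp_apply, Algebra.linearMap_apply, comul_def, counit_def]
    induction a using TaftAlgebra.induction with
    | scalar c =>
      rw [AlgHom.commutes, AlgHom.commutes, Algebra.TensorProduct.algebraMap_apply]
      simp [antipodeLin_algebraMap]
    | gen_h => simp [comulHom_h, counitHom_h, antipodeLin_h, h_pow_mul_h q m (NeZero.ne m)]
    | gen_x =>
      have h1 : antipodeLin q m (NeZero.ne m) 1 = 1 := by
        simpa using antipodeLin_algebraMap q m (NeZero.ne m) 1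
      simp [comulHom_x, counitHom_x, antipodeLin_x, h1, mul_assoc,
        h_pow_mul_h q m (NeZero.ne m)]
    | mul a b ha hb =>
      rw [map_mul, antipode_left_mul q m _ _ _ _ ha, hb, map_mul, map_mul, Algebra.smul_def]
    | add a b ha hb => rw [map_add, map_add, map_add, ha, hb, map_add, map_add]
  mul_antipode_lTensor_comul := by
    ext a
    simp only [LinearMap.comp_apply, Algebra.linearMap_apply, comul_def, counit_def]
    induction a using TaftAlgebra.induction with
    | scalar c =>
      have h1 : antipodeLin q m (NeZero.ne m) 1 = 1 := by
        simpa using antipodeLin_algebraMap q m (NeZero.ne m) 1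
      rw [AlgHom.commutes, AlgHom.commutes, Algebra.TensorProduct.algebraMap_apply]
      simp [h1]
    | gen_h => simp [comulHom_h, counitHom_h, antipodeLin_h, h_mul_h_pow q m (NeZero.ne m)]
    | gen_x => simp [comulHom_x, counitHom_x, antipodeLin_x, antipodeLin_h]
    | mul a b ha hb =>
      rw [map_mul, antipode_right_mul q m _ _ _ _ hb, ha, map_mul, map_mul, Algebra.smul_def,
        Algebra.commutes]
    | add a b ha hb => rw [map_add, map_add, map_add, ha, hb, map_add, map_add]

end Hopf

end TaftAlgebra

/-- The Taft Hopf algebra `T_{m²}(q)` for a primitive `m`-th root of unity `q`. -/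
noncomputable def taftHopf {q : k} {m : ℕ} (hm : 2 ≤ m) (hq : IsPrimitiveRoot q m) :
    HopfAlgCat.{u} k :=
  haveI : NeZero m := ⟨by omega⟩
  haveI : Fact (IsPrimitiveRoot q m) := ⟨hq⟩
  HopfAlgCat.of k (TaftAlgebra q m)

end TaftAlgebra

/-! ### Factorization of Hopf algebras -/

section Factorization

variable {k : Type u} [Field k]

/-- `E` factors through `A` and `H`: there are injective Hopf algebra maps `i : A → E`,
`j : H → E` such that `A ⊗ H → E`, `a ⊗ h ↦ i a * j h`, is bijective. (A bialgebra map between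
Hopf algebras automatically commutes with the antipodes.) -/
def FactorsThrough (E A H : HopfAlgCat.{u} k) : Prop :=
  ∃ (i : A →ₐc[k] E) (j : H →ₐc[k] E), Function.Injective i ∧ Function.Injective j ∧
    Function.Bijective (LinearMap.mul' k E ∘ₗ
      TensorProduct.map (i : A →ₗ[k] E) (j : H →ₗ[k] E))

/-- Isomorphism of Hopf algebras, on the Hopf algebras that factor through `A` and `H`. -/
def factorizationSetoid (A H : HopfAlgCat.{u} k) :
    Setoid {E : HopfAlgCat.{u} k // FactorsThrough E A H} where
  r E F := Nonempty (E.1 ≃ₐc[k] F.1)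
  iseqv :=
    ⟨fun _ => ⟨BialgEquiv.refl k _⟩, fun ⟨e⟩ => ⟨e.symm⟩, fun ⟨e⟩ ⟨f⟩ => ⟨e.trans f⟩⟩

/-- The number (a cardinal) of isomorphism types of Hopf algebras that factor through
`A` and `H`. -/
noncomputable def numFactorizationTypes (A H : HopfAlgCat.{u} k) : Cardinal.{u + 1} :=
  Cardinal.mk (Quotient (factorizationSetoid A H))

end Factorization

/-! Let `H, X` generate the Taft algebra of parameter `p = qbar` and order `n`, and let `h, x`
generate the one of parameter `q` and order `m`. If `E` factors through them, the product map from
their tensor product to `E` is an isomorphism of coalgebras. The group-like elements of `E` are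
therefore the products `H ^ a * h ^ b`. By `skewPrimitive_tensor`, solutions of `Δ z = z ⊗ g + 1 ⊗
z` are multiples of `1 - g`, except for `g = H` and `g = h`, where `X` and `x` come in.

Conjugation by group-like elements preserves such solutions, so `hH = Hh`, `hX = αXh` and `Hx =
γxH`. Comparing coproducts forces `γ⁻¹ = α`. Then `xX - αXx` is a solution for `g = Hh`, hence equal
to `l(1 - Hh)`, and commuting it with `h` and `H` gives `l(α - q) = 0` and `l(αp - 1) = 0`
(`exists_relations`). Conversely, the Hopf algebra `TaftBicrossed` presented by these relations does
factor when `α ^ n = α ^ m = 1` and both constraints on `l` hold (`mulMap_bijective`): it acts on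
the tensor product, with `x` acting through a Jackson derivative on the first factor, and evaluation
at `1 ⊗ 1` inverts the product map.

A Taft algebra embeds in `E` only as one of the two factors, up to rescaling `x`
(`hom_to_factorization`). An isomorphism therefore keeps the factors, and with them `α`, or
exchanges them, which needs `p = q` and inverts `α`; in both cases it preserves whether `l = 0`
(`parameters_of_equiv`). A nonzero `l` can be rescaled to `1`, and it requires `α = q` and `qp = 1`.

The count is thus the number `ν(d)` of possible `α` with `l = 0`, modulo inversion if `p = q`, plus
one if `qp = 1`. For `m = n ≥ 3` the conditions `p = q` and `qp = 1` exclude each other; under the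
first, `ν = m` and inversion has `⌊m/2⌋ + 1` orbits. For `m = n = 2` both hold, but inversion is
trivial on `{1, -1}`, whence `2 + 1 = 3`. -/

set_option linter.unusedSectionVars false

/-! ### Functionals acting on a coalgebra -/

section CoalgebraAction

variable {k : Type u} [Field k] {C D : Type*}

section Module

variable [AddCommGroup C] [Module k C] [Coalgebra k C] [AddCommGroup D] [Module k D]
  [Coalgebra k D]

/-- The operator `(id ⊗ f) ∘ Δ`. -/
noncomputable def rightAct (f : C →ₗ[k] k) : C →ₗ[k] C :=
  (TensorProduct.rid k C).toLinearMap ∘ₗ f.lTensor C ∘ₗ Coalgebra.comul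

/-- The operator `(f ⊗ id) ∘ Δ`. -/
noncomputable def leftAct (f : C →ₗ[k] k) : C →ₗ[k] C :=
  (TensorProduct.lid k C).toLinearMap ∘ₗ f.rTensor C ∘ₗ Coalgebra.comul

theorem rightAct_counit (c : C) : rightAct (Coalgebra.counit (R := k)) c = c := by
  simp [rightAct, Coalgebra.lTensor_counit_comul]

theorem leftAct_counit (c : C) : leftAct (Coalgebra.counit (R := k)) c = c := by
  simp [leftAct, Coalgebra.rTensor_counit_comul]

/-- The counit axiom absorbs the first tensor leg, so a functional is recovered from its operator.
-/
theorem counit_rightAct (f : C →ₗ[k] k) (c : C) :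
    Coalgebra.counit (R := k) (rightAct f c) = f c := by
  have h1 : ∀ t : C ⊗[k] C, Coalgebra.counit (R := k) (TensorProduct.rid k C (f.lTensor C t)) =
      f (TensorProduct.lid k C ((Coalgebra.counit (R := k)).rTensor C t)) := by
    intro t
    induction t using TensorProduct.induction_on with
    | zero => simp
    | tmul a b => simp [mul_comm]
    | add a b ha hb => simp only [map_add, ha, hb]
  simp only [rightAct, LinearMap.comp_apply, LinearEquiv.coe_coe, h1,
    Coalgebra.rTensor_counit_comul, TensorProduct.lid_tmul, one_smul]

/-- Skew primitivity becomes an eigenvector equation modulo `e` for the right action, and modulo `g`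
for the left action below. -/
theorem rightAct_of_comul_eq {z g e : C}
    (hz : Coalgebra.comul (R := k) z = z ⊗ₜ[k] g + e ⊗ₜ[k] z) (f : C →ₗ[k] k) :
    rightAct f z = f g • z + f z • e := by
  simp [rightAct, hz]

theorem leftAct_of_comul_eq {z g e : C}
    (hz : Coalgebra.comul (R := k) z = z ⊗ₜ[k] g + e ⊗ₜ[k] z) (f : C →ₗ[k] k) :
    leftAct f z = f z • g + f e • z := by
  simp [leftAct, hz]

theorem rightAct_groupLike {g : C} (hg : IsGroupLikeElem k g) (f : C →ₗ[k] k) :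
    rightAct f g = f g • g := by
  simp [rightAct, hg.comul_eq_tmul_self]

theorem leftAct_groupLike {g : C} (hg : IsGroupLikeElem k g) (f : C →ₗ[k] k) :
    leftAct f g = f g • g := by
  simp [leftAct, hg.comul_eq_tmul_self]

/-- The tensor product of two functionals. -/
noncomputable def tensorFunctional (f : C →ₗ[k] k) (f' : D →ₗ[k] k) : C ⊗[k] D →ₗ[k] k :=
  (TensorProduct.lid k k).toLinearMap ∘ₗ TensorProduct.map f f'

@[simp]
theorem tensorFunctional_tmul (f : C →ₗ[k] k) (f' : D →ₗ[k] k) (c : C) (d : D) :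
    tensorFunctional f f' (c ⊗ₜ[k] d) = f c * f' d := by
  simp [tensorFunctional]

theorem rightAct_tensor (f : C →ₗ[k] k) (f' : D →ₗ[k] k) (c : C) (d : D) :
    rightAct (tensorFunctional f f') (c ⊗ₜ[k] d) = rightAct f c ⊗ₜ[k] rightAct f' d := by
  have h1 : ∀ (s : C ⊗[k] C) (t : D ⊗[k] D),
      TensorProduct.rid k (C ⊗[k] D) ((tensorFunctional f f').lTensor (C ⊗[k] D)
        (TensorProduct.AlgebraTensorModule.tensorTensorTensorComm k k k k C C D D (s ⊗ₜ[k] t))) =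
      TensorProduct.rid k C (f.lTensor C s) ⊗ₜ[k] TensorProduct.rid k D (f'.lTensor D t) := by
    intro s t
    induction s using TensorProduct.induction_on with
    | zero => simp
    | add a b ha hb => simp only [map_add, TensorProduct.add_tmul, ha, hb]
    | tmul a b =>
      induction t using TensorProduct.induction_on with
      | zero => simp
      | add a b ha hb => simp only [map_add, TensorProduct.tmul_add, ha, hb]
      | tmul c d => simp [TensorProduct.smul_tmul', TensorProduct.tmul_smul, smul_smul, mul_comm]
  simp only [rightAct, LinearMap.comp_apply, LinearEquiv.coe_coe, TensorProduct.comul_tmul, h1]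

theorem leftAct_tensor (f : C →ₗ[k] k) (f' : D →ₗ[k] k) (c : C) (d : D) :
    leftAct (tensorFunctional f f') (c ⊗ₜ[k] d) = leftAct f c ⊗ₜ[k] leftAct f' d := by
  have h1 : ∀ (s : C ⊗[k] C) (t : D ⊗[k] D),
      TensorProduct.lid k (C ⊗[k] D) ((tensorFunctional f f').rTensor (C ⊗[k] D)
        (TensorProduct.AlgebraTensorModule.tensorTensorTensorComm k k k k C C D D (s ⊗ₜ[k] t))) =
      TensorProduct.lid k C (f.rTensor C s) ⊗ₜ[k] TensorProduct.lid k D (f'.rTensor D t) := by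
    intro s t
    induction s using TensorProduct.induction_on with
    | zero => simp
    | add a b ha hb => simp only [map_add, TensorProduct.add_tmul, ha, hb]
    | tmul a b =>
      induction t using TensorProduct.induction_on with
      | zero => simp
      | add a b ha hb => simp only [map_add, TensorProduct.tmul_add, ha, hb]
      | tmul c d => simp [TensorProduct.smul_tmul', TensorProduct.tmul_smul, smul_smul, mul_comm]
  simp only [leftAct, LinearMap.comp_apply, LinearEquiv.coe_coe, TensorProduct.comul_tmul, h1]

/-- Acting on opposite tensor factors, functionals commute under convolution. -/
theorem tensorFunctional_convolution_comm (f : C →ₗ[k] k) (f' : D →ₗ[k] k) (z : C ⊗[k] D) :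
    tensorFunctional f (Coalgebra.counit (R := k))
        (rightAct (tensorFunctional (Coalgebra.counit (R := k)) f') z) =
      tensorFunctional (Coalgebra.counit (R := k)) f'
        (rightAct (tensorFunctional f (Coalgebra.counit (R := k))) z) := by
  induction z using TensorProduct.induction_on with
  | zero => simp
  | add a b ha hb => simp only [map_add, ha, hb]
  | tmul c d => simp only [rightAct_tensor, rightAct_counit, tensorFunctional_tmul, counit_rightAct]

end Module

end CoalgebraAction

/-! ### Coordinates in an eigenbasis. -/

section Coordinates

variable {k : Type u} [Field k]

/-- A diagonal operator turns a vector identity into one scalar equation per coordinate; group-like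
and skew primitive elements are located in this way. -/
theorem Module.Basis.repr_apply_of_diagonal {ι V : Type*} [AddCommGroup V] [Module k V]
    (b : Module.Basis ι k V) {T : V →ₗ[k] V} {ev : ι → k} (hT : ∀ i, T (b i) = ev i • b i)
    (v : V) (i : ι) : b.repr (T v) i = ev i * b.repr v i := by
  have : (b.coord i) ∘ₗ T = ev i • b.coord i := by
    refine b.ext fun j => ?_
    by_cases hij : j = i
    · subst hij; simp [hT]
    · simp [hT, hij]
  exact LinearMap.congr_fun this v

end Coordinates

/-! ### Characters, skew derivations and the monomial basis of a Taft algebra. -/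

namespace TaftAlgebra

variable {k : Type u} [Field k] {q : k} {m : ℕ}

/-- The Taft algebra is generated by left multiplications by `h` and `x` from `1`. -/
theorem induction_left {P : TaftAlgebra q m → Prop} (one : P 1)
    (h_mul : ∀ a, P a → P (h q m * a)) (x_mul : ∀ a, P a → P (x q m * a))
    (smul : ∀ (c : k) a, P a → P (c • a)) (add : ∀ a b, P a → P b → P (a + b))
    (a : TaftAlgebra q m) : P a := by
  suffices H : ∀ b, P b → P (a * b) by simpa using H 1 one
  induction a using TaftAlgebra.induction with
  | scalar c => intro b hb; rw [← Algebra.smul_def]; exact smul c b hb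
  | gen_h => exact h_mul
  | gen_x => exact x_mul
  | mul a b ha hb => intro c hc; rw [mul_assoc]; exact ha _ (hb _ hc)
  | add a b ha hb => intro c hc; rw [add_mul]; exact add _ _ (ha _ hc) (hb _ hc)

/-- The rescaling endomorphism `h ↦ s h`, `x ↦ t x`, where `s ^ m = 1`. -/
noncomputable def scale (s t : k) (hs : s ^ m = 1) : TaftAlgebra q m →ₐ[k] TaftAlgebra q m :=
  lift (s • h q m) (t • x q m) (by rw [smul_pow, h_pow, hs, one_smul])
    (by rw [smul_pow, x_pow, smul_zero])
    (by rw [smul_mul_smul_comm, x_mul_h, smul_mul_smul_comm, smul_comm, mul_comm t])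

theorem scale_h (s t : k) (hs : s ^ m = 1) : scale s t hs (h q m) = s • h q m := lift_h ..

theorem scale_x (s t : k) (hs : s ^ m = 1) : scale s t hs (x q m) = t • x q m := lift_x ..

theorem scale_monomial (s t : k) (hs : s ^ m = 1) (a i : ℕ) :
    scale s t hs (h q m ^ a * x q m ^ i) = (s ^ a * t ^ i) • (h q m ^ a * x q m ^ i) := by
  rw [map_mul, map_pow, map_pow, scale_h, scale_x, smul_pow, smul_pow, smul_mul_smul_comm]

theorem x_mul_h_pow (a : ℕ) : x q m * h q m ^ a = q ^ a • (h q m ^ a * x q m) :=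
  mul_pow_of_qComm (x_mul_h q m) a

/-- The two-dimensional representation `h ↦ diag (1, q)`, `x ↦ E₁₂`. -/
noncomputable def rep (hm : 2 ≤ m) (hq : q ^ m = 1) :
    TaftAlgebra q m →ₐ[k] Matrix (Fin 2) (Fin 2) k :=
  lift (Matrix.diagonal ![1, q]) !![0, 1; 0, 0]
    (by
      rw [Matrix.diagonal_pow, ← Matrix.diagonal_one]
      congr 1
      ext i
      fin_cases i <;> simp [hq])
    (by
      obtain ⟨l, rfl⟩ := Nat.exists_eq_add_of_le hm
      have h0 : (!![0, 1; 0, 0] : Matrix (Fin 2) (Fin 2) k) * !![0, 1; 0, 0] = 0 := by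
        ext i j; fin_cases i <;> fin_cases j <;> simp
      rw [pow_add, pow_two, h0, zero_mul])
    (by ext i j; fin_cases i <;> fin_cases j <;> simp [Matrix.diagonal, Matrix.mul_apply])

theorem rep_h (hm : 2 ≤ m) (hq : q ^ m = 1) :
    rep hm hq (h q m) = Matrix.diagonal ![1, q] := lift_h ..

theorem rep_x (hm : 2 ≤ m) (hq : q ^ m = 1) : rep hm hq (x q m) = !![0, 1; 0, 0] := lift_x ..

/-- The character `h ↦ q`, `x ↦ 0`. -/
noncomputable def character (q : k) (hm : m ≠ 0) (hq : q ^ m = 1) : TaftAlgebra q m →ₐ[k] k :=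
  lift q 0 hq (zero_pow hm) (by simp)

theorem character_h (hm : m ≠ 0) (hq : q ^ m = 1) : character q hm hq (h q m) = q := lift_h ..

theorem character_x (hm : m ≠ 0) (hq : q ^ m = 1) : character q hm hq (x q m) = 0 := lift_x ..

/-- The skew derivation `ε`-`χ` with `h ↦ 0`, `x ↦ 1`, as a matrix coefficient. -/
noncomputable def skewDer (hm : 2 ≤ m) (hq : q ^ m = 1) : TaftAlgebra q m →ₗ[k] k :=
  Matrix.entryLinearMap k k 0 1 ∘ₗ (rep hm hq).toLinearMap

theorem skewDer_h_mul (hm : 2 ≤ m) (hq : q ^ m = 1) (a : TaftAlgebra q m) :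
    skewDer hm hq (h q m * a) = skewDer hm hq a := by
  simp [skewDer, rep_h]

/-- The representation is upper triangular, so its diagonal entries are characters; this one appears
in the product rule of `skewDer`. -/
theorem rep_one_one (hm : 2 ≤ m) (hq : q ^ m = 1) (a : TaftAlgebra q m) :
    rep hm hq a 1 1 = character q (by omega) hq a := by
  induction a using induction_left with
  | one => simp
  | h_mul a ha => simp [rep_h, character_h, ha]
  | x_mul a ha => simp only [map_mul, rep_x, character_x, Matrix.mul_apply, Fin.sum_univ_two]; simp
  | smul c a ha => simp [ha]
  | add a b ha hb => simp [ha, hb]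

theorem skewDer_x_mul (hm : 2 ≤ m) (hq : q ^ m = 1) (a : TaftAlgebra q m) :
    skewDer hm hq (x q m * a) = character q (by omega) hq a := by
  rw [← rep_one_one hm hq]
  show rep hm hq (x q m * a) 0 1 = _
  rw [map_mul, rep_x, Matrix.mul_apply, Fin.sum_univ_two]
  simp

theorem skewDer_h_pow (hm : 2 ≤ m) (hq : q ^ m = 1) (a : ℕ) :
    skewDer hm hq (h q m ^ a) = 0 := by
  induction a with
  | zero => simp [skewDer]
  | succ a ih => rw [pow_succ', skewDer_h_mul, ih]

theorem skewDer_one (hm : 2 ≤ m) (hq : q ^ m = 1) : skewDer hm hq 1 = 0 := by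
  simpa using skewDer_h_pow hm hq 0

theorem skewDer_x (hm : 2 ≤ m) (hq : q ^ m = 1) : skewDer hm hq (x q m) = 1 := by
  have := skewDer_x_mul hm hq 1
  rwa [mul_one, map_one] at this

section Hopf

variable [NeZero m] [hq : Fact (IsPrimitiveRoot q m)]

theorem comul_h : Coalgebra.comul (R := k) (h q m) = h q m ⊗ₜ[k] h q m :=
  comulHom_h q m hq.out

theorem comul_x : Coalgebra.comul (R := k) (x q m) = x q m ⊗ₜ[k] h q m + 1 ⊗ₜ[k] x q m :=
  comulHom_x q m hq.out

theorem counit_h : Coalgebra.counit (R := k) (h q m) = 1 := counitHom_h q m (NeZero.ne m)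

theorem counit_x : Coalgebra.counit (R := k) (x q m) = 0 := counitHom_x q m (NeZero.ne m)

theorem isGroupLikeElem_h : IsGroupLikeElem k (h q m) := ⟨counit_h, comul_h⟩

theorem one_ne_zero' : (1 : TaftAlgebra q m) ≠ 0 := fun h0 => by
  have := congrArg (Coalgebra.counit (R := k)) h0
  simp at this

instance : Nontrivial (TaftAlgebra q m) := ⟨⟨1, 0, one_ne_zero'⟩⟩

theorem rightAct_h_mul (f : TaftAlgebra q m →ₗ[k] k) (a : TaftAlgebra q m) :
    rightAct f (h q m * a) = h q m * rightAct (f ∘ₗ LinearMap.mulLeft k (h q m)) a := by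
  simp only [rightAct, LinearMap.comp_apply, Bialgebra.comul_mul, comul_h, LinearEquiv.coe_coe]
  induction Coalgebra.comul (R := k) a using TensorProduct.induction_on with
  | zero => simp
  | tmul a b => simp
  | add a b ha hb => rw [mul_add, map_add, map_add, ha, hb, map_add, map_add, mul_add]

theorem rightAct_x_mul (f : TaftAlgebra q m →ₗ[k] k) (a : TaftAlgebra q m) :
    rightAct f (x q m * a) = x q m * rightAct (f ∘ₗ LinearMap.mulLeft k (h q m)) a +
      rightAct (f ∘ₗ LinearMap.mulLeft k (x q m)) a := by
  simp only [rightAct, LinearMap.comp_apply, Bialgebra.comul_mul, comul_x, LinearEquiv.coe_coe]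
  induction Coalgebra.comul (R := k) a using TensorProduct.induction_on with
  | zero => simp
  | tmul a b => simp [add_mul]
  | add a b ha hb =>
    rw [mul_add, map_add, map_add, ha, hb]
    simp only [map_add, mul_add]
    abel

theorem leftAct_h_mul (f : TaftAlgebra q m →ₗ[k] k) (a : TaftAlgebra q m) :
    leftAct f (h q m * a) = h q m * leftAct (f ∘ₗ LinearMap.mulLeft k (h q m)) a := by
  simp only [leftAct, LinearMap.comp_apply, Bialgebra.comul_mul, comul_h, LinearEquiv.coe_coe]
  induction Coalgebra.comul (R := k) a using TensorProduct.induction_on with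
  | zero => simp
  | tmul a b => simp
  | add a b ha hb => rw [mul_add, map_add, map_add, ha, hb, map_add, map_add, mul_add]

theorem leftAct_x_mul (f : TaftAlgebra q m →ₗ[k] k) (a : TaftAlgebra q m) :
    leftAct f (x q m * a) = h q m * leftAct (f ∘ₗ LinearMap.mulLeft k (x q m)) a +
      x q m * leftAct f a := by
  simp only [leftAct, LinearMap.comp_apply, Bialgebra.comul_mul, comul_x, LinearEquiv.coe_coe]
  induction Coalgebra.comul (R := k) a using TensorProduct.induction_on with
  | zero => simp
  | tmul a b => simp [add_mul]
  | add a b ha hb =>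
    rw [mul_add, map_add, map_add, ha, hb]
    simp only [map_add, mul_add]
    abel

theorem rightAct_smul (c : k) (f : TaftAlgebra q m →ₗ[k] k) (a : TaftAlgebra q m) :
    rightAct (c • f) a = c • rightAct f a := by
  simp [rightAct, LinearMap.lTensor_smul]

theorem rightAct_zero (a : TaftAlgebra q m) :
    rightAct (0 : TaftAlgebra q m →ₗ[k] k) a = 0 := by
  simp [rightAct]

theorem leftAct_smul (c : k) (f : TaftAlgebra q m →ₗ[k] k) (a : TaftAlgebra q m) :
    leftAct (c • f) a = c • leftAct f a := by
  simp [leftAct, LinearMap.rTensor_smul]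

theorem leftAct_zero (a : TaftAlgebra q m) :
    leftAct (0 : TaftAlgebra q m →ₗ[k] k) a = 0 := by
  simp [leftAct]

/-- The character `h ↦ q`, `x ↦ 0` as a functional. -/
noncomputable def chi (q : k) (m : ℕ) [NeZero m] [hq : Fact (IsPrimitiveRoot q m)] :
    TaftAlgebra q m →ₗ[k] k :=
  (character q (NeZero.ne m) hq.out.pow_eq_one).toLinearMap

theorem chi_one : chi q m 1 = 1 := by simp [chi]

theorem chi_h : chi q m (h q m) = q := by simp [chi, character_h]

theorem chi_comp_h : chi q m ∘ₗ LinearMap.mulLeft k (h q m) = q • chi q m := by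
  ext a; simp [chi, character_h]

theorem chi_comp_x : chi q m ∘ₗ LinearMap.mulLeft k (x q m) = 0 := by
  ext a; simp [chi, character_x]

theorem rightAct_one (f : TaftAlgebra q m →ₗ[k] k) : rightAct f 1 = f 1 • 1 := by
  simp [rightAct, Algebra.TensorProduct.one_def]

theorem leftAct_one (f : TaftAlgebra q m →ₗ[k] k) : leftAct f 1 = f 1 • 1 := by
  simp [leftAct, Algebra.TensorProduct.one_def]

/-- The right action scales `h` and `x` alike, the left action scales only `h`. Their discrepancy
detects the exponent of `x`. -/
theorem rightAct_chi (a : TaftAlgebra q m) :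
    rightAct (chi q m) a = scale q q hq.out.pow_eq_one a := by
  induction a using induction_left with
  | one => simp [rightAct_one, chi]
  | h_mul a ha => simp [rightAct_h_mul, chi_comp_h, rightAct_smul, scale_h, ha]
  | x_mul a ha =>
    simp [rightAct_x_mul, chi_comp_h, chi_comp_x, rightAct_smul, rightAct_zero, scale_x, ha]
  | smul c a ha => simp [ha]
  | add a b ha hb => simp [ha, hb]

theorem leftAct_chi (a : TaftAlgebra q m) :
    leftAct (chi q m) a = scale q 1 hq.out.pow_eq_one a := by
  induction a using induction_left with
  | one => simp [leftAct_one, chi]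
  | h_mul a ha => simp [leftAct_h_mul, chi_comp_h, leftAct_smul, scale_h, ha]
  | x_mul a ha => simp [leftAct_x_mul, chi_comp_x, leftAct_zero, scale_x, ha]
  | smul c a ha => simp [ha]
  | add a b ha hb => simp [ha, hb]

variable (hm : 2 ≤ m)

theorem rightAct_skewDer_h_mul (a : TaftAlgebra q m) :
    rightAct (skewDer hm hq.out.pow_eq_one) (h q m * a) =
      h q m * rightAct (skewDer hm hq.out.pow_eq_one) a := by
  rw [rightAct_h_mul]
  have : skewDer hm hq.out.pow_eq_one ∘ₗ LinearMap.mulLeft k (h q m) =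
      skewDer hm hq.out.pow_eq_one := by
    ext a; simp [skewDer_h_mul]
  rw [this]

/-- A twisted Leibniz rule: the action of `skewDer` is a `q`-derivative in the variable `x`. -/
theorem rightAct_skewDer_x_mul (a : TaftAlgebra q m) :
    rightAct (skewDer hm hq.out.pow_eq_one) (x q m * a) =
      x q m * rightAct (skewDer hm hq.out.pow_eq_one) a + scale q q hq.out.pow_eq_one a := by
  have h1 : skewDer hm hq.out.pow_eq_one ∘ₗ LinearMap.mulLeft k (h q m) =
      skewDer hm hq.out.pow_eq_one := by
    ext a; simp [skewDer_h_mul]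
  have h2 : skewDer hm hq.out.pow_eq_one ∘ₗ LinearMap.mulLeft k (x q m) = chi q m := by
    ext a; simp [skewDer_x_mul, chi]
  rw [rightAct_x_mul, ← rightAct_chi, h1, h2]

theorem rightAct_skewDer_one : rightAct (skewDer hm hq.out.pow_eq_one) (1 : TaftAlgebra q m) = 0 := by
  have := skewDer_h_pow hm hq.out.pow_eq_one 0
  rw [pow_zero] at this
  rw [rightAct_one, this, zero_smul]

theorem rightAct_skewDer_x_pow (i : ℕ) :
    rightAct (skewDer hm hq.out.pow_eq_one) (x q m ^ i) = qInt q i • x q m ^ (i - 1) := by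
  induction i with
  | zero => simp [rightAct_skewDer_one, qInt]
  | succ i ih =>
    rw [pow_succ', rightAct_skewDer_x_mul, ih, map_pow, scale_x, smul_pow, mul_smul_comm,
      ← pow_succ', Nat.add_sub_cancel, qInt, qInt, Finset.sum_range_succ, add_smul]
    -- For `i = 0` the truncated exponent `i - 1` does no harm, since the `q`-integer is zero.
    congr 1
    cases i <;> simp

theorem qInt_ne_zero {i : ℕ} (h0 : 0 < i) (hi : i < m) : qInt q i ≠ 0 := by
  obtain ⟨j, rfl⟩ : ∃ j, i = j + 1 := ⟨i - 1, by omega⟩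
  have := qFact_ne_zero hq.out hi
  rw [qFact_succ] at this
  exact right_ne_zero_of_mul this

-- The `q`-derivative lowers the exponent, with a `q`-integer factor that does not vanish below `m`.
include hm in
theorem x_pow_ne_zero {i : ℕ} (hi : i < m) : x q m ^ i ≠ 0 := by
  induction i with
  | zero => simp
  | succ i ih =>
    intro h0
    have h1 := rightAct_skewDer_x_pow (q := q) hm (i + 1)
    rw [h0, map_zero, Nat.add_sub_cancel] at h1
    exact smul_ne_zero (qInt_ne_zero (Nat.succ_pos i) hi) (ih (by omega)) h1.symm

theorem isUnit_h : IsUnit (h q m) :=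
  ⟨⟨h q m, h q m ^ (m - 1), h_mul_h_pow q m (NeZero.ne m), h_pow_mul_h q m (NeZero.ne m)⟩, rfl⟩

/-- The monomials `h ^ a * x ^ i`. -/
noncomputable def monomial (q : k) (m : ℕ) (I : Fin m × Fin m) : TaftAlgebra q m :=
  h q m ^ (I.1 : ℕ) * x q m ^ (I.2 : ℕ)

-- The monomials are eigenvectors of `h ↦ q h`, `x ↦ 2 x`. The `m`-th power of the eigenvalue `q ^ a
-- * 2 ^ i` determines `i` in characteristic zero, and then `q ^ a` determines `a`.
include hm in
theorem linearIndependent_monomial [CharZero k] : LinearIndependent k (monomial q m) := by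
  refine Module.End.eigenvectors_linearIndependent'
    (scale (q := q) q 2 hq.out.pow_eq_one).toLinearMap
    (fun I : Fin m × Fin m => q ^ (I.1 : ℕ) * 2 ^ (I.2 : ℕ)) ?_ _ fun I => ?_
  · rintro ⟨a, i⟩ ⟨b, j⟩ hab
    dsimp only at hab
    have h1 := congrArg (· ^ m) hab
    simp only [mul_pow, ← pow_mul, mul_comm _ m] at h1
    simp only [pow_mul, hq.out.pow_eq_one, one_pow, one_mul] at h1
    have h2 : (2 : ℕ) ^ (m * i) = 2 ^ (m * j) := by
      have : (((2 : ℕ) ^ (m * i) : ℕ) : k) = ((2 ^ (m * j) : ℕ) : k) := by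
        push_cast; rw [pow_mul, pow_mul]; exact h1
      exact_mod_cast this
    have h3 : m * i = m * j := Nat.pow_right_injective le_rfl h2
    have h4 : (i : ℕ) = j := Nat.eq_of_mul_eq_mul_left (by omega) h3
    rw [h4] at hab
    have h5 := mul_right_cancel₀ (pow_ne_zero _ two_ne_zero) hab
    have h6 := hq.out.pow_inj a.2 b.2 h5
    exact Prod.ext (Fin.ext h6) (Fin.ext h4)
  · rw [Module.End.hasEigenvector_iff, Module.End.mem_eigenspace_iff]
    refine ⟨scale_monomial .., fun h0 => x_pow_ne_zero (q := q) hm I.2.2 ?_⟩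
    exact (isUnit_h.pow _).mul_right_eq_zero.mp h0

/-- The span contains `1` and is stable under left multiplication by both generators. -/
theorem span_monomial : ⊤ ≤ Submodule.span k (Set.range (monomial q m)) := by
  have key : ∀ a i : ℕ, h q m ^ a * x q m ^ i ∈ Submodule.span k (Set.range (monomial q m)) := by
    intro a i
    have h1 : h q m ^ a = h q m ^ (a % m) := by
      conv_lhs => rw [← Nat.div_add_mod a m, pow_add, pow_mul, h_pow, one_pow, one_mul]
    rcases lt_or_ge i m with hi | hi
    · rw [h1]
      exact Submodule.subset_span
        ⟨(⟨a % m, Nat.mod_lt _ (Nat.pos_of_ne_zero (NeZero.ne m))⟩, ⟨i, hi⟩), rfl⟩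
    · obtain ⟨j, rfl⟩ := Nat.exists_eq_add_of_le hi
      rw [pow_add (x q m), x_pow, zero_mul, mul_zero]
      exact Submodule.zero_mem _
  have stable : ∀ y, (∀ a i : ℕ, y * (h q m ^ a * x q m ^ i) ∈
      Submodule.span k (Set.range (monomial q m))) →
      ∀ z ∈ Submodule.span k (Set.range (monomial q m)),
        y * z ∈ Submodule.span k (Set.range (monomial q m)) := by
    intro y hy z hz
    have := Submodule.map_span_le (LinearMap.mulLeft k y) (Set.range (monomial q m))
      (Submodule.span k (Set.range (monomial q m)))
    refine this.mpr ?_ (Submodule.mem_map_of_mem hz)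
    rintro _ ⟨I, rfl⟩
    exact hy _ _
  rintro a -
  induction a using induction_left with
  | one => simpa using key 0 0
  | h_mul a ha =>
    refine stable _ (fun a i => ?_) a ha
    rw [← mul_assoc, ← pow_succ']
    exact key _ _
  | x_mul a ha =>
    refine stable _ (fun a i => ?_) a ha
    rw [← mul_assoc, x_mul_h_pow, smul_mul_assoc, mul_assoc, ← pow_succ']
    exact Submodule.smul_mem _ _ (key _ _)
  | smul c a ha => exact Submodule.smul_mem _ _ ha
  | add a b ha hb => exact Submodule.add_mem _ ha hb

/-- The basis `h ^ a * x ^ i`, `0 ≤ a, i < m`, of the Taft algebra. -/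
noncomputable def monomialBasis [CharZero k] : Module.Basis (Fin m × Fin m) k (TaftAlgebra q m) :=
  Module.Basis.mk (linearIndependent_monomial hm) span_monomial

theorem monomialBasis_apply [CharZero k] (I : Fin m × Fin m) :
    monomialBasis (q := q) hm I = h q m ^ (I.1 : ℕ) * x q m ^ (I.2 : ℕ) :=
  Module.Basis.mk_apply ..

end Hopf

end TaftAlgebra

/-! ### Group-like and skew primitive elements of a tensor product of Taft algebras. -/

namespace TaftAlgebra

section TensorCoalgebra

variable {k : Type u} [Field k] [CharZero k] {p q : k} {n m : ℕ} [NeZero n] [NeZero m]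
  [hp : Fact (IsPrimitiveRoot p n)] [hq : Fact (IsPrimitiveRoot q m)] (hn : 2 ≤ n) (hm : 2 ≤ m)

/-- The monomial basis of the tensor product of two Taft algebras. -/
noncomputable def tensorBasis : Module.Basis ((Fin n × Fin n) × (Fin m × Fin m)) k
    (TaftAlgebra p n ⊗[k] TaftAlgebra q m) :=
  (monomialBasis hn).tensorProduct (monomialBasis hm)

theorem tensorBasis_apply (I : (Fin n × Fin n) × (Fin m × Fin m)) :
    tensorBasis (p := p) (q := q) hn hm I = (h p n ^ (I.1.1 : ℕ) * x p n ^ (I.1.2 : ℕ)) ⊗ₜ[k]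
      (h q m ^ (I.2.1 : ℕ) * x q m ^ (I.2.2 : ℕ)) := by
  rw [tensorBasis, Module.Basis.tensorProduct_apply, monomialBasis_apply, monomialBasis_apply]

/-- Here and in the next three lemmas the eigenvalues on `h ^ a * x ^ i ⊗ h ^ b * x ^ j` are `p ^ (a
+ i)`, `p ^ a`, `q ^ (b + j)` and `q ^ b`; together they separate the monomials. -/
theorem repr_rightAct_chi_left (z : TaftAlgebra p n ⊗[k] TaftAlgebra q m)
    (I : (Fin n × Fin n) × (Fin m × Fin m)) :
    (tensorBasis hn hm).repr
        (rightAct (tensorFunctional (chi p n) (Coalgebra.counit (R := k))) z) I =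
      (p ^ (I.1.1 : ℕ) * p ^ (I.1.2 : ℕ)) * (tensorBasis hn hm).repr z I :=
  (tensorBasis hn hm).repr_apply_of_diagonal
    (ev := fun I => p ^ (I.1.1 : ℕ) * p ^ (I.1.2 : ℕ)) (fun I => by
    rw [tensorBasis_apply, rightAct_tensor, rightAct_counit, rightAct_chi, scale_monomial,
      TensorProduct.smul_tmul']) z I

theorem repr_leftAct_chi_left (z : TaftAlgebra p n ⊗[k] TaftAlgebra q m)
    (I : (Fin n × Fin n) × (Fin m × Fin m)) :
    (tensorBasis hn hm).repr
        (leftAct (tensorFunctional (chi p n) (Coalgebra.counit (R := k))) z) I =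
      p ^ (I.1.1 : ℕ) * (tensorBasis hn hm).repr z I :=
  (tensorBasis hn hm).repr_apply_of_diagonal
    (ev := fun I => p ^ (I.1.1 : ℕ)) (fun I => by
    rw [tensorBasis_apply, leftAct_tensor, leftAct_counit, leftAct_chi, scale_monomial,
      TensorProduct.smul_tmul', one_pow, mul_one]) z I

theorem repr_rightAct_chi_right (z : TaftAlgebra p n ⊗[k] TaftAlgebra q m)
    (I : (Fin n × Fin n) × (Fin m × Fin m)) :
    (tensorBasis hn hm).repr
        (rightAct (tensorFunctional (Coalgebra.counit (R := k)) (chi q m)) z) I =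
      (q ^ (I.2.1 : ℕ) * q ^ (I.2.2 : ℕ)) * (tensorBasis hn hm).repr z I :=
  (tensorBasis hn hm).repr_apply_of_diagonal
    (ev := fun I => q ^ (I.2.1 : ℕ) * q ^ (I.2.2 : ℕ)) (fun I => by
    rw [tensorBasis_apply, rightAct_tensor, rightAct_counit, rightAct_chi, scale_monomial,
      TensorProduct.tmul_smul]) z I

theorem repr_leftAct_chi_right (z : TaftAlgebra p n ⊗[k] TaftAlgebra q m)
    (I : (Fin n × Fin n) × (Fin m × Fin m)) :
    (tensorBasis hn hm).repr
        (leftAct (tensorFunctional (Coalgebra.counit (R := k)) (chi q m)) z) I =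
      q ^ (I.2.1 : ℕ) * (tensorBasis hn hm).repr z I :=
  (tensorBasis hn hm).repr_apply_of_diagonal
    (ev := fun I => q ^ (I.2.1 : ℕ)) (fun I => by
    rw [tensorBasis_apply, leftAct_tensor, leftAct_counit, leftAct_chi, scale_monomial,
      TensorProduct.tmul_smul, one_pow, mul_one]) z I

theorem pow_fin_inj {a b : Fin m} (hab : q ^ (a : ℕ) = q ^ (b : ℕ)) : a = b :=
  Fin.ext (hq.out.pow_inj a.2 b.2 hab)

theorem pow_fin_eq_one {a : Fin m} (ha : q ^ (a : ℕ) = 1) : a = 0 :=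
  pow_fin_inj (q := q) (by simpa using ha)

/-- The group-like elements of the tensor product of two Taft algebras. -/
theorem groupLike_tensor {g : TaftAlgebra p n ⊗[k] TaftAlgebra q m} (hg : IsGroupLikeElem k g) :
    ∃ (a : Fin n) (b : Fin m), g = tensorBasis hn hm ((a, 0), (b, 0)) := by
  set B := tensorBasis (p := p) (q := q) hn hm with hB
  have e1 : ∀ I, _ := fun I => repr_rightAct_chi_left hn hm g I
  have e2 : ∀ I, _ := fun I => repr_leftAct_chi_left hn hm g I
  have e3 : ∀ I, _ := fun I => repr_rightAct_chi_right hn hm g I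
  have e4 : ∀ I, _ := fun I => repr_leftAct_chi_right hn hm g I
  simp only [rightAct_groupLike hg, leftAct_groupLike hg, map_smul, Finsupp.smul_apply,
    smul_eq_mul, ← hB] at e1 e2 e3 e4
  have hp0 : p ≠ 0 := hp.out.ne_zero (NeZero.ne n)
  have hq0 : q ≠ 0 := hq.out.ne_zero (NeZero.ne m)
  -- Left and right actions multiply `g` by the same scalar, so `p ^ (a + i) = p ^ a` on the support
  -- and `i = 0`; likewise for the second factor.
  have key : ∀ I, B.repr g I ≠ 0 →
      I.1.2 = 0 ∧ I.2.2 = 0 ∧ p ^ (I.1.1 : ℕ) = tensorFunctional (chi p n) Coalgebra.counit g ∧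
        q ^ (I.2.1 : ℕ) = tensorFunctional Coalgebra.counit (chi q m) g := by
    intro I hI
    have f1 := mul_right_cancel₀ hI (e1 I)
    have f2 := mul_right_cancel₀ hI (e2 I)
    have f3 := mul_right_cancel₀ hI (e3 I)
    have f4 := mul_right_cancel₀ hI (e4 I)
    rw [f2, eq_comm, mul_eq_left₀ (pow_ne_zero _ hp0)] at f1
    rw [f4, eq_comm, mul_eq_left₀ (pow_ne_zero _ hq0)] at f3
    exact ⟨pow_fin_eq_one f1, pow_fin_eq_one f3, f2.symm, f4.symm⟩
  obtain ⟨⟨⟨a, i⟩, ⟨b, j⟩⟩, hI⟩ : ∃ I, B.repr g I ≠ 0 := by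
    by_contra! h0
    refine hg.ne_zero (B.repr.injective ?_)
    ext I
    simp [h0 I]
  obtain ⟨k1, k2, k3, k4⟩ := key _ hI
  dsimp only at k1 k2 k3 k4
  subst k1 k2
  have hsupp : ((B.repr g).support : Set ((Fin n × Fin n) × (Fin m × Fin m))) ⊆
      {((a, 0), (b, 0))} := by
    intro J hJ
    obtain ⟨j1, j2, j3, j4⟩ := key J (Finsupp.mem_support_iff.mp hJ)
    rw [← k3] at j3
    rw [← k4] at j4
    exact Prod.ext (Prod.ext (pow_fin_inj j3) j1) (Prod.ext (pow_fin_inj j4) j2)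
  rw [← B.mem_span_image, Set.image_singleton, Submodule.mem_span_singleton] at hsupp
  obtain ⟨c, hc⟩ := hsupp
  refine ⟨a, b, ?_⟩
  have h1 := hg.counit_eq_one
  rw [← hc, hB, tensorBasis_apply] at h1
  have : c = 1 := by simpa [Bialgebra.counit_pow, counit_h] using h1
  rw [← hc, this, one_smul]

theorem tensorFunctional_skewDer_left (a : ℕ) (f : TaftAlgebra q m →ₗ[k] k) (y : TaftAlgebra q m) :
    tensorFunctional (skewDer hn hp.out.pow_eq_one) f ((h p n ^ a) ⊗ₜ[k] y) = 0 := by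
  rw [tensorFunctional_tmul, skewDer_h_pow, zero_mul]

theorem tensorFunctional_skewDer_right (b : ℕ) (f : TaftAlgebra p n →ₗ[k] k)
    (y : TaftAlgebra p n) :
    tensorFunctional f (skewDer hm hq.out.pow_eq_one) (y ⊗ₜ[k] (h q m ^ b)) = 0 := by
  rw [tensorFunctional_tmul, skewDer_h_pow, mul_zero]

/-- A `(1, g)`-primitive element is a combination of `1`, `g` and one further monomial. -/
theorem skewPrimitive_mem_span {u : Fin n} {v : Fin m}
    {g z : TaftAlgebra p n ⊗[k] TaftAlgebra q m}
    (hguv : g = tensorBasis hn hm ((u, 0), (v, 0)))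
    (hz : Coalgebra.comul (R := k) z = z ⊗ₜ[k] g + 1 ⊗ₜ[k] z) :
    ∃ c₀ c₁ c₂ : k, z = c₀ • 1 + c₁ • g +
      c₂ • ((x p n ^ (u : ℕ)) ⊗ₜ[k] (x q m ^ (v : ℕ))) := by
  set B := tensorBasis (p := p) (q := q) hn hm with hB
  have hp0 : p ≠ 0 := hp.out.ne_zero (NeZero.ne n)
  have hq0 : q ≠ 0 := hq.out.ne_zero (NeZero.ne m)
  have hone : (1 : TaftAlgebra p n ⊗[k] TaftAlgebra q m) = B ((0, 0), (0, 0)) := by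
    simp [hB, tensorBasis_apply, Algebra.TensorProduct.one_def]
  have hw : (x p n ^ (u : ℕ)) ⊗ₜ[k] (x q m ^ (v : ℕ)) = B ((0, u), (0, v)) := by
    simp [hB, tensorBasis_apply]
  have g1 : tensorFunctional (chi p n) (Coalgebra.counit (R := k)) g = p ^ (u : ℕ) := by
    simp [hguv, hB, tensorBasis_apply, Bialgebra.counit_pow, counit_h, chi, character_h]
  have g2 : tensorFunctional (Coalgebra.counit (R := k)) (chi q m) g = q ^ (v : ℕ) := by
    simp [hguv, hB, tensorBasis_apply, Bialgebra.counit_pow, counit_h, chi, character_h]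
  have o1 : tensorFunctional (chi p n) (Coalgebra.counit (R := k))
      (1 : TaftAlgebra p n ⊗[k] TaftAlgebra q m) = 1 := by
    simp [Algebra.TensorProduct.one_def, chi_one]
  have o2 : tensorFunctional (Coalgebra.counit (R := k)) (chi q m)
      (1 : TaftAlgebra p n ⊗[k] TaftAlgebra q m) = 1 := by
    simp [Algebra.TensorProduct.one_def, chi_one]
  have e1 : ∀ I, _ := fun I => repr_rightAct_chi_left hn hm z I
  have e2 : ∀ I, _ := fun I => repr_leftAct_chi_left hn hm z I
  have e3 : ∀ I, _ := fun I => repr_rightAct_chi_right hn hm z I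
  have e4 : ∀ I, _ := fun I => repr_leftAct_chi_right hn hm z I
  simp only [rightAct_of_comul_eq hz, leftAct_of_comul_eq hz, map_add, map_smul,
    Finsupp.add_apply, Finsupp.smul_apply, smul_eq_mul, ← hB, g1, g2, o1, o2, one_mul] at e1 e2 e3 e4
  -- Away from the coordinates of `1` and `g`, the left eigenvalues must be `1` and the right ones
  -- must be the characters of `g`, which leaves a single monomial.
  have hsupp : ((B.repr z).support : Set _) ⊆
      {((0, 0), (0, 0)), ((u, 0), (v, 0)), ((0, u), (0, v))} := by
    intro J hJ
    have hJ0 : B.repr z J ≠ 0 := Finsupp.mem_support_iff.mp hJ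
    by_cases hJ1 : J = ((0, 0), (0, 0))
    · exact Or.inl hJ1
    by_cases hJ2 : J = ((u, 0), (v, 0))
    · exact Or.inr (Or.inl hJ2)
    right; right
    have r1 : B.repr (1 : TaftAlgebra p n ⊗[k] TaftAlgebra q m) J = 0 := by
      rw [hone, B.repr_self, Finsupp.single_eq_of_ne hJ1]
    have r2 : B.repr g J = 0 := by
      rw [hguv, B.repr_self, Finsupp.single_eq_of_ne hJ2]
    have f1 := e1 J
    have f2 := e2 J
    have f3 := e3 J
    have f4 := e4 J
    rw [r1, mul_zero, add_zero] at f1 f3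
    rw [r2, mul_zero, zero_add] at f2 f4
    replace f1 := mul_right_cancel₀ hJ0 f1
    replace f3 := mul_right_cancel₀ hJ0 f3
    have f2' := (mul_eq_right₀ hJ0).mp f2.symm
    have f4' := (mul_eq_right₀ hJ0).mp f4.symm
    rw [f2', one_mul] at f1
    rw [f4', one_mul] at f3
    exact Prod.ext (Prod.ext (pow_fin_eq_one f2') (pow_fin_inj f1.symm))
      (Prod.ext (pow_fin_eq_one f4') (pow_fin_inj f3.symm))
  rw [← B.mem_span_image, Set.image_insert_eq, Set.image_insert_eq, Set.image_singleton,
    Submodule.mem_span_triple] at hsupp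
  obtain ⟨c₀, c₁, c₂, hc⟩ := hsupp
  exact ⟨c₀, c₁, c₂, by rw [hone, hguv, hw, hc]⟩

include hn hm in
theorem tensor_x_pow_ne_smul_one {a : Fin n} {b : Fin m} (hab : a ≠ 0 ∨ b ≠ 0) (c d : k)
    (hc : c ≠ 0) : c • ((x p n ^ (a : ℕ)) ⊗ₜ[k] (x q m ^ (b : ℕ))) ≠ d • 1 := by
  intro h0
  have h1 := congrArg (fun t => (tensorBasis (p := p) (q := q) hn hm).repr t ((0, a), (0, b))) h0
  have hone : (1 : TaftAlgebra p n ⊗[k] TaftAlgebra q m) = tensorBasis hn hm ((0, 0), (0, 0)) := by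
    simp [tensorBasis_apply, Algebra.TensorProduct.one_def]
  have hw : (x p n ^ (a : ℕ)) ⊗ₜ[k] (x q m ^ (b : ℕ)) =
      tensorBasis (p := p) (q := q) hn hm ((0, a), (0, b)) := by
    simp [tensorBasis_apply]
  have hne : (((0, a), (0, b)) : (Fin n × Fin n) × (Fin m × Fin m)) ≠ ((0, 0), (0, 0)) := by
    rintro heq
    simp only [Prod.mk.injEq, true_and] at heq
    rcases hab with h | h
    · exact h heq.1
    · exact h heq.2
  simp only [hone, hw, map_smul, Module.Basis.repr_self, Finsupp.smul_apply, Finsupp.single_eq_same,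
    Finsupp.single_eq_of_ne hne, smul_eq_mul, mul_one, mul_zero] at h1
  exact hc h1

include hn hm in
/-- The skew primitive elements of the tensor product of two Taft algebras. -/
theorem skewPrimitive_tensor {g z : TaftAlgebra p n ⊗[k] TaftAlgebra q m}
    (hg : IsGroupLikeElem k g) (hz : Coalgebra.comul (R := k) z = z ⊗ₜ[k] g + 1 ⊗ₜ[k] z) :
    (∃ c : k, z = c • (1 - g)) ∨
    (g = h p n ⊗ₜ 1 ∧ ∃ c c' : k, z = c • (x p n ⊗ₜ 1) + c' • (1 - g)) ∨
    (g = 1 ⊗ₜ h q m ∧ ∃ c c' : k, z = c • (1 ⊗ₜ x q m) + c' • (1 - g)) := by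
  obtain ⟨u, v, huv⟩ := groupLike_tensor hn hm hg
  obtain ⟨c₀, c₁, c₂, hc⟩ := skewPrimitive_mem_span hn hm huv hz
  have hguv : g = (h p n ^ (u : ℕ)) ⊗ₜ[k] (h q m ^ (v : ℕ)) := by
    rw [huv, tensorBasis_apply]; simp
  have hz0 : Coalgebra.counit (R := k) z = 0 := by
    have h1 := rightAct_of_comul_eq hz (Coalgebra.counit (R := k))
    rw [rightAct_counit, hg.counit_eq_one, one_smul, left_eq_add] at h1
    exact (smul_eq_zero.mp h1).resolve_right one_ne_zero
  -- Unless `u = v = 0`, the third term has counit zero, so the vanishing of the counit of `z` ties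
  -- `c₁` to `c₀`.
  have hsum : (u : ℕ) ≠ 0 ∨ (v : ℕ) ≠ 0 ∨ c₂ = 0 → c₁ = -c₀ := by
    intro hcase
    rw [hc] at hz0
    simp only [map_add, map_smul, Bialgebra.counit_one, hg.counit_eq_one,
      TensorProduct.counit_tmul, Bialgebra.counit_pow, counit_x, smul_eq_mul, mul_one] at hz0
    rcases hcase with h' | h' | h'
    · rw [zero_pow h'] at hz0; linear_combination hz0
    · rw [zero_pow h'] at hz0; linear_combination hz0
    · rw [h'] at hz0; linear_combination hz0
  have hr : ∀ f : TaftAlgebra p n ⊗[k] TaftAlgebra q m →ₗ[k] k, f g = 0 → f 1 = 0 →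
      c₂ • rightAct f ((x p n ^ (u : ℕ)) ⊗ₜ[k] (x q m ^ (v : ℕ))) = f z • 1 := by
    intro f hf hf1
    have h1 := rightAct_of_comul_eq hz f
    rw [hf, zero_smul, zero_add] at h1
    conv_lhs at h1 => rw [hc]
    rw [map_add, map_add, map_smul, map_smul, map_smul, rightAct_groupLike hg, hf,
      rightAct_groupLike IsGroupLikeElem.one, hf1] at h1
    simpa using h1
  by_cases hc2 : c₂ = 0
  · left
    refine ⟨c₀, ?_⟩
    rw [hc, hsum (Or.inr (Or.inr hc2)), hc2]
    module
  by_cases hu : (u : ℕ) = 0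
  · by_cases hv : (v : ℕ) = 0
    · left
      refine ⟨0, ?_⟩
      rw [hc, hguv, hu, hv, pow_zero, pow_zero, pow_zero, pow_zero,
        ← Algebra.TensorProduct.one_def] at hz0
      simp only [map_add, map_smul, Bialgebra.counit_one, smul_eq_mul, mul_one] at hz0
      rw [hc, hguv, hu, hv, pow_zero, pow_zero, pow_zero, pow_zero,
        ← Algebra.TensorProduct.one_def, ← add_smul, ← add_smul, hz0, zero_smul, zero_smul]
    · right; right
      -- The skew derivation of the second factor kills `1` and `g` and lowers `x ^ v` to a nonzero
      -- multiple of `x ^ (v - 1)`. The outcome must be a multiple of `1`, so `u = 0` and `v = 1`.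
      have h1 := hr (tensorFunctional (Coalgebra.counit (R := k)) (skewDer hm hq.out.pow_eq_one))
        (by rw [hguv]; exact tensorFunctional_skewDer_right hm _ _ _)
        (by simp [Algebra.TensorProduct.one_def, skewDer_one])
      rw [rightAct_tensor, rightAct_counit, rightAct_skewDer_x_pow, TensorProduct.tmul_smul,
        smul_smul] at h1
      have hlt : (v : ℕ) - 1 < m := by omega
      have h2 := mt (tensor_x_pow_ne_smul_one (p := p) (q := q) hn hm (a := u)
        (b := ⟨(v : ℕ) - 1, hlt⟩) · _ _
        (mul_ne_zero hc2 (qInt_ne_zero (Nat.pos_of_ne_zero hv) v.2))) (not_not.mpr h1)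
      push Not at h2
      have hv1 : (v : ℕ) = 1 := by
        have := congrArg Fin.val h2.2
        simp at this
        omega
      rw [hu, hv1, pow_zero, pow_one] at hguv
      refine ⟨hguv, c₂, c₀, ?_⟩
      rw [hc, hsum (Or.inr (Or.inl hv)), hu, hv1, pow_zero, pow_one]
      module
  · right; left
    have h1 := hr (tensorFunctional (skewDer hn hp.out.pow_eq_one) (Coalgebra.counit (R := k)))
      (by rw [hguv]; exact tensorFunctional_skewDer_left hn _ _ _)
      (by simp [Algebra.TensorProduct.one_def, skewDer_one])
    rw [rightAct_tensor, rightAct_counit, rightAct_skewDer_x_pow, TensorProduct.smul_tmul',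
      smul_smul] at h1
    have hlt : (u : ℕ) - 1 < n := by omega
    have h2 := mt (tensor_x_pow_ne_smul_one (p := p) (q := q) hn hm (a := ⟨(u : ℕ) - 1, hlt⟩)
      (b := v) · _ _
      (mul_ne_zero hc2 (qInt_ne_zero (Nat.pos_of_ne_zero hu) u.2))) (not_not.mpr h1)
    push Not at h2
    have hu1 : (u : ℕ) = 1 := by
      have := congrArg Fin.val h2.1
      simp at this
      omega
    have hv : (v : ℕ) = 0 := by rw [h2.2]; rfl
    rw [hv, hu1, pow_zero, pow_one] at hguv
    refine ⟨hguv, c₂, c₀, ?_⟩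
    rw [hc, hsum (Or.inl hu), hv, hu1, pow_zero, pow_one]
    module

end TensorCoalgebra

end TaftAlgebra

/-! ### Products of sub-bialgebras -/

section MulMap

variable {k : Type u} [Field k] {A B E : Type*} [Ring A] [Bialgebra k A] [Ring B] [Bialgebra k B]
  [Ring E] [Bialgebra k E]

/-- The map `a ⊗ b ↦ i a * j b`. -/
noncomputable def mulMap (i : A →ₐc[k] E) (j : B →ₐc[k] E) : A ⊗[k] B →ₗ[k] E :=
  LinearMap.mul' k E ∘ₗ TensorProduct.map (i : A →ₗ[k] E) (j : B →ₗ[k] E)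

@[simp]
theorem mulMap_tmul (i : A →ₐc[k] E) (j : B →ₐc[k] E) (a : A) (b : B) :
    mulMap i j (a ⊗ₜ[k] b) = i a * j b := by
  simp [mulMap]

theorem mulMap_one (i : A →ₐc[k] E) (j : B →ₐc[k] E) : mulMap i j 1 = 1 := by
  simp [Algebra.TensorProduct.one_def]

/-- Only the multiplicativity of `Δ` on `E` is used: the product map respects coproducts whether or
not the two images commute. -/
theorem comul_mulMap (i : A →ₐc[k] E) (j : B →ₐc[k] E) (z : A ⊗[k] B) :
    Coalgebra.comul (R := k) (mulMap i j z) =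
      TensorProduct.map (mulMap i j) (mulMap i j) (Coalgebra.comul (R := k) z) := by
  induction z using TensorProduct.induction_on with
  | zero => simp
  | add a b ha hb => simp only [map_add, ha, hb]
  | tmul a b =>
    rw [mulMap_tmul, Bialgebra.comul_mul, ← CoalgHomClass.map_comp_comul_apply,
      ← CoalgHomClass.map_comp_comul_apply, TensorProduct.comul_tmul]
    induction Coalgebra.comul (R := k) a using TensorProduct.induction_on with
    | zero => simp
    | add a b ha hb => simp only [map_add, add_mul, TensorProduct.add_tmul, ha, hb]
    | tmul a₁ a₂ =>
      induction Coalgebra.comul (R := k) b using TensorProduct.induction_on with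
      | zero => simp
      | add a b ha hb => simp only [map_add, mul_add, TensorProduct.tmul_add, ha, hb]
      | tmul b₁ b₂ => simp

theorem counit_mulMap (i : A →ₐc[k] E) (j : B →ₐc[k] E) (z : A ⊗[k] B) :
    Coalgebra.counit (R := k) (mulMap i j z) = Coalgebra.counit (R := k) z := by
  induction z using TensorProduct.induction_on with
  | zero => simp
  | add a b ha hb => simp only [map_add, ha, hb]
  | tmul a b => simp [mul_comm]

variable {i : A →ₐc[k] E} {j : B →ₐc[k] E} (hij : Function.Bijective (mulMap i j))

/-- The bijective product map as a coalgebra isomorphism. -/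
noncomputable def mulEquiv : A ⊗[k] B ≃ₗc[k] E :=
  CoalgEquiv.ofBijective (f := ({ mulMap i j with
    counit_comp := LinearMap.ext fun z => counit_mulMap i j z
    map_comp_comul := LinearMap.ext fun z => (comul_mulMap i j z).symm } : A ⊗[k] B →ₗc[k] E)) hij

theorem mulEquiv_apply (z : A ⊗[k] B) : mulEquiv hij z = mulMap i j z := rfl

include hij in
/-- A pair of functionals on the factors defines a functional on the product. -/
theorem exists_product_functional (f : A →ₗ[k] k) (f' : B →ₗ[k] k) :
    ∃ F : E →ₗ[k] k, (∀ a b, F (i a * j b) = f a * f' b) ∧ (∀ a, F (i a) = f a * f' 1) ∧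
      (∀ b, F (j b) = f 1 * f' b) ∧ F 1 = f 1 * f' 1 := by
  refine ⟨tensorFunctional f f' ∘ₗ (LinearEquiv.ofBijective _ hij).symm.toLinearMap, ?_⟩
  have key : ∀ a b, (tensorFunctional f f' ∘ₗ (LinearEquiv.ofBijective _ hij).symm.toLinearMap)
      (i a * j b) = f a * f' b := by
    intro a b
    rw [← tensorFunctional_tmul, ← mulMap_tmul]
    simp only [LinearMap.comp_apply]
    congr 1
    exact (LinearEquiv.ofBijective _ hij).symm_apply_apply _
  refine ⟨key, fun a => ?_, fun b => ?_, ?_⟩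
  · simpa using key a 1
  · simpa using key 1 b
  · simpa using key 1 1

theorem rightAct_mulMap (f : A ⊗[k] B →ₗ[k] k) (F : E →ₗ[k] k) (hF : F ∘ₗ mulMap i j = f)
    (z : A ⊗[k] B) : rightAct F (mulMap i j z) = mulMap i j (rightAct f z) := by
  simp only [rightAct, LinearMap.comp_apply, comul_mulMap, LinearEquiv.coe_coe]
  induction Coalgebra.comul (R := k) z using TensorProduct.induction_on with
  | zero => simp
  | add a b ha hb => simp only [map_add, ha, hb]
  | tmul a b => simp [← hF]

-- Both sides are the convolution of `F` and `G`, taken in the two orders; it is commutative because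
-- they live on opposite tensor factors. This is what compares `α` with `γ⁻¹` in `exists_relations`.
include hij in
theorem product_functional_comm {f : A →ₗ[k] k} {f' : B →ₗ[k] k} {F G : E →ₗ[k] k}
    (hF : ∀ a b, F (i a * j b) = f a * Coalgebra.counit (R := k) b)
    (hG : ∀ a b, G (i a * j b) = Coalgebra.counit (R := k) a * f' b) (w : E) :
    F (rightAct G w) = G (rightAct F w) := by
  obtain ⟨z, rfl⟩ := hij.2 w
  have hF' : F ∘ₗ mulMap i j = tensorFunctional f (Coalgebra.counit (R := k)) := by
    ext a b; simp [hF]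
  have hG' : G ∘ₗ mulMap i j = tensorFunctional (Coalgebra.counit (R := k)) f' := by
    ext a b; simp [hG]
  rw [rightAct_mulMap _ F hF', rightAct_mulMap _ G hG']
  exact (LinearMap.congr_fun hF' _).trans ((tensorFunctional_convolution_comm f f' z).trans
    (LinearMap.congr_fun hG' _).symm)

end MulMap

/-! ### Conjugation and `q`-commutation. -/

section QComm

variable {k : Type u} [Field k] {E : Type*} [Ring E] [Algebra k E]

theorem pow_mul_of_qComm {q : k} {a b : E} (hab : b * a = q • (a * b)) (i : ℕ) :
    b ^ i * a = q ^ i • (a * b ^ i) := by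
  induction i with
  | zero => simp
  | succ i ih =>
    rw [pow_succ', mul_assoc, ih, mul_smul_comm, ← mul_assoc, hab, smul_mul_assoc, smul_smul,
      mul_assoc, ← pow_succ', ← pow_succ]

/-- Conjugation fixes `H`, so the conjugate of `X` still `p`-commutes with `H`. The element `1 - H`
commutes with `H`, and as `p ≠ 1` its coefficient must vanish. -/
theorem qComm_of_conj {u v H X : E} {p c c' : k} (hvu : v * u = 1)
    (hXH : X * H = p • (H * X)) (hH : u * H * v = H) (hX : u * X * v = c • X + c' • (1 - H))
    (hHu : IsUnit H) (hH1 : H ≠ 1) (hp : p ≠ 1) : u * X = c • (X * u) := by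
  have h1 : (u * X * v) * (u * H * v) = p • ((u * H * v) * (u * X * v)) := by
    have : ∀ y z : E, (u * y * v) * (u * z * v) = u * (y * z) * v := by
      intro y z
      calc (u * y * v) * (u * z * v) = u * y * (v * u) * z * v := by noncomm_ring
        _ = u * (y * z) * v := by rw [hvu]; noncomm_ring
    rw [this, this, hXH]
    simp
  rw [hH, hX] at h1
  have h2 : (c' * (1 - p)) • (H * (1 - H)) = 0 := by
    have h3 : (c • X + c' • (1 - H)) * H = c • (X * H) + c' • (H * (1 - H)) := by
      rw [add_mul, smul_mul_assoc, smul_mul_assoc]; congr 2; noncomm_ring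
    rw [h3, hXH, mul_add, mul_smul_comm, mul_smul_comm, smul_add, smul_comm c p, add_right_inj,
      ← sub_eq_zero, smul_smul, ← sub_smul] at h1
    rw [← h1]; congr 1; ring
  rcases smul_eq_zero.mp h2 with h3 | h3
  · have hc' : c' = 0 := (mul_eq_zero.mp h3).resolve_right (sub_ne_zero.mpr hp.symm)
    rw [hc', zero_smul, add_zero] at hX
    calc u * X = u * X * v * u := by rw [mul_assoc, hvu, mul_one]
      _ = c • (X * u) := by rw [hX, smul_mul_assoc]
  · exact absurd (sub_eq_zero.mp (hHu.mul_right_eq_zero.mp h3)).symm hH1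

end QComm

/-- The hypothesis `u * v = 1` keeps the left leg of `1 ⊗ z` equal to `1`, so conjugation preserves
the shape of the coproduct. -/
theorem comul_conj {k : Type u} [Field k] {E : Type*} [Ring E] [Bialgebra k E] {u v g z : E}
    (hu : IsGroupLikeElem k u) (hv : IsGroupLikeElem k v) (huv : u * v = 1)
    (hz : Coalgebra.comul (R := k) z = z ⊗ₜ[k] g + 1 ⊗ₜ[k] z) :
    Coalgebra.comul (R := k) (u * z * v) =
      (u * z * v) ⊗ₜ[k] (u * g * v) + 1 ⊗ₜ[k] (u * z * v) := by
  rw [Bialgebra.comul_mul, Bialgebra.comul_mul, hu.comul_eq_tmul_self, hv.comul_eq_tmul_self, hz,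
    mul_add, add_mul]
  simp [huv]

/-! ### Hopf algebras factoring through two Taft algebras -/

namespace TaftAlgebra

section Factorization

variable {k : Type u} [Field k] [CharZero k] {p q : k} {n m : ℕ} [NeZero n] [NeZero m]
  [hp : Fact (IsPrimitiveRoot p n)] [hq : Fact (IsPrimitiveRoot q m)] (hn : 2 ≤ n) (hm : 2 ≤ m)
  {E : Type*} [Ring E] [Bialgebra k E]
  {i : TaftAlgebra p n →ₐc[k] E} {j : TaftAlgebra q m →ₐc[k] E}
  (hij : Function.Bijective (mulMap i j))

include hn hm hij

/-- The question involves only the coalgebra and the unit, so it transfers through `mulEquiv` to the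
tensor product. -/
theorem skewPrimitive_of_factorization {g z : E}
    (hg : IsGroupLikeElem k g) (hz : Coalgebra.comul (R := k) z = z ⊗ₜ[k] g + 1 ⊗ₜ[k] z) :
    (∃ c : k, z = c • (1 - g)) ∨
    (g = i (h p n) ∧ ∃ c c' : k, z = c • i (x p n) + c' • (1 - g)) ∨
    (g = j (h q m) ∧ ∃ c c' : k, z = c • j (x q m) + c' • (1 - g)) := by
  obtain ⟨g, rfl⟩ := EquivLike.surjective (mulEquiv hij) g
  obtain ⟨z, rfl⟩ := EquivLike.surjective (mulEquiv hij) z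
  rw [isGroupLikeElem_map_equiv] at hg
  have h1 : (mulEquiv hij) 1 = 1 := mulMap_one i j
  have hz' : Coalgebra.comul (R := k) z = z ⊗ₜ[k] g + 1 ⊗ₜ[k] z := by
    have h2 := CoalgHomClass.map_comp_comul_apply (mulEquiv hij).symm ((mulEquiv hij) z)
    rw [hz, ← h1] at h2
    simpa using h2.symm
  rcases skewPrimitive_tensor hn hm hg hz' with ⟨c, hc⟩ | ⟨hg', c, c', hc⟩ | ⟨hg', c, c', hc⟩
  · exact Or.inl ⟨c, by rw [hc, map_smul, map_sub, h1]⟩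
  · refine Or.inr (Or.inl ⟨by simp [hg', mulEquiv_apply], c, c', ?_⟩)
    rw [hc, map_add, map_smul, map_smul, map_sub, h1]
    simp [mulEquiv_apply]
  · refine Or.inr (Or.inr ⟨by simp [hg', mulEquiv_apply], c, c', ?_⟩)
    rw [hc, map_add, map_smul, map_smul, map_sub, h1]
    simp [mulEquiv_apply]

/-- Functionals separating the generators. -/
theorem exists_separating_functionals : ∃ F F' G G' : E →ₗ[k] k,
    (F 1 = 1 ∧ F (i (h p n)) = p ∧ F (j (h q m)) = 1 ∧ F (i (h p n) * j (h q m)) = p) ∧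
    (F' 1 = 1 ∧ F' (i (h p n)) = 1 ∧ F' (j (h q m)) = q ∧ F' (i (h p n) * j (h q m)) = q) ∧
    (G 1 = 0 ∧ G (i (h p n)) = 0 ∧ G (j (h q m)) = 0 ∧ G (i (x p n)) = 1 ∧ G (j (x q m)) = 0) ∧
    (G' 1 = 0 ∧ G' (i (h p n)) = 0 ∧ G' (j (h q m)) = 0 ∧ G' (i (x p n)) = 0 ∧
      G' (j (x q m)) = 1) := by
  have hh := skewDer_h_pow hn hp.out.pow_eq_one 1
  have hh' := skewDer_h_pow hm hq.out.pow_eq_one 1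
  rw [pow_one] at hh hh'
  obtain ⟨F, F1, F2, F3, F4⟩ := exists_product_functional hij (chi p n) (Coalgebra.counit (R := k))
  obtain ⟨F', F1', F2', F3', F4'⟩ :=
    exists_product_functional hij (Coalgebra.counit (R := k)) (chi q m)
  obtain ⟨G, G1, G2, G3, G4⟩ := exists_product_functional hij
    (skewDer hn hp.out.pow_eq_one) (Coalgebra.counit (R := k))
  obtain ⟨G', G1', G2', G3', G4'⟩ := exists_product_functional hij
    (Coalgebra.counit (R := k)) (skewDer hm hq.out.pow_eq_one)
  refine ⟨F, F', G, G', ?_, ?_, ?_, ?_⟩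
  · simp [F1, F2, F3, F4, chi_one, chi_h, counit_h]
  · simp [F1', F2', F3', F4', chi_one, chi_h, counit_h]
  · simp [G2, G3, G4, skewDer_one, skewDer_x, hh]
  · simp [G2', G3', G4', skewDer_one, skewDer_x, hh']

theorem ne_one_left : i (h p n) ≠ 1 := fun h0 => by
  obtain ⟨F, -, -, -, ⟨F1, F2, -⟩, -⟩ := exists_separating_functionals hn hm hij
  rw [h0, F1] at F2
  exact hp.out.ne_one (by omega) F2.symm

theorem ne_one_right : j (h q m) ≠ 1 := fun h0 => by
  obtain ⟨-, F, -, -, -, ⟨F1, -, F2, -⟩, -⟩ := exists_separating_functionals hn hm hij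
  rw [h0, F1] at F2
  exact hq.out.ne_one (by omega) F2.symm

theorem left_ne_right : i (h p n) ≠ j (h q m) := fun h0 => by
  obtain ⟨F, -, -, -, ⟨-, F1, F2, -⟩, -⟩ := exists_separating_functionals hn hm hij
  rw [h0, F2] at F1
  exact hp.out.ne_one (by omega) F1.symm

theorem mul_ne_one : i (h p n) * j (h q m) ≠ 1 := fun h0 => by
  obtain ⟨F, -, -, -, ⟨F1, -, -, F2⟩, -⟩ := exists_separating_functionals hn hm hij
  rw [h0, F1] at F2
  exact hp.out.ne_one (by omega) F2.symm

theorem x_left_ne (c : k) : i (x p n) ≠ c • (1 - i (h p n)) := fun h0 => by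
  obtain ⟨-, -, G, -, -, -, ⟨G1, G2, -, G3, -⟩, -⟩ := exists_separating_functionals hn hm hij
  rw [h0] at G3
  simp [G1, G2] at G3

theorem x_right_ne (c : k) : j (x q m) ≠ c • (1 - j (h q m)) := fun h0 => by
  obtain ⟨-, -, -, G, -, -, -, ⟨G1, -, G2, -, G3⟩⟩ := exists_separating_functionals hn hm hij
  rw [h0] at G3
  simp [G1, G2] at G3

omit [CharZero k] hij hn hm in
theorem comul_map_x (i : TaftAlgebra p n →ₐc[k] E) : Coalgebra.comul (R := k) (i (x p n)) =
    i (x p n) ⊗ₜ[k] i (h p n) + 1 ⊗ₜ[k] i (x p n) := by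
  rw [← CoalgHomClass.map_comp_comul_apply, comul_x]
  simp

omit [CharZero k] hij hn hm in
theorem isUnit_map_h (i : TaftAlgebra p n →ₐc[k] E) : IsUnit (i (h p n)) := isUnit_h.map i

/-- The conjugate of `X` by `h` is skew primitive. It cannot be trivial, since `X` is not, and its
group-like cannot be `h`, since undoing the conjugation would give `H = h`. Hence it lies over `H`,
and `qComm_of_conj` applies. -/
theorem exists_conj_left : j (h q m) * i (h p n) = i (h p n) * j (h q m) ∧
    ∃ α : k, α ^ m = 1 ∧ j (h q m) * i (x p n) = α • (i (x p n) * j (h q m)) := by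
  have hu : IsGroupLikeElem k (j (h q m)) := isGroupLikeElem_h.map j
  have hv : IsGroupLikeElem k (j (h q m ^ (m - 1))) := isGroupLikeElem_h.pow.map j
  have huv : j (h q m) * j (h q m ^ (m - 1)) = 1 := by
    rw [← map_mul, h_mul_h_pow q m (NeZero.ne m), map_one]
  have hvu : j (h q m ^ (m - 1)) * j (h q m) = 1 := by
    rw [← map_mul, h_pow_mul_h q m (NeZero.ne m), map_one]
  have hH : IsGroupLikeElem k (i (h p n)) := isGroupLikeElem_h.map i
  have hx0 : i (x p n) ≠ 0 := by simpa using x_left_ne hn hm hij 0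
  have back : ∀ y w : E, j (h q m) * y * j (h q m ^ (m - 1)) = w →
      y = j (h q m ^ (m - 1)) * w * j (h q m) := by
    rintro y _ rfl
    calc y = (j (h q m ^ (m - 1)) * j (h q m)) * y * (j (h q m ^ (m - 1)) * j (h q m)) := by
          rw [hvu, one_mul, mul_one]
      _ = _ := by noncomm_ring
  rcases skewPrimitive_of_factorization hn hm hij ((hu.mul hH).mul hv)
    (comul_conj hu hv huv (comul_map_x i)) with ⟨c, hc⟩ | ⟨hg, c, c', hc⟩ | ⟨hg, c, c', hc⟩
  · refine absurd ?_ (x_left_ne hn hm hij c)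
    rw [back _ _ hc, mul_smul_comm, smul_mul_assoc]
    congr 1
    rw [mul_sub, sub_mul, mul_one, hvu]
    congr 1
    exact (back _ _ rfl).symm
  · rw [hg] at hc
    have hcomm : j (h q m) * i (h p n) = i (h p n) * j (h q m) := by
      have := congrArg (· * j (h q m)) hg
      simpa only [mul_assoc, hvu, mul_one] using this
    have h1 := qComm_of_conj (p := p) hvu (by rw [← map_mul, x_mul_h, map_smul, map_mul]) hg hc
      (isUnit_map_h i) (ne_one_left hn hm hij) (hp.out.ne_one (by omega))
    refine ⟨hcomm, c, ?_, h1⟩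
    -- Commuting `h ^ m = 1` past `X` multiplies by `c ^ m`.
    have h2 := pow_mul_of_qComm h1 m
    rw [← map_pow, h_pow, map_one, one_mul, mul_one, eq_comm, ← sub_eq_zero, ← one_smul k (i _),
      smul_smul, mul_one, ← sub_smul] at h2
    exact sub_eq_zero.mp ((smul_eq_zero.mp h2).resolve_right hx0)
  · refine absurd ?_ (left_ne_right hn hm hij)
    rw [back _ _ hg, hvu, one_mul]

/-- The same argument with the factors exchanged; the group-like is now known to be fixed by
conjugation. -/
theorem exists_conj_right : ∃ γ : k, γ ^ n = 1 ∧
    i (h p n) * j (x q m) = γ • (j (x q m) * i (h p n)) := by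
  have hu : IsGroupLikeElem k (i (h p n)) := isGroupLikeElem_h.map i
  have hv : IsGroupLikeElem k (i (h p n ^ (n - 1))) := isGroupLikeElem_h.pow.map i
  have huv : i (h p n) * i (h p n ^ (n - 1)) = 1 := by
    rw [← map_mul, h_mul_h_pow p n (NeZero.ne n), map_one]
  have hvu : i (h p n ^ (n - 1)) * i (h p n) = 1 := by
    rw [← map_mul, h_pow_mul_h p n (NeZero.ne n), map_one]
  have hH : IsGroupLikeElem k (j (h q m)) := isGroupLikeElem_h.map j
  have hx0 : j (x q m) ≠ 0 := by simpa using x_right_ne hn hm hij 0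
  have hg : i (h p n) * j (h q m) * i (h p n ^ (n - 1)) = j (h q m) := by
    rw [← (exists_conj_left hn hm hij).1, mul_assoc, huv, mul_one]
  have hz := comul_conj hu hv huv (comul_map_x j)
  rw [hg] at hz
  rcases skewPrimitive_of_factorization hn hm hij hH hz with
    ⟨c, hc⟩ | ⟨hg', -⟩ | ⟨-, c, c', hc⟩
  · refine absurd ?_ (x_right_ne hn hm hij c)
    calc j (x q m) = (i (h p n ^ (n - 1)) * i (h p n)) * j (x q m) *
          (i (h p n ^ (n - 1)) * i (h p n)) := by rw [hvu, one_mul, mul_one]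
      _ = i (h p n ^ (n - 1)) * (i (h p n) * j (x q m) * i (h p n ^ (n - 1))) * i (h p n) := by
          noncomm_ring
      _ = c • (1 - j (h q m)) := by
          rw [hc, mul_smul_comm, smul_mul_assoc, mul_sub, sub_mul, mul_one, hvu, mul_assoc,
            (exists_conj_left hn hm hij).1, ← mul_assoc, hvu, one_mul]
  · exact absurd hg'.symm (left_ne_right hn hm hij)
  · have h1 := qComm_of_conj (p := q) hvu (by rw [← map_mul, x_mul_h, map_smul, map_mul]) hg hc
      (isUnit_map_h j) (ne_one_right hn hm hij) (hq.out.ne_one (by omega))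
    refine ⟨c, ?_, h1⟩
    have h2 := pow_mul_of_qComm h1 n
    rw [← map_pow, h_pow, map_one, one_mul, mul_one, eq_comm, ← sub_eq_zero, ← one_smul k (j _),
      smul_smul, mul_one, ← sub_smul] at h2
    exact sub_eq_zero.mp ((smul_eq_zero.mp h2).resolve_right hx0)

/-- The relations between the two Taft subalgebras of a factorization. -/
theorem exists_relations : ∃ α l : k, α ^ n = 1 ∧ α ^ m = 1 ∧ l * (α - q) = 0 ∧
    l * (α * p - 1) = 0 ∧ j (h q m) * i (h p n) = i (h p n) * j (h q m) ∧
    j (h q m) * i (x p n) = α • (i (x p n) * j (h q m)) ∧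
    j (x q m) * i (h p n) = α • (i (h p n) * j (x q m)) ∧
    j (x q m) * i (x p n) = α • (i (x p n) * j (x q m)) + l • (1 - i (h p n) * j (h q m)) := by
  obtain ⟨hHh, α, hα, hhX⟩ := exists_conj_left hn hm hij
  obtain ⟨γ, hγ, hHx⟩ := exists_conj_right hn hm hij
  have hα0 : α ≠ 0 := by rintro rfl; rw [zero_pow (NeZero.ne m)] at hα; exact zero_ne_one hα
  have hγ0 : γ ≠ 0 := by rintro rfl; rw [zero_pow (NeZero.ne n)] at hγ; exact zero_ne_one hγ
  have hxH : j (x q m) * i (h p n) = γ⁻¹ • (i (h p n) * j (x q m)) := by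
    rw [hHx, smul_smul, inv_mul_cancel₀ hγ0, one_smul]
  have hXH : i (x p n) * i (h p n) = p • (i (h p n) * i (x p n)) := by
    rw [← map_mul, x_mul_h, map_smul, map_mul]
  have hxh : j (x q m) * j (h q m) = q • (j (h q m) * j (x q m)) := by
    rw [← map_mul, x_mul_h, map_smul, map_mul]
  have hne1 := ne_one_left hn hm hij
  have hne2 := ne_one_right hn hm hij
  have hu1 := isUnit_map_h i
  have hu2 := isUnit_map_h j
  have hmul1 := mul_ne_one hn hm hij
  -- With this choice of coefficient the terms `x ⊗ Xh` cancel in the coproduct of `w`; the terms `X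
  -- ⊗ Hx` leave the factor `γ⁻¹ - α`.
  set w := j (x q m) * i (x p n) - α • (i (x p n) * j (x q m)) with hw
  have hΔ : Coalgebra.comul (R := k) w = w ⊗ₜ[k] (i (h p n) * j (h q m)) + 1 ⊗ₜ[k] w +
      (γ⁻¹ - α) • (i (x p n) ⊗ₜ[k] (i (h p n) * j (x q m))) := by
    rw [hw, map_sub, map_smul, Bialgebra.comul_mul, Bialgebra.comul_mul, comul_map_x, comul_map_x]
    simp only [add_mul, mul_add, Algebra.TensorProduct.tmul_mul_tmul, one_mul, mul_one, hHh, hhX,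
      hxH, TensorProduct.tmul_smul, TensorProduct.sub_tmul, TensorProduct.tmul_sub,
      ← TensorProduct.smul_tmul']
    module
  -- The skew derivations of the two factors, convolved in one order, return `γ⁻¹ - α` on `w`, and
  -- in the other order `0`.
  have hαγ : γ⁻¹ = α := by
    have hh := skewDer_h_pow hn hp.out.pow_eq_one 1
    have hh' := skewDer_h_pow hm hq.out.pow_eq_one 1
    rw [pow_one] at hh hh'
    obtain ⟨F, F1, F2, F3, F4⟩ := exists_product_functional hij
      (skewDer hn hp.out.pow_eq_one) (Coalgebra.counit (R := k))
    obtain ⟨G, G1, G2, G3, G4⟩ := exists_product_functional hij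
      (Coalgebra.counit (R := k)) (skewDer hm hq.out.pow_eq_one)
    have hc := product_functional_comm hij F1 G1 w
    have r : ∀ f : E →ₗ[k] k, rightAct f w = f (i (h p n) * j (h q m)) • w + f w • 1 +
        ((γ⁻¹ - α) * f (i (h p n) * j (x q m))) • i (x p n) := by
      intro f
      simp [rightAct, hΔ, smul_smul]
    rw [r F, r G] at hc
    simp only [F1, F2, F4, G1, G2, G4, hh, hh', skewDer_one, skewDer_x, counit_h, counit_x,
      Bialgebra.counit_one, map_add, map_smul, smul_eq_mul] at hc
    linear_combination hc
  rw [hαγ, sub_self, zero_smul, add_zero] at hΔ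
  have hg : IsGroupLikeElem k (i (h p n) * j (h q m)) :=
    (isGroupLikeElem_h.map i).mul (isGroupLikeElem_h.map j)
  -- Now `w` is skew primitive over `Hh`, which is neither `H` nor `h`, so only the trivial
  -- solutions remain.
  obtain ⟨l, hl⟩ : ∃ l : k, w = l • (1 - i (h p n) * j (h q m)) := by
    rcases skewPrimitive_of_factorization hn hm hij hg hΔ with hc | ⟨h0, -⟩ | ⟨h0, -⟩
    · exact hc
    · exact absurd (hu1.mul_eq_left.mp h0) hne2
    · exact absurd (hu2.mul_eq_right.mp h0) hne1
  have hsub : (1 : E) - i (h p n) * j (h q m) ≠ 0 := sub_ne_zero.mpr hmul1.symm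
  rw [hαγ] at hxH
  refine ⟨α, l, ?_, hα, ?_, ?_, hHh, hhX, hxH, ?_⟩
  · rw [← hαγ, inv_pow, hγ, inv_one]
  -- The `q`-commutation of `w` with `h` is compared with the fact that `1 - Hh` commutes with `h`;
  -- the next bullet does the same with `H`.
  · have h1 : α • (w * j (h q m)) = q • (j (h q m) * w) := by
      have e1 : α • (j (x q m) * i (x p n) * j (h q m)) =
          q • (j (h q m) * (j (x q m) * i (x p n))) := by
        rw [mul_assoc, ← mul_smul_comm, ← hhX, ← mul_assoc, hxh, smul_mul_assoc, mul_assoc]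
      have e2 : α • (i (x p n) * j (x q m) * j (h q m)) =
          q • (j (h q m) * (i (x p n) * j (x q m))) := by
        rw [mul_assoc, hxh, mul_smul_comm, smul_comm, ← mul_assoc, ← smul_mul_assoc, ← hhX,
          mul_assoc]
      rw [hw, sub_mul, mul_sub, smul_sub, smul_sub, e1, smul_mul_assoc, e2, mul_smul_comm,
        smul_comm α q]
    have h2 : j (h q m) * (1 - i (h p n) * j (h q m)) =
        (1 - i (h p n) * j (h q m)) * j (h q m) := by
      rw [mul_sub, sub_mul, ← mul_assoc, hHh, mul_one, one_mul]
    rw [hl, smul_mul_assoc, mul_smul_comm, h2, smul_smul, smul_smul, ← sub_eq_zero, ← sub_smul] at h1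
    rcases smul_eq_zero.mp h1 with h3 | h3
    · linear_combination h3
    · exact absurd (hu2.mul_left_eq_zero.mp h3) hsub
  · have h1 : w * i (h p n) = (α * p) • (i (h p n) * w) := by
      have e1 : j (x q m) * i (x p n) * i (h p n) =
          (α * p) • (i (h p n) * (j (x q m) * i (x p n))) := by
        rw [mul_assoc, hXH, mul_smul_comm, ← mul_assoc, hxH, smul_mul_assoc, smul_smul, mul_comm p,
          mul_assoc]
      have e2 : i (x p n) * j (x q m) * i (h p n) =
          (α * p) • (i (h p n) * (i (x p n) * j (x q m))) := by
        rw [mul_assoc, hxH, mul_smul_comm, ← mul_assoc, hXH, smul_mul_assoc, smul_smul, mul_assoc]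
      rw [hw, sub_mul, mul_sub, smul_sub, e1, smul_mul_assoc, e2, mul_smul_comm, smul_comm α]
    have h2 : i (h p n) * (1 - i (h p n) * j (h q m)) =
        (1 - i (h p n) * j (h q m)) * i (h p n) := by
      rw [mul_sub, sub_mul, mul_assoc, hHh, mul_one, one_mul]
    rw [hl, smul_mul_assoc, mul_smul_comm, h2, smul_smul, ← sub_eq_zero, ← sub_smul] at h1
    rcases smul_eq_zero.mp h1 with h3 | h3
    · linear_combination -h3
    · exact absurd (hu1.mul_left_eq_zero.mp h3) hsub
  · rw [← hl, hw]; abel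

end Factorization

end TaftAlgebra

/-! ### Bicrossed products of two Taft algebras by generators and relations -/

/-- The four generators. -/
inductive BicrossedGen : Type
  | H
  | X
  | h
  | x

section BicrossedRel

variable {k : Type u} [Field k]

open BicrossedGen FreeAlgebra in
/-- The relations of two Taft algebras together with `h H = H h`, `h X = α X h`, `x H = α H x`,
`x X = α X x + l (1 - H h)`. -/
inductive BicrossedRel (p q α l : k) (n m : ℕ) :
    FreeAlgebra k BicrossedGen → FreeAlgebra k BicrossedGen → Prop
  | H_pow : BicrossedRel p q α l n m (ι k H ^ n) 1
  | X_pow : BicrossedRel p q α l n m (ι k X ^ n) 0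
  | X_mul_H : BicrossedRel p q α l n m (ι k X * ι k H) (p • (ι k H * ι k X))
  | h_pow : BicrossedRel p q α l n m (ι k h ^ m) 1
  | x_pow : BicrossedRel p q α l n m (ι k x ^ m) 0
  | x_mul_h : BicrossedRel p q α l n m (ι k x * ι k h) (q • (ι k h * ι k x))
  | h_mul_H : BicrossedRel p q α l n m (ι k h * ι k H) (ι k H * ι k h)
  | h_mul_X : BicrossedRel p q α l n m (ι k h * ι k X) (α • (ι k X * ι k h))
  | x_mul_H : BicrossedRel p q α l n m (ι k x * ι k H) (α • (ι k H * ι k x))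
  | x_mul_X : BicrossedRel p q α l n m (ι k x * ι k X)
      (α • (ι k X * ι k x) + l • (1 - ι k H * ι k h))

/-- The algebra generated by two Taft algebras subject to the mixed relations. -/
def TaftBicrossed (p q α l : k) (n m : ℕ) : Type u := RingQuot (BicrossedRel p q α l n m)

end BicrossedRel

namespace TaftBicrossed

open TaftAlgebra (h x)

section Algebra

variable {k : Type u} [Field k] (p q α l : k) (n m : ℕ)

noncomputable instance instRing : Ring (TaftBicrossed p q α l n m) :=
  inferInstanceAs (Ring (RingQuot (BicrossedRel p q α l n m)))

noncomputable instance instAlgebra : Algebra k (TaftBicrossed p q α l n m) :=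
  inferInstanceAs (Algebra k (RingQuot (BicrossedRel p q α l n m)))

/-- The quotient map from the free algebra. -/
noncomputable def mk : FreeAlgebra k BicrossedGen →ₐ[k] TaftBicrossed p q α l n m :=
  RingQuot.mkAlgHom k (BicrossedRel p q α l n m)

theorem mk_rel {a b : FreeAlgebra k BicrossedGen} (hab : BicrossedRel p q α l n m a b) :
    mk p q α l n m a = mk p q α l n m b := RingQuot.mkAlgHom_rel k hab

/-- The first Taft subalgebra. -/
noncomputable def inl : TaftAlgebra p n →ₐ[k] TaftBicrossed p q α l n m :=
  TaftAlgebra.lift (mk p q α l n m (FreeAlgebra.ι k .H)) (mk p q α l n m (FreeAlgebra.ι k .X))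
    (by simpa using mk_rel p q α l n m .H_pow) (by simpa using mk_rel p q α l n m .X_pow)
    (by simpa using mk_rel p q α l n m .X_mul_H)

/-- The second Taft subalgebra. -/
noncomputable def inr : TaftAlgebra q m →ₐ[k] TaftBicrossed p q α l n m :=
  TaftAlgebra.lift (mk p q α l n m (FreeAlgebra.ι k .h)) (mk p q α l n m (FreeAlgebra.ι k .x))
    (by simpa using mk_rel p q α l n m .h_pow) (by simpa using mk_rel p q α l n m .x_pow)
    (by simpa using mk_rel p q α l n m .x_mul_h)

theorem inl_h : inl p q α l n m (h p n) = mk p q α l n m (FreeAlgebra.ι k .H) :=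
  TaftAlgebra.lift_h ..

theorem inl_x : inl p q α l n m (x p n) = mk p q α l n m (FreeAlgebra.ι k .X) :=
  TaftAlgebra.lift_x ..

theorem inr_h : inr p q α l n m (h q m) = mk p q α l n m (FreeAlgebra.ι k .h) :=
  TaftAlgebra.lift_h ..

theorem inr_x : inr p q α l n m (x q m) = mk p q α l n m (FreeAlgebra.ι k .x) :=
  TaftAlgebra.lift_x ..

end Algebra

section UniversalProperty

variable {k : Type u} [Field k] {p q α l : k} {n m : ℕ}

/-- The mixed relations between the images of two Taft algebras in an algebra. -/
structure MixedRelations (α l : k) {F : Type*} [Ring F] [Algebra k F]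
    (f : TaftAlgebra p n →ₐ[k] F) (g : TaftAlgebra q m →ₐ[k] F) : Prop where
  h_mul_H : g (h q m) * f (h p n) = f (h p n) * g (h q m)
  h_mul_X : g (h q m) * f (x p n) = α • (f (x p n) * g (h q m))
  x_mul_H : g (x q m) * f (h p n) = α • (f (h p n) * g (x q m))
  x_mul_X : g (x q m) * f (x p n) =
    α • (f (x p n) * g (x q m)) + l • (1 - f (h p n) * g (h q m))

theorem mixedRelations : MixedRelations α l (inl p q α l n m) (inr p q α l n m) := by
  constructor <;> rw [inl, inr]
  · simpa [TaftAlgebra.lift_h, TaftAlgebra.lift_x] using mk_rel p q α l n m .h_mul_H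
  · simpa [TaftAlgebra.lift_h, TaftAlgebra.lift_x] using mk_rel p q α l n m .h_mul_X
  · simpa [TaftAlgebra.lift_h, TaftAlgebra.lift_x] using mk_rel p q α l n m .x_mul_H
  · simpa [TaftAlgebra.lift_h, TaftAlgebra.lift_x] using mk_rel p q α l n m .x_mul_X

variable {F : Type*} [Ring F] [Algebra k F]

/-- The universal property. -/
noncomputable def lift (f : TaftAlgebra p n →ₐ[k] F) (g : TaftAlgebra q m →ₐ[k] F)
    (hfg : MixedRelations α l f g) : TaftBicrossed p q α l n m →ₐ[k] F :=
  RingQuot.liftAlgHom k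
    ⟨FreeAlgebra.lift k (fun i => match i with
      | .H => f (h p n) | .X => f (x p n) | .h => g (h q m) | .x => g (x q m)), by
      intro a b hab
      cases hab with
      | H_pow => simpa using congrArg f (TaftAlgebra.h_pow p n)
      | X_pow => simpa using congrArg f (TaftAlgebra.x_pow p n)
      | X_mul_H => simpa using congrArg f (TaftAlgebra.x_mul_h p n)
      | h_pow => simpa using congrArg g (TaftAlgebra.h_pow q m)
      | x_pow => simpa using congrArg g (TaftAlgebra.x_pow q m)
      | x_mul_h => simpa using congrArg g (TaftAlgebra.x_mul_h q m)
      | h_mul_H => simpa using hfg.h_mul_H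
      | h_mul_X => simpa using hfg.h_mul_X
      | x_mul_H => simpa using hfg.x_mul_H
      | x_mul_X => simpa using hfg.x_mul_X⟩

variable (f : TaftAlgebra p n →ₐ[k] F) (g : TaftAlgebra q m →ₐ[k] F)
    (hfg : MixedRelations α l f g)

theorem lift_mk_ι (i : BicrossedGen) : lift f g hfg (mk p q α l n m (FreeAlgebra.ι k i)) =
    match i with
      | .H => f (h p n) | .X => f (x p n) | .h => g (h q m) | .x => g (x q m) := by
  unfold lift mk
  exact (RingQuot.liftAlgHom_mkAlgHom_apply _ _ _ _).trans (by simp)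

theorem lift_comp_inl : (lift f g hfg).comp (inl p q α l n m) = f :=
  TaftAlgebra.algHom_ext (by simp [inl_h, lift_mk_ι]) (by simp [inl_x, lift_mk_ι])

theorem lift_comp_inr : (lift f g hfg).comp (inr p q α l n m) = g :=
  TaftAlgebra.algHom_ext (by simp [inr_h, lift_mk_ι]) (by simp [inr_x, lift_mk_ι])

@[simp]
theorem lift_inl (a : TaftAlgebra p n) : lift f g hfg (inl p q α l n m a) = f a :=
  AlgHom.congr_fun (lift_comp_inl f g hfg) a

@[simp]
theorem lift_inr (b : TaftAlgebra q m) : lift f g hfg (inr p q α l n m b) = g b :=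
  AlgHom.congr_fun (lift_comp_inr f g hfg) b

/-- The two Taft subalgebras generate. -/
theorem induction {P : TaftBicrossed p q α l n m → Prop}
    (left : ∀ a, P (inl p q α l n m a)) (right : ∀ b, P (inr p q α l n m b))
    (mul : ∀ a b, P a → P b → P (a * b)) (add : ∀ a b, P a → P b → P (a + b))
    (a : TaftBicrossed p q α l n m) : P a := by
  obtain ⟨a, rfl⟩ : ∃ b, mk p q α l n m b = a :=
    RingQuot.mkAlgHom_surjective k (BicrossedRel p q α l n m) a
  induction a using FreeAlgebra.induction with
  | grade0 r =>
    have := left (algebraMap k _ r)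
    rw [AlgHom.commutes] at this
    rw [AlgHom.commutes]
    exact this
  | grade1 i =>
    cases i with
    | H => rw [← inl_h]; exact left _
    | X => rw [← inl_x]; exact left _
    | h => rw [← inr_h]; exact right _
    | x => rw [← inr_x]; exact right _
  | mul a b ha hb => rw [map_mul]; exact mul _ _ ha hb
  | add a b ha hb => rw [map_add]; exact add _ _ ha hb

theorem algHom_ext {φ ψ : TaftBicrossed p q α l n m →ₐ[k] F}
    (h₁ : φ.comp (inl p q α l n m) = ψ.comp (inl p q α l n m))
    (h₂ : φ.comp (inr p q α l n m) = ψ.comp (inr p q α l n m)) : φ = ψ := by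
  ext a
  induction a using TaftBicrossed.induction with
  | left a => exact AlgHom.congr_fun h₁ a
  | right b => exact AlgHom.congr_fun h₂ b
  | mul a b ha hb => rw [map_mul, map_mul, ha, hb]
  | add a b ha hb => rw [map_add, map_add, ha, hb]

end UniversalProperty

section Hopf

variable {k : Type u} [Field k] (p q α l : k) (n m : ℕ) [NeZero n] [NeZero m]
  [hp : Fact (IsPrimitiveRoot p n)] [hq : Fact (IsPrimitiveRoot q m)]

/-- The comultiplication extending those of the two Taft subalgebras. -/
noncomputable def comulHom : TaftBicrossed p q α l n m →ₐ[k]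
    TaftBicrossed p q α l n m ⊗[k] TaftBicrossed p q α l n m :=
  lift ((Algebra.TensorProduct.map (inl p q α l n m) (inl p q α l n m)).comp
      (Bialgebra.comulAlgHom k (TaftAlgebra p n)))
    ((Algebra.TensorProduct.map (inr p q α l n m) (inr p q α l n m)).comp
      (Bialgebra.comulAlgHom k (TaftAlgebra q m)))
    (by
      have h1 := mixedRelations (p := p) (q := q) (α := α) (l := l) (n := n) (m := m)
      constructor
      · simp [TaftAlgebra.comul_h, h1.h_mul_H]
      · simp only [AlgHom.comp_apply, Bialgebra.comulAlgHom_apply, TaftAlgebra.comul_h,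
          TaftAlgebra.comul_x, map_add, Algebra.TensorProduct.map_tmul, map_one, mul_add, add_mul,
          Algebra.TensorProduct.tmul_mul_tmul, h1.h_mul_H, h1.h_mul_X, mul_one, one_mul,
          TensorProduct.tmul_smul, ← TensorProduct.smul_tmul']
        module
      · simp only [AlgHom.comp_apply, Bialgebra.comulAlgHom_apply, TaftAlgebra.comul_h,
          TaftAlgebra.comul_x, map_add, Algebra.TensorProduct.map_tmul, map_one, mul_add, add_mul,
          Algebra.TensorProduct.tmul_mul_tmul, h1.h_mul_H, h1.x_mul_H, mul_one, one_mul,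
          TensorProduct.tmul_smul, ← TensorProduct.smul_tmul']
        module
      -- The inhomogeneous term is compatible because `1 - Hh` is itself skew primitive over `Hh`;
      -- the mixed terms cancel since the same `α` governs both cross relations.
      · simp only [AlgHom.comp_apply, Bialgebra.comulAlgHom_apply, TaftAlgebra.comul_h,
          TaftAlgebra.comul_x, map_add, Algebra.TensorProduct.map_tmul, map_one, mul_add, add_mul,
          Algebra.TensorProduct.tmul_mul_tmul, h1.h_mul_H, h1.h_mul_X, h1.x_mul_H, h1.x_mul_X,
          mul_one, one_mul, TensorProduct.tmul_smul, ← TensorProduct.smul_tmul',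
          TensorProduct.tmul_add, TensorProduct.add_tmul, TensorProduct.tmul_sub,
          TensorProduct.sub_tmul, Algebra.TensorProduct.one_def]
        module)

/-- The counit extending those of the two Taft subalgebras. -/
noncomputable def counitHom : TaftBicrossed p q α l n m →ₐ[k] k :=
  lift (Bialgebra.counitAlgHom k (TaftAlgebra p n)) (Bialgebra.counitAlgHom k (TaftAlgebra q m))
    (by constructor <;> simp [TaftAlgebra.counit_h, TaftAlgebra.counit_x])

/-- All parameters are allowed here. Admissibility matters only for the bijectivity of the product
map. -/
noncomputable instance instBialgebra : Bialgebra k (TaftBicrossed p q α l n m) :=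
  Bialgebra.ofAlgHom (comulHom p q α l n m) (counitHom p q α l n m)
    (algHom_ext
      (TaftAlgebra.algHom_ext
        (by simp [comulHom, TaftAlgebra.comul_h])
        (by simp [comulHom, TaftAlgebra.comul_h, TaftAlgebra.comul_x, TensorProduct.add_tmul,
          TensorProduct.tmul_add, Algebra.TensorProduct.one_def, add_assoc]))
      (TaftAlgebra.algHom_ext
        (by simp [comulHom, TaftAlgebra.comul_h])
        (by simp [comulHom, TaftAlgebra.comul_h, TaftAlgebra.comul_x, TensorProduct.add_tmul,
          TensorProduct.tmul_add, Algebra.TensorProduct.one_def, add_assoc])))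
    (algHom_ext
      (TaftAlgebra.algHom_ext
        (by simp [comulHom, counitHom, TaftAlgebra.comul_h, TaftAlgebra.counit_h])
        (by simp [comulHom, counitHom, TaftAlgebra.comul_x, TaftAlgebra.counit_x]))
      (TaftAlgebra.algHom_ext
        (by simp [comulHom, counitHom, TaftAlgebra.comul_h, TaftAlgebra.counit_h])
        (by simp [comulHom, counitHom, TaftAlgebra.comul_x, TaftAlgebra.counit_x])))
    (algHom_ext
      (TaftAlgebra.algHom_ext
        (by simp [comulHom, counitHom, TaftAlgebra.comul_h, TaftAlgebra.counit_h])
        (by simp [comulHom, counitHom, TaftAlgebra.comul_x, TaftAlgebra.counit_x,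
          TaftAlgebra.counit_h]))
      (TaftAlgebra.algHom_ext
        (by simp [comulHom, counitHom, TaftAlgebra.comul_h, TaftAlgebra.counit_h])
        (by simp [comulHom, counitHom, TaftAlgebra.comul_x, TaftAlgebra.counit_x,
          TaftAlgebra.counit_h])))

theorem comul_inl (a : TaftAlgebra p n) : Coalgebra.comul (R := k) (inl p q α l n m a) =
    Algebra.TensorProduct.map (inl p q α l n m) (inl p q α l n m)
      (Coalgebra.comul (R := k) a) := lift_inl ..

theorem comul_inr (b : TaftAlgebra q m) : Coalgebra.comul (R := k) (inr p q α l n m b) =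
    Algebra.TensorProduct.map (inr p q α l n m) (inr p q α l n m)
      (Coalgebra.comul (R := k) b) := lift_inr ..

theorem counit_inl (a : TaftAlgebra p n) : Coalgebra.counit (R := k) (inl p q α l n m a) =
    Coalgebra.counit (R := k) a := lift_inl ..

theorem counit_inr (b : TaftAlgebra q m) : Coalgebra.counit (R := k) (inr p q α l n m b) =
    Coalgebra.counit (R := k) b := lift_inr ..

/-- The first Taft subalgebra as a sub-bialgebra. -/
noncomputable def inlBialgHom : TaftAlgebra p n →ₐc[k] TaftBicrossed p q α l n m :=
  BialgHom.ofAlgHom (inl p q α l n m) (AlgHom.ext fun a => counit_inl p q α l n m a)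
    (AlgHom.ext fun a => (comul_inl p q α l n m a).symm)

/-- The second Taft subalgebra as a sub-bialgebra. -/
noncomputable def inrBialgHom : TaftAlgebra q m →ₐc[k] TaftBicrossed p q α l n m :=
  BialgHom.ofAlgHom (inr p q α l n m) (AlgHom.ext fun a => counit_inr p q α l n m a)
    (AlgHom.ext fun a => (comul_inr p q α l n m a).symm)

theorem inlBialgHom_apply (a : TaftAlgebra p n) : inlBialgHom p q α l n m a = inl p q α l n m a :=
  rfl

theorem inrBialgHom_apply (b : TaftAlgebra q m) : inrBialgHom p q α l n m b = inr p q α l n m b :=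
  rfl

/-- The antipode, as an algebra homomorphism to the opposite algebra. -/
noncomputable def antipodeHom :
    TaftBicrossed p q α l n m →ₐ[k] (TaftBicrossed p q α l n m)ᵐᵒᵖ :=
  lift ((AlgHom.op (inl p q α l n m)).comp (TaftAlgebra.antipodeHom p n (NeZero.ne n)))
    ((AlgHom.op (inr p q α l n m)).comp (TaftAlgebra.antipodeHom q m (NeZero.ne m)))
    (by
      have h1 := mixedRelations (p := p) (q := q) (α := α) (l := l) (n := n) (m := m)
      have e1 : inl p q α l n m (h p n) * inl p q α l n m (h p n ^ (n - 1)) = 1 := by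
        rw [← map_mul, TaftAlgebra.h_mul_h_pow p n (NeZero.ne n), map_one]
      have e2 : inl p q α l n m (h p n ^ (n - 1)) * inl p q α l n m (h p n) = 1 := by
        rw [← map_mul, TaftAlgebra.h_pow_mul_h p n (NeZero.ne n), map_one]
      have e3 : inr p q α l n m (h q m) * inr p q α l n m (h q m ^ (m - 1)) = 1 := by
        rw [← map_mul, TaftAlgebra.h_mul_h_pow q m (NeZero.ne m), map_one]
      have e4 : inr p q α l n m (h q m ^ (m - 1)) * inr p q α l n m (h q m) = 1 := by
        rw [← map_mul, TaftAlgebra.h_pow_mul_h q m (NeZero.ne m), map_one]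
      simp only [map_pow] at e1 e2 e3 e4
      -- The powers `n - 1` and `m - 1` are the inverses of `H` and `g`; the relations `r5` to `r9`
      -- carry these inverses past the other generators.
      obtain ⟨r1, r2, r3, r4⟩ := h1
      set H := inl p q α l n m (h p n)
      set X := inl p q α l n m (x p n)
      set g := inr p q α l n m (h q m)
      set y := inr p q α l n m (x q m)
      have r5 : H ^ (n - 1) * g = g * H ^ (n - 1) :=
        ((Commute.pow_right (show Commute g H from r1) (n - 1)).eq).symm
      have r6 : g ^ (m - 1) * H ^ (n - 1) = H ^ (n - 1) * g ^ (m - 1) :=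
        (Commute.pow_pow (show Commute g H from r1) (m - 1) (n - 1)).eq
      have r7 : X * g ^ (m - 1) = α • (g ^ (m - 1) * X) := by
        calc X * g ^ (m - 1) = g ^ (m - 1) * (g * X) * g ^ (m - 1) := by
              rw [← mul_assoc, e4, one_mul]
          _ = α • (g ^ (m - 1) * X) := by
              rw [r2, mul_smul_comm, smul_mul_assoc, mul_assoc, mul_assoc, e3, mul_one]
      have r8 : H ^ (n - 1) * y = α • (y * H ^ (n - 1)) := by
        calc H ^ (n - 1) * y = H ^ (n - 1) * (y * H) * H ^ (n - 1) := by
              rw [mul_assoc, mul_assoc, e1, mul_one]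
          _ = α • (y * H ^ (n - 1)) := by
              rw [r3, mul_smul_comm, smul_mul_assoc, ← mul_assoc, e2, one_mul]
      have r9 : H * g * (g ^ (m - 1) * H ^ (n - 1)) = 1 := by
        rw [mul_assoc, ← mul_assoc g, e3, one_mul, e1]
      constructor
      · simp only [AlgHom.comp_apply, TaftAlgebra.antipodeHom, TaftAlgebra.lift_h,
          AlgHom.op_apply_apply, MulOpposite.unop_op, ← MulOpposite.op_mul, map_pow]
        rw [r6]
      · simp only [AlgHom.comp_apply, TaftAlgebra.antipodeHom, TaftAlgebra.lift_h,
          TaftAlgebra.lift_x, AlgHom.op_apply_apply, MulOpposite.unop_op, ← MulOpposite.op_mul,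
          map_pow, map_neg, map_mul, ← MulOpposite.op_smul]
        congr 1
        rw [neg_mul, mul_neg, smul_neg, mul_assoc, ← r6, ← mul_assoc, r7, smul_mul_assoc, mul_assoc]
      · simp only [AlgHom.comp_apply, TaftAlgebra.antipodeHom, TaftAlgebra.lift_h,
          TaftAlgebra.lift_x, AlgHom.op_apply_apply, MulOpposite.unop_op, ← MulOpposite.op_mul,
          map_pow, map_neg, map_mul, ← MulOpposite.op_smul]
        congr 1
        rw [neg_mul, mul_neg, smul_neg, mul_assoc, r6, ← mul_assoc, r8, smul_mul_assoc, mul_assoc]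
      · simp only [AlgHom.comp_apply, TaftAlgebra.antipodeHom, TaftAlgebra.lift_h,
          TaftAlgebra.lift_x, AlgHom.op_apply_apply, MulOpposite.unop_op, ← MulOpposite.op_mul,
          map_pow, map_neg, map_mul, ← MulOpposite.op_smul, ← MulOpposite.op_one,
          ← MulOpposite.op_sub, ← MulOpposite.op_add]
        congr 1
        rw [neg_mul_neg, neg_mul_neg]
        calc X * H ^ (n - 1) * (y * g ^ (m - 1))
            = X * (H ^ (n - 1) * y) * g ^ (m - 1) := by noncomm_ring
          _ = (α • (X * y)) * (g ^ (m - 1) * H ^ (n - 1)) := by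
              rw [r8, r6, mul_smul_comm, smul_mul_assoc, smul_mul_assoc]
              congr 1
              noncomm_ring
          _ = (y * X - l • (1 - H * g)) * (g ^ (m - 1) * H ^ (n - 1)) := by
              rw [r4, add_sub_cancel_right]
          -- Multiplying `1 - Hg` by the inverse of `Hg` reverses its sign, which turns `-l` into
          -- `+l`.
          _ = y * (X * g ^ (m - 1)) * H ^ (n - 1) + l • (1 - g ^ (m - 1) * H ^ (n - 1)) := by
              rw [sub_mul, smul_mul_assoc, sub_mul, r9, one_mul, ← neg_sub 1, smul_neg, sub_neg_eq_add]
              congr 1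
              noncomm_ring
          _ = _ := by
              rw [r7, mul_smul_comm, smul_mul_assoc]
              congr 2
              noncomm_ring)

/-- The antipode as a linear map. -/
noncomputable def antipodeLin : TaftBicrossed p q α l n m →ₗ[k] TaftBicrossed p q α l n m :=
  (MulOpposite.opLinearEquiv k).symm.toLinearMap ∘ₗ (antipodeHom p q α l n m).toLinearMap

theorem antipodeLin_mul (a b : TaftBicrossed p q α l n m) :
    antipodeLin p q α l n m (a * b) = antipodeLin p q α l n m b * antipodeLin p q α l n m a := by
  simp [antipodeLin]

theorem antipodeLin_inl (a : TaftAlgebra p n) : antipodeLin p q α l n m (inl p q α l n m a) =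
    inl p q α l n m (HopfAlgebra.antipode k a) := by
  simp only [antipodeLin, antipodeHom, LinearMap.comp_apply, AlgHom.toLinearMap_apply, lift_inl]
  rfl

theorem antipodeLin_inr (b : TaftAlgebra q m) : antipodeLin p q α l n m (inr p q α l n m b) =
    inr p q α l n m (HopfAlgebra.antipode k b) := by
  simp only [antipodeLin, antipodeHom, LinearMap.comp_apply, AlgHom.toLinearMap_apply, lift_inr]
  rfl

section AntipodeAxioms

variable {A E : Type*} [Ring A] [HopfAlgebra k A] [Ring E] [Bialgebra k E] {S : E →ₗ[k] E}

/-- This makes the antipode axiom stable under products, so that it need only be checked on the two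
Taft subalgebras. -/
theorem antipode_left_mul (hS : ∀ a b, S (a * b) = S b * S a) (t s : E ⊗[k] E) (c : k)
    (ht : LinearMap.mul' k _ (S.rTensor _ t) = algebraMap k _ c) :
    LinearMap.mul' k _ (S.rTensor _ (t * s)) = c • LinearMap.mul' k _ (S.rTensor _ s) := by
  have key : ∀ (t : E ⊗[k] E) (a b : E), LinearMap.mul' k _ (S.rTensor _ (t * a ⊗ₜ[k] b)) =
      S a * LinearMap.mul' k _ (S.rTensor _ t) * b := by
    intro t a b
    induction t using TensorProduct.induction_on with
    | zero => simp
    | tmul y z => simp [hS, mul_assoc]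
    | add y z hy hz => rw [add_mul, map_add, map_add, hy, hz, map_add, map_add, mul_add, add_mul]
  induction s using TensorProduct.induction_on with
  | zero => simp
  | tmul a b =>
    rw [key, ht, ← Algebra.commutes, mul_assoc, Algebra.smul_def]
    simp
  | add y z hy hz => rw [mul_add, map_add, map_add, hy, hz, map_add, map_add, smul_add]

theorem antipode_right_mul (hS : ∀ a b, S (a * b) = S b * S a) (t s : E ⊗[k] E) (c : k)
    (hs : LinearMap.mul' k _ (S.lTensor _ s) = algebraMap k _ c) :
    LinearMap.mul' k _ (S.lTensor _ (t * s)) = c • LinearMap.mul' k _ (S.lTensor _ t) := by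
  have key : ∀ (s : E ⊗[k] E) (a b : E), LinearMap.mul' k _ (S.lTensor _ (a ⊗ₜ[k] b * s)) =
      a * LinearMap.mul' k _ (S.lTensor _ s) * S b := by
    intro s a b
    induction s using TensorProduct.induction_on with
    | zero => simp
    | tmul y z => simp [hS, mul_assoc]
    | add y z hy hz => rw [mul_add, map_add, map_add, hy, hz, map_add, map_add, mul_add, add_mul]
  induction t using TensorProduct.induction_on with
  | zero => simp
  | tmul a b =>
    rw [key, hs, ← Algebra.commutes, mul_assoc, Algebra.smul_def]
    simp
  | add y z hy hz => rw [add_mul, map_add, map_add, hy, hz, map_add, map_add, smul_add]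

theorem antipode_left_map (f : A →ₐ[k] E) (hf : ∀ a, S (f a) = f (HopfAlgebra.antipode k a))
    (a : A) : LinearMap.mul' k _ (S.rTensor _
      (Algebra.TensorProduct.map f f (Coalgebra.comul (R := k) a))) =
      algebraMap k _ (Coalgebra.counit (R := k) a) := by
  rw [← AlgHom.commutes f, ← HopfAlgebra.mul_antipode_rTensor_comul_apply]
  induction Coalgebra.comul (R := k) a using TensorProduct.induction_on with
  | zero => simp
  | tmul a b => simp [hf]
  | add a b ha hb => simp only [map_add, ha, hb]

theorem antipode_right_map (f : A →ₐ[k] E) (hf : ∀ a, S (f a) = f (HopfAlgebra.antipode k a))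
    (a : A) : LinearMap.mul' k _ (S.lTensor _
      (Algebra.TensorProduct.map f f (Coalgebra.comul (R := k) a))) =
      algebraMap k _ (Coalgebra.counit (R := k) a) := by
  rw [← AlgHom.commutes f, ← HopfAlgebra.mul_antipode_lTensor_comul_apply]
  induction Coalgebra.comul (R := k) a using TensorProduct.induction_on with
  | zero => simp
  | tmul a b => simp [hf]
  | add a b ha hb => simp only [map_add, ha, hb]

end AntipodeAxioms

noncomputable instance instHopfAlgebra : HopfAlgebra k (TaftBicrossed p q α l n m) where
  antipode := antipodeLin p q α l n m
  mul_antipode_rTensor_comul := by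
    ext a
    simp only [LinearMap.comp_apply, Algebra.linearMap_apply]
    induction a using TaftBicrossed.induction with
    | left a =>
      rw [comul_inl, counit_inl, antipode_left_map _ (antipodeLin_inl p q α l n m)]
    | right b =>
      rw [comul_inr, counit_inr, antipode_left_map _ (antipodeLin_inr p q α l n m)]
    | mul a b ha hb =>
      rw [Bialgebra.comul_mul, antipode_left_mul (antipodeLin_mul p q α l n m) _ _ _ ha, hb,
        Bialgebra.counit_mul, map_mul, Algebra.smul_def]
    | add a b ha hb => rw [map_add, map_add, map_add, ha, hb, map_add, map_add]
  mul_antipode_lTensor_comul := by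
    ext a
    simp only [LinearMap.comp_apply, Algebra.linearMap_apply]
    induction a using TaftBicrossed.induction with
    | left a =>
      rw [comul_inl, counit_inl, antipode_right_map _ (antipodeLin_inl p q α l n m)]
    | right b =>
      rw [comul_inr, counit_inr, antipode_right_map _ (antipodeLin_inr p q α l n m)]
    | mul a b ha hb =>
      rw [Bialgebra.comul_mul, antipode_right_mul (antipodeLin_mul p q α l n m) _ _ _ hb, ha,
        Bialgebra.counit_mul, map_mul, Algebra.smul_def, Algebra.commutes]
    | add a b ha hb => rw [map_add, map_add, map_add, ha, hb, map_add, map_add]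

end Hopf

end TaftBicrossed

/-! ### Bijectivity of the product map for admissible parameters. -/

theorem mul_pow_eq_zero_of_qComm {k : Type u} [Field k] {E : Type*} [Ring E] [Algebra k E] {q : k}
    {a b : E} {m : ℕ} (hab : b * a = q • (a * b)) (hb : b ^ m = 0) : (a * b) ^ m = 0 := by
  -- Reordering costs only a scalar, whose value is irrelevant.
  have key : ∀ i : ℕ, ∃ c : k, (a * b) ^ i = c • (a ^ i * b ^ i) := by
    intro i
    induction i with
    | zero => exact ⟨1, by simp⟩
    | succ i ih =>
      obtain ⟨c, hc⟩ := ih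
      refine ⟨q ^ i * c, ?_⟩
      rw [pow_succ', hc, mul_smul_comm, mul_assoc, ← mul_assoc b,
        TaftAlgebra.mul_pow_of_qComm hab i, smul_mul_assoc, mul_smul_comm, smul_smul, mul_comm c,
        mul_assoc (a ^ i), ← pow_succ', ← mul_assoc, ← pow_succ']
  obtain ⟨c, hc⟩ := key m
  rw [hc, hb, mul_zero, smul_zero]

namespace TaftBicrossed

open TaftAlgebra (h x scale)

variable {k : Type u} [Field k]

/-- The parameters for which the presented algebra is a bicrossed product. -/
structure Admissible (p q α l : k) (n m : ℕ) : Prop where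
  pow_left : α ^ n = 1
  pow_right : α ^ m = 1
  eq_right : l * (α - q) = 0
  eq_left : l * (α * p - 1) = 0

variable {p q α l : k} {n m : ℕ}

/-- The properties of the Jackson derivative on the first Taft algebra which describes the
commutator with `x`. -/
structure IsJackson (q α l : k) (m : ℕ) (hα : α ^ n = 1)
    (D : TaftAlgebra p n →ₗ[k] TaftAlgebra p n) : Prop where
  map_one : D 1 = 0
  map_h_mul : ∀ a, D (h p n * a) = α • (h p n * D a)
  map_x_mul : ∀ a, D (x p n * a) = α • (x p n * D a) + l • a
  scale_comm : ∀ a, D (scale α α hα a) = q • scale α α hα (D a)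
  scale_one_comm : ∀ a, D (scale 1 α (one_pow n) a) = q • scale 1 α (one_pow n) (D a)
  -- The closed form `D f = l (f(αX) - f(X)) / ((α - 1)X)`, with the denominator cleared.
  x_mul_apply : ∀ a, (α - 1) • (x p n * D a) = l • (scale 1 α (one_pow n) a - a)
  pow_eq_zero : D ^ m = 0
  -- The last two conditions express `α = q` and `αp = 1` in a form that also holds for `D = 0`.
  smul_apply : ∀ a, α • D a = q • D a
  mul_smul_apply : ∀ a, (α * p) • D a = D a

/-- For `l = 0` take `D = 0`. Otherwise `αp = 1`, so precomposing the action of `skewDer` with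
`scale α α` undoes the twist `scale p p` of its Leibniz rule; the factor `l * α⁻¹` normalises the
value at `X` to `l`. -/
theorem exists_isJackson [NeZero n] [NeZero m] [hp : Fact (IsPrimitiveRoot p n)]
    [hq : Fact (IsPrimitiveRoot q m)] (hn : 2 ≤ n) (hm : 2 ≤ m) (hα : Admissible p q α l n m) :
    ∃ D : TaftAlgebra p n →ₗ[k] TaftAlgebra p n, IsJackson q α l m hα.pow_left D := by
  by_cases hl : l = 0
  · subst hl
    exact ⟨0, by simp, by simp, by simp, by simp, by simp, by simp, zero_pow (NeZero.ne m),
      by simp, by simp⟩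
  have hαq : α = q := sub_eq_zero.mp ((mul_eq_zero.mp hα.eq_right).resolve_left hl)
  have hαp : α * p = 1 := sub_eq_zero.mp ((mul_eq_zero.mp hα.eq_left).resolve_left hl)
  have hα0 : α ≠ 0 := left_ne_zero_of_mul (hαp.trans_ne one_ne_zero)
  let D : TaftAlgebra p n →ₗ[k] TaftAlgebra p n := (l * α⁻¹) •
    (rightAct (TaftAlgebra.skewDer hn hp.out.pow_eq_one) ∘ₗ
      (scale α α hα.pow_left).toLinearMap)
  have D_apply : ∀ a, D a = (l * α⁻¹) • rightAct (TaftAlgebra.skewDer hn hp.out.pow_eq_one)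
      (scale α α hα.pow_left a) := fun a => rfl
  have hqα : ∀ y : TaftAlgebra p n, q • y = α • y := fun y => by rw [hαq]
  have hone : D 1 = 0 := by
    rw [D_apply, map_one, TaftAlgebra.rightAct_skewDer_one, smul_zero]
  have hh : ∀ a, D (h p n * a) = α • (h p n * D a) := by
    intro a
    rw [D_apply, D_apply, map_mul, TaftAlgebra.scale_h, smul_mul_assoc, map_smul,
      TaftAlgebra.rightAct_skewDer_h_mul, mul_smul_comm, smul_comm α]
  have hscale : ∀ a : TaftAlgebra p n, scale p p hp.out.pow_eq_one (scale α α hα.pow_left a) = a := by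
    intro a
    have : (scale p p hp.out.pow_eq_one).comp (scale α α hα.pow_left) =
        AlgHom.id k (TaftAlgebra p n) :=
      TaftAlgebra.algHom_ext (by simp [TaftAlgebra.scale_h, smul_smul, hαp])
        (by simp [TaftAlgebra.scale_x, smul_smul, hαp])
    exact AlgHom.congr_fun this a
  have hx : ∀ a, D (x p n * a) = α • (x p n * D a) + l • a := by
    intro a
    rw [D_apply, D_apply, map_mul, TaftAlgebra.scale_x, smul_mul_assoc, map_smul,
      TaftAlgebra.rightAct_skewDer_x_mul, hscale, smul_add, smul_add, mul_smul_comm, smul_comm α,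
      smul_smul _ α a, mul_assoc, inv_mul_cancel₀ hα0, mul_one]
  -- At `s = m` the inhomogeneous term dies, because the `m`-th `q`-integer is zero; this gives `D ^
  -- m = 0` by induction. At `s = 0` the truncated exponent is masked by a zero coefficient.
  have hpow : ∀ (s : ℕ) (a : TaftAlgebra p n), (D ^ s) (x p n * a) =
      α ^ s • (x p n * (D ^ s) a) + (l * TaftAlgebra.qInt α s) • (D ^ (s - 1)) a := by
    intro s
    induction s with
    | zero => intro a; simp [TaftAlgebra.qInt]
    | succ s ih =>
      intro a
      have e : TaftAlgebra.qInt α s • D ((D ^ (s - 1)) a) = TaftAlgebra.qInt α s • (D ^ s) a := by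
        cases s with
        | zero => simp [TaftAlgebra.qInt]
        | succ s => rw [Nat.add_sub_cancel, pow_succ' D s, Module.End.mul_apply]
      rw [pow_succ' D s, Module.End.mul_apply, ih, map_add, map_smul, hx, map_smul, mul_smul, e,
        Module.End.mul_apply, Nat.add_sub_cancel]
      simp only [TaftAlgebra.qInt, Finset.sum_range_succ, smul_add]
      module
  have hpow_h : ∀ (s : ℕ) (a : TaftAlgebra p n),
      (D ^ s) (h p n * a) = α ^ s • (h p n * (D ^ s) a) := by
    intro s
    induction s with
    | zero => intro a; simp
    | succ s ih =>
      intro a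
      rw [pow_succ' D s, Module.End.mul_apply, ih, map_smul, hh, smul_smul, Module.End.mul_apply,
        pow_succ]
  refine ⟨D, hone, hh, hx, fun a => ?_, fun a => ?_, fun a => ?_, ?_, fun a => (hqα _).symm,
    fun a => by rw [hαp, one_smul]⟩
  · rw [hqα]
    induction a using TaftAlgebra.induction_left with
    | one => simp [hone]
    | h_mul a ha =>
      rw [map_mul, TaftAlgebra.scale_h, smul_mul_assoc, map_smul, hh, hh, ha, map_smul, map_mul,
        TaftAlgebra.scale_h]
      simp only [smul_mul_assoc, mul_smul_comm]
    | x_mul a ha =>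
      rw [map_mul, TaftAlgebra.scale_x, smul_mul_assoc, map_smul, hx, hx, ha, map_add, map_smul,
        map_mul, TaftAlgebra.scale_x, map_smul]
      simp only [smul_mul_assoc, mul_smul_comm, smul_add]
    | smul c a ha => simp only [map_smul, ha]; rw [smul_comm]
    | add a b ha hb => simp only [map_add, ha, hb, smul_add]
  · rw [hqα]
    induction a using TaftAlgebra.induction_left with
    | one => simp [hone]
    | h_mul a ha =>
      rw [map_mul, TaftAlgebra.scale_h, smul_mul_assoc, map_smul, hh, hh, ha, map_smul, map_mul,
        TaftAlgebra.scale_h]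
      simp only [mul_smul_comm, one_smul]
    | x_mul a ha =>
      rw [map_mul, TaftAlgebra.scale_x, smul_mul_assoc, map_smul, hx, hx, ha, map_add, map_smul,
        map_mul, TaftAlgebra.scale_x, map_smul]
      simp only [smul_mul_assoc, mul_smul_comm, smul_add]
    | smul c a ha => simp only [map_smul, ha]; rw [smul_comm]
    | add a b ha hb => simp only [map_add, ha, hb, smul_add]
  · induction a using TaftAlgebra.induction_left with
    | one => simp [hone]
    | h_mul a ha =>
      rw [hh, mul_smul_comm, ← mul_assoc, TaftAlgebra.x_mul_h, smul_mul_assoc, smul_smul, smul_smul,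
        mul_assoc (α - 1), hαp, mul_one, mul_assoc, ← mul_smul_comm, ha, map_mul, TaftAlgebra.scale_h, one_smul,
        mul_smul_comm, mul_sub]
    | x_mul a ha =>
      rw [hx, mul_add, mul_smul_comm, smul_add, smul_comm, ← mul_smul_comm (α - 1), ha, map_mul,
        TaftAlgebra.scale_x]
      simp only [mul_smul_comm, smul_mul_assoc, mul_sub]
      module
    | smul c a ha => rw [map_smul, mul_smul_comm, smul_comm, ha, map_smul]; module
    | add a b ha hb => rw [map_add, mul_add, smul_add, ha, hb, map_add]; module
  · ext a
    rw [LinearMap.zero_apply]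
    induction a using TaftAlgebra.induction_left with
    | one =>
      obtain ⟨s, hs⟩ := Nat.exists_eq_succ_of_ne_zero (NeZero.ne m)
      rw [hs, pow_succ, Module.End.mul_apply, hone, map_zero]
    | h_mul a ha => rw [hpow_h, ha, mul_zero, smul_zero]
    | x_mul a ha =>
      rw [hpow, ha, hαq, TaftAlgebra.qInt_eq_zero hq.out (by omega), mul_zero, mul_zero, smul_zero,
        zero_smul, add_zero]
    | smul c a ha => rw [map_smul, ha, smul_zero]
    | add a b ha hb => rw [map_add, ha, hb, add_zero]

section Representation

variable (q) (hα : Admissible p q α l n m) (D : TaftAlgebra p n →ₗ[k] TaftAlgebra p n)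

/-- The action of `h` on the tensor product of the two Taft algebras. -/
noncomputable def hOp (α : k) : Module.End k (TaftAlgebra p n ⊗[k] TaftAlgebra q m) :=
  TensorProduct.map (scale 1 α (one_pow n)).toLinearMap (LinearMap.mulLeft k (h q m))

/-- The action of `x` on the tensor product of the two Taft algebras. -/
noncomputable def xOp (hα : α ^ n = 1) : Module.End k (TaftAlgebra p n ⊗[k] TaftAlgebra q m) :=
  -- The three terms encode the rule `x a = σ(a) x + D(a) - H D(a) h`, with `σ = scale α α`.
  TensorProduct.map (LinearMap.mulLeft k (-h p n) * D) (LinearMap.mulLeft k (h q m)) +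
    TensorProduct.map (scale α α hα).toLinearMap (LinearMap.mulLeft k (x q m)) +
    TensorProduct.map D 1

@[simp]
theorem hOp_tmul (a : TaftAlgebra p n) (b : TaftAlgebra q m) :
    hOp q α (a ⊗ₜ[k] b) = scale 1 α (one_pow n) a ⊗ₜ[k] (h q m * b) := rfl

@[simp]
theorem xOp_tmul (hα : α ^ n = 1) (a : TaftAlgebra p n) (b : TaftAlgebra q m) :
    xOp q D hα (a ⊗ₜ[k] b) = (-h p n * D a) ⊗ₜ[k] (h q m * b) +
      scale α α hα a ⊗ₜ[k] (x q m * b) + D a ⊗ₜ[k] b := rfl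

variable {q D}

theorem hOp_pow (hα : Admissible p q α l n m) :
    (hOp q α : Module.End k (TaftAlgebra p n ⊗[k] TaftAlgebra q m)) ^ m = 1 := by
  have h1 : ∀ s : ℕ, (scale 1 α (one_pow n) : TaftAlgebra p n →ₐ[k] _) ^ s =
      scale 1 (α ^ s) (one_pow n) := by
    intro s
    refine TaftAlgebra.algHom_ext ?_ ?_ <;> induction s with
    | zero => simp [TaftAlgebra.scale_h, TaftAlgebra.scale_x]
    | succ s ih =>
      rw [pow_succ', AlgHom.mul_apply, ih]
      simp [TaftAlgebra.scale_h, TaftAlgebra.scale_x, smul_smul, pow_succ]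
  have h2 : (scale 1 α (one_pow n) : TaftAlgebra p n →ₐ[k] _).toLinearMap ^ m = 1 := by
    ext a
    have h3 : ∀ s : ℕ, ((scale 1 α (one_pow n) : TaftAlgebra p n →ₐ[k] _).toLinearMap ^ s) a =
        ((scale 1 α (one_pow n) : TaftAlgebra p n →ₐ[k] _) ^ s) a := by
      intro s
      rw [Module.End.coe_pow, AlgHom.coe_pow]
      rfl
    have h4 : (scale 1 1 (one_pow n) : TaftAlgebra p n →ₐ[k] _) = AlgHom.id k _ :=
      TaftAlgebra.algHom_ext (by simp [TaftAlgebra.scale_h]) (by simp [TaftAlgebra.scale_x])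
    rw [h3, h1]
    simp only [hα.pow_right, h4]
    rfl
  rw [hOp, TensorProduct.map_pow, h2, LinearMap.pow_mulLeft, TaftAlgebra.h_pow,
    LinearMap.mulLeft_one]
  exact TensorProduct.map_id

/-- The last summand `q`-commutes with the sum of the other two, which `q`-commute with each other,
and each has vanishing `m`-th power. Two applications of the `q`-binomial theorem conclude. -/
theorem xOp_pow [NeZero m] [hq : Fact (IsPrimitiveRoot q m)] (hα : Admissible p q α l n m)
    (hD : IsJackson q α l m hα.pow_left D) :
    (xOp q D hα.pow_left : Module.End k (TaftAlgebra p n ⊗[k] TaftAlgebra q m)) ^ m = 0 := by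
  refine TaftAlgebra.add_pow_eq_zero_of_qComm hq.out ?_
    (TaftAlgebra.add_pow_eq_zero_of_qComm hq.out ?_ ?_ ?_) ?_
  · refine TensorProduct.ext' fun a b => ?_
    simp only [Module.End.mul_apply, LinearMap.add_apply, TensorProduct.map_tmul,
      LinearMap.mulLeft_apply, AlgHom.toLinearMap_apply, map_add, Module.End.one_apply, neg_mul,
      map_neg, hD.map_h_mul, hD.scale_comm, LinearMap.smul_apply, smul_add]
    rw [← mul_smul_comm, hD.smul_apply, mul_smul_comm, ← smul_neg, TensorProduct.smul_tmul',
      TensorProduct.smul_tmul']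
  · refine TensorProduct.ext' fun a b => ?_
    simp only [Module.End.mul_apply, TensorProduct.map_tmul, LinearMap.mulLeft_apply,
      AlgHom.toLinearMap_apply, neg_mul, map_neg, map_mul, TaftAlgebra.scale_h, hD.scale_comm,
      LinearMap.smul_apply, smul_mul_assoc, mul_smul_comm]
    rw [← mul_assoc, TaftAlgebra.x_mul_h, smul_mul_assoc, TensorProduct.tmul_smul, ← mul_smul_comm,
      ← map_smul, hD.smul_apply, map_smul, mul_smul_comm, mul_assoc,
      smul_neg]
  · rw [TensorProduct.map_pow, mul_pow_eq_zero_of_qComm (q := α) ?_ hD.pow_eq_zero,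
      TensorProduct.map_zero_left]
    ext a
    simp [hD.map_h_mul]
  · rw [TensorProduct.map_pow, LinearMap.pow_mulLeft, TaftAlgebra.x_pow,
      LinearMap.mulLeft_zero_eq_zero, TensorProduct.map_zero_right]
  · rw [TensorProduct.map_pow, hD.pow_eq_zero, TensorProduct.map_zero_left]

theorem xOp_mul_hOp (hα : Admissible p q α l n m) (hD : IsJackson q α l m hα.pow_left D) :
    (xOp q D hα.pow_left * hOp q α : Module.End k (TaftAlgebra p n ⊗[k] TaftAlgebra q m)) =
      q • (hOp q α * xOp q D hα.pow_left) := by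
  have hcomm : ∀ a : TaftAlgebra p n, scale α α hα.pow_left (scale 1 α (one_pow n) a) =
      scale 1 α (one_pow n) (scale α α hα.pow_left a) := by
    intro a
    have : (scale α α hα.pow_left).comp (scale 1 α (one_pow n)) =
        (scale 1 α (one_pow n)).comp (scale α α hα.pow_left : TaftAlgebra p n →ₐ[k] _) :=
      TaftAlgebra.algHom_ext (by simp [TaftAlgebra.scale_h]) (by simp [TaftAlgebra.scale_x])
    exact AlgHom.congr_fun this a
  refine TensorProduct.ext' fun a b => ?_
  simp only [Module.End.mul_apply, hOp_tmul, xOp_tmul, hD.scale_one_comm, hcomm, map_add,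
    LinearMap.smul_apply, map_mul, map_neg, TaftAlgebra.scale_h, one_smul, smul_add]
  congr 1
  · congr 1
    · rw [TensorProduct.smul_tmul', mul_smul_comm]
    · rw [← mul_assoc, TaftAlgebra.x_mul_h, smul_mul_assoc, TensorProduct.tmul_smul, mul_assoc]

/-- The action of the first Taft algebra by left multiplication. -/
noncomputable def leftRep (p q : k) (n m : ℕ) :
    TaftAlgebra p n →ₐ[k] Module.End k (TaftAlgebra p n ⊗[k] TaftAlgebra q m) :=
  Algebra.lsmul k k (TaftAlgebra p n ⊗[k] TaftAlgebra q m)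

@[simp]
theorem leftRep_tmul (c a : TaftAlgebra p n) (b : TaftAlgebra q m) :
    leftRep p q n m c (a ⊗ₜ[k] b) = (c * a) ⊗ₜ[k] b := rfl

/-- The action of the second Taft algebra. -/
noncomputable def rightRep [NeZero m] [hq : Fact (IsPrimitiveRoot q m)]
    (hα : Admissible p q α l n m) (hD : IsJackson q α l m hα.pow_left D) :
    TaftAlgebra q m →ₐ[k] Module.End k (TaftAlgebra p n ⊗[k] TaftAlgebra q m) :=
  TaftAlgebra.lift (hOp q α) (xOp q D hα.pow_left) (hOp_pow hα) (xOp_pow hα hD) (xOp_mul_hOp hα hD)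

/-- Since `D` kills `1`, the twisted action reduces to left multiplication on `1 ⊗ b`. This lets
evaluation at `1 ⊗ 1` recover a tensor. -/
theorem rightRep_one_tmul [NeZero m] [hq : Fact (IsPrimitiveRoot q m)]
    (hα : Admissible p q α l n m) (hD : IsJackson q α l m hα.pow_left D) (b : TaftAlgebra q m) :
    rightRep hα hD b (1 ⊗ₜ[k] 1) = 1 ⊗ₜ[k] b := by
  induction b using TaftAlgebra.induction_left with
  | one => simp
  | h_mul b hb =>
    rw [map_mul, Module.End.mul_apply, hb, rightRep, TaftAlgebra.lift_h, hOp_tmul, map_one]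
  | x_mul b hb =>
    rw [map_mul, Module.End.mul_apply, hb, rightRep, TaftAlgebra.lift_x, xOp_tmul, hD.map_one,
      map_one]
    simp
  | smul c b hb => rw [map_smul, LinearMap.smul_apply, hb, TensorProduct.tmul_smul]
  | add a b ha hb => rw [map_add, LinearMap.add_apply, ha, hb, TensorProduct.tmul_add]

theorem mixedRelations_rep [NeZero m] [hq : Fact (IsPrimitiveRoot q m)]
    (hα : Admissible p q α l n m) (hD : IsJackson q α l m hα.pow_left D) :
    MixedRelations α l (leftRep p q n m) (rightRep hα hD) := by
  -- The part of the `xX` relation that involves `h` reduces to the closed form `x_mul_apply`,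
  -- multiplied by `H`, and `αp = 1` on values of `D`.
  have key : ∀ a, -(h p n * (α • (x p n * D a) + l • a)) =
      -(α • (x p n * (h p n * D a))) - l • (h p n * scale 1 α (one_pow n) a) := by
    intro a
    have h1 := congrArg (h p n * ·) (hD.x_mul_apply a)
    have h2 : (α * p) • (h p n * (x p n * D a)) = h p n * (x p n * D a) := by
      rw [← mul_smul_comm, ← mul_smul_comm, hD.mul_smul_apply]
    simp only [mul_smul_comm, mul_sub, smul_sub, sub_smul, one_smul] at h1
    rw [← mul_assoc (x p n), TaftAlgebra.x_mul_h, smul_mul_assoc, smul_smul, mul_assoc,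
      h2, mul_add, mul_smul_comm, mul_smul_comm]
    rw [← sub_eq_zero] at h1 ⊢
    rw [← neg_eq_zero, ← h1]
    abel
  constructor <;> rw [rightRep] <;> simp only [TaftAlgebra.lift_h, TaftAlgebra.lift_x] <;>
    refine TensorProduct.ext' fun a b => ?_
  · simp [TaftAlgebra.scale_h]
  · simp [TaftAlgebra.scale_x, TensorProduct.smul_tmul']
  · simp only [Module.End.mul_apply, leftRep_tmul, xOp_tmul, hD.map_h_mul, map_mul,
      TaftAlgebra.scale_h, LinearMap.smul_apply, map_add, smul_add, TensorProduct.smul_tmul',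
      smul_mul_assoc, mul_smul_comm, neg_mul, mul_neg]
  · simp only [Module.End.mul_apply, leftRep_tmul, xOp_tmul, hD.map_x_mul, map_mul,
      TaftAlgebra.scale_x, LinearMap.smul_apply, LinearMap.add_apply, LinearMap.sub_apply,
      Module.End.one_apply, hOp_tmul, map_add, smul_add, TensorProduct.smul_tmul',
      smul_mul_assoc, neg_mul, mul_neg, key, TensorProduct.add_tmul, TensorProduct.sub_tmul, smul_sub,
      smul_neg]
    abel

/-- The Poincaré–Birkhoff–Witt theorem: the product map from the tensor product is bijective. -/
theorem mulMap_bijective [NeZero n] [NeZero m] [hp : Fact (IsPrimitiveRoot p n)]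
    [hq : Fact (IsPrimitiveRoot q m)] (hn : 2 ≤ n) (hm : 2 ≤ m) (hα : Admissible p q α l n m) :
    Function.Bijective (mulMap (inlBialgHom p q α l n m) (inrBialgHom p q α l n m)) := by
  constructor
  · obtain ⟨D, hD⟩ := exists_isJackson hn hm hα
    let φ := lift _ _ (mixedRelations_rep hα hD)
    -- Applying the representation to the vector `1 ⊗ 1` is a left inverse of the product map.
    refine Function.LeftInverse.injective (g := fun e => φ e (1 ⊗ₜ[k] 1)) fun z => ?_
    induction z using TensorProduct.induction_on with
    | zero => simp
    | add a b ha hb => simp only [map_add, LinearMap.add_apply, ha, hb]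
    | tmul a b =>
      simp only [mulMap_tmul, inlBialgHom_apply, inrBialgHom_apply, map_mul, φ, lift_inl, lift_inr,
        Module.End.mul_apply, rightRep_one_tmul, leftRep_tmul, mul_one]
  -- For surjectivity, the range is shown to be a left ideal containing `1`; the mixed relations
  -- move `h` and `x` to the right of the first factor.
  · set i := inlBialgHom p q α l n m
    set j := inrBialgHom p q α l n m
    obtain ⟨r1, r2, r3, r4⟩ :=
      mixedRelations (p := p) (q := q) (α := α) (l := l) (n := n) (m := m)
    have hinl : ∀ a, ∀ y ∈ LinearMap.range (mulMap i j), i a * y ∈ LinearMap.range (mulMap i j) := by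
      rintro a _ ⟨z, rfl⟩
      induction z using TensorProduct.induction_on with
      | zero => simp
      | tmul c b => exact ⟨(a * c) ⊗ₜ[k] b, by simp [mul_assoc]⟩
      | add y z hy hz => rw [map_add, mul_add]; exact Submodule.add_mem _ hy hz
    have hmul : ∀ (y : TaftBicrossed p q α l n m), (∀ a b, y * (i a * j b) ∈ LinearMap.range (mulMap i j)) →
        ∀ z ∈ LinearMap.range (mulMap i j), y * z ∈ LinearMap.range (mulMap i j) := by
      rintro y hy _ ⟨z, rfl⟩
      induction z using TensorProduct.induction_on with
      | zero => simp
      | tmul c b => rw [mulMap_tmul]; exact hy c b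
      | add y z hy hz => rw [map_add, mul_add]; exact Submodule.add_mem _ hy hz
    have hj : ∀ b, j b ∈ LinearMap.range (mulMap i j) := fun b => ⟨1 ⊗ₜ[k] b, by simp⟩
    have hh : ∀ z ∈ LinearMap.range (mulMap i j), j (h q m) * z ∈ LinearMap.range (mulMap i j) := by
      refine hmul _ fun a b => ?_
      induction a using TaftAlgebra.induction_left with
      | one => rw [map_one, one_mul, ← map_mul]; exact hj _
      | h_mul a ha =>
        have : j (h q m) * (i (h p n * a) * j b) = i (h p n) * (j (h q m) * (i a * j b)) := by
          rw [map_mul, mul_assoc, ← mul_assoc, show j (h q m) * i (h p n) = _ from r1, mul_assoc]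
          rfl
        rw [this]
        exact hinl _ _ ha
      | x_mul a ha =>
        have : j (h q m) * (i (x p n * a) * j b) = α • (i (x p n) * (j (h q m) * (i a * j b))) := by
          rw [map_mul, mul_assoc, ← mul_assoc, show j (h q m) * i (x p n) = _ from r2,
            smul_mul_assoc, mul_assoc]
          rfl
        rw [this]
        exact Submodule.smul_mem _ _ (hinl _ _ ha)
      | smul c a ha =>
        rw [map_smul, smul_mul_assoc, mul_smul_comm]; exact Submodule.smul_mem _ _ ha
      | add a b ha hb => rw [map_add, add_mul, mul_add]; exact Submodule.add_mem _ ha hb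
    have hx : ∀ z ∈ LinearMap.range (mulMap i j), j (x q m) * z ∈ LinearMap.range (mulMap i j) := by
      refine hmul _ fun a b => ?_
      induction a using TaftAlgebra.induction_left with
      | one => rw [map_one, one_mul, ← map_mul]; exact hj _
      | h_mul a ha =>
        have : j (x q m) * (i (h p n * a) * j b) = α • (i (h p n) * (j (x q m) * (i a * j b))) := by
          rw [map_mul, mul_assoc, ← mul_assoc, show j (x q m) * i (h p n) = _ from r3,
            smul_mul_assoc, mul_assoc]
          rfl
        rw [this]
        exact Submodule.smul_mem _ _ (hinl _ _ ha)
      | x_mul a ha =>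
        have : j (x q m) * (i (x p n * a) * j b) = α • (i (x p n) * (j (x q m) * (i a * j b))) +
            l • (i a * j b - i (h p n) * (j (h q m) * (i a * j b))) := by
          rw [map_mul, mul_assoc, ← mul_assoc, show j (x q m) * i (x p n) = _ from r4,
            add_mul, smul_mul_assoc, smul_mul_assoc, sub_mul, one_mul, mul_assoc, mul_assoc]
          rfl
        rw [this]
        have hab : i a * j b ∈ LinearMap.range (mulMap i j) := ⟨a ⊗ₜ[k] b, by simp⟩
        exact Submodule.add_mem _ (Submodule.smul_mem _ _ (hinl _ _ ha))
          (Submodule.smul_mem _ _ (Submodule.sub_mem _ hab (hinl _ _ (hh _ hab))))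
      | smul c a ha =>
        rw [map_smul, smul_mul_assoc, mul_smul_comm]; exact Submodule.smul_mem _ _ ha
      | add a b ha hb => rw [map_add, add_mul, mul_add]; exact Submodule.add_mem _ ha hb
    have hr : ∀ b, ∀ z ∈ LinearMap.range (mulMap i j), j b * z ∈ LinearMap.range (mulMap i j) := by
      intro b
      induction b using TaftAlgebra.induction_left with
      | one => simp
      | h_mul b hb => intro z hz; rw [map_mul, mul_assoc]; exact hh _ (hb z hz)
      | x_mul b hb => intro z hz; rw [map_mul, mul_assoc]; exact hx _ (hb z hz)
      | smul c b hb =>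
        intro z hz; rw [map_smul, smul_mul_assoc]; exact Submodule.smul_mem _ _ (hb z hz)
      | add a b ha hb =>
        intro z hz; rw [map_add, add_mul]; exact Submodule.add_mem _ (ha z hz) (hb z hz)
    have key : ∀ e : TaftBicrossed p q α l n m, ∀ z ∈ LinearMap.range (mulMap i j),
        e * z ∈ LinearMap.range (mulMap i j) := by
      intro e
      induction e using TaftBicrossed.induction with
      | left a => exact hinl a
      | right b => exact hr b
      | mul a b ha hb => intro z hz; rw [mul_assoc]; exact ha _ (hb z hz)
      | add a b ha hb => intro z hz; rw [add_mul]; exact Submodule.add_mem _ (ha z hz) (hb z hz)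
    intro e
    have h1 := key e 1 ⟨1, mulMap_one i j⟩
    rwa [mul_one] at h1

end Representation

end TaftBicrossed

/-! ### Embeddings of a Taft algebra in a factorization, and rescalings. -/

namespace TaftAlgebra

section Hom

variable {k : Type u} [Field k] [CharZero k] {p q r : k} {n m N : ℕ} [NeZero n] [NeZero m]
  [NeZero N] [hp : Fact (IsPrimitiveRoot p n)] [hq : Fact (IsPrimitiveRoot q m)]
  [hr : Fact (IsPrimitiveRoot r N)] (hn : 2 ≤ n) (hm : 2 ≤ m) (hN : 2 ≤ N)
  {E : Type*} [Ring E] [Bialgebra k E]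
  {i : TaftAlgebra p n →ₐc[k] E} {j : TaftAlgebra q m →ₐc[k] E}
  (hij : Function.Bijective (mulMap i j))

theorem x_ne_smul (hN : 2 ≤ N) (c : k) : x r N ≠ c • (1 - h r N) := fun h0 => by
  have h1 := congrArg (skewDer hN hr.out.pow_eq_one) h0
  have h2 := skewDer_h_pow hN hr.out.pow_eq_one 1
  rw [pow_one] at h2
  simp [skewDer_x, skewDer_one, h2] at h1

/-- If `y = c X + c' (1 - H)` satisfies `y H = r H y`, then `r = p` and `c' = 0`. -/
theorem eq_of_qComm {H X y : E} {c c' : k} (hXH : X * H = p • (H * X))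
    (hX : ∀ c : k, X ≠ c • (1 - H)) (hH : IsUnit H) (hH1 : H ≠ 1) (hr1 : r ≠ 1) (hc : c ≠ 0)
    (hy : y = c • X + c' • (1 - H)) (hyH : y * H = r • (H * y)) : r = p ∧ y = c • X := by
  have h1 : H * ((c * (p - r)) • X + (c' * (1 - r)) • (1 - H)) = 0 := by
    have e : y * H = H * ((c * p) • X + c' • (1 - H)) := by
      rw [hy, add_mul, smul_mul_assoc, hXH, mul_add, smul_mul_assoc, mul_smul_comm, mul_smul_comm,
        smul_smul, sub_mul, mul_sub, one_mul, mul_one]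
    rw [e, ← mul_smul_comm, ← sub_eq_zero, ← mul_sub, hy] at hyH
    rw [← hyH]
    congr 1
    module
  replace h1 := hH.mul_right_eq_zero.mp h1
  -- Otherwise the relation could be solved for `X` as a multiple of `1 - H`.
  have h2 : c * (p - r) = 0 := by
    by_contra h0
    refine hX (-((c * (p - r))⁻¹ * (c' * (1 - r)))) ?_
    have h3 := congrArg ((c * (p - r))⁻¹ • ·) h1
    simp only [smul_add, smul_smul, inv_mul_cancel₀ h0, one_smul, smul_zero] at h3
    rw [neg_smul]
    exact eq_neg_of_add_eq_zero_left h3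
  refine ⟨(sub_eq_zero.mp ((mul_eq_zero.mp h2).resolve_left hc)).symm, ?_⟩
  rw [h2, zero_smul, zero_add] at h1
  rcases smul_eq_zero.mp h1 with h3 | h3
  · rw [hy, (mul_eq_zero.mp h3).resolve_right (sub_ne_zero.mpr hr1.symm), zero_smul, add_zero]
  · exact absurd (sub_eq_zero.mp h3).symm hH1

include hn hm hN hij in
/-- A Taft algebra embeds in a factorization only through one of the two factors, up to
rescaling. -/
theorem hom_to_factorization (f : TaftAlgebra r N →ₐc[k] E) (hf : Function.Injective f) :
    (r = p ∧ f (h r N) = i (h p n) ∧ ∃ c : k, c ≠ 0 ∧ f (x r N) = c • i (x p n)) ∨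
    (r = q ∧ f (h r N) = j (h q m) ∧ ∃ c : k, c ≠ 0 ∧ f (x r N) = c • j (x q m)) := by
  have hne : ∀ c : k, f (x r N) ≠ c • (1 - f (h r N)) := by
    intro c hc
    refine x_ne_smul hN c (hf ?_)
    rw [hc, map_smul, map_sub, map_one]
  have hr1 : r ≠ 1 := hr.out.ne_one (by omega)
  have hcomm : f (x r N) * f (h r N) = r • (f (h r N) * f (x r N)) := by
    rw [← map_mul, x_mul_h, map_smul, map_mul]
  rcases skewPrimitive_of_factorization hn hm hij (isGroupLikeElem_h.map f) (comul_map_x f) with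
    ⟨c, hc⟩ | ⟨hg, c, c', hc⟩ | ⟨hg, c, c', hc⟩
  · exact absurd hc (hne c)
  · left
    have hc0 : c ≠ 0 := by
      rintro rfl
      rw [zero_smul, zero_add] at hc
      exact hne c' hc
    rw [hg] at hc hcomm
    obtain ⟨h1, h2⟩ := eq_of_qComm (p := p) (by rw [← map_mul, x_mul_h, map_smul, map_mul])
      (x_left_ne hn hm hij) (isUnit_map_h i) (ne_one_left hn hm hij) hr1 hc0 hc hcomm
    exact ⟨h1, hg, c, hc0, h2⟩
  · right
    have hc0 : c ≠ 0 := by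
      rintro rfl
      rw [zero_smul, zero_add] at hc
      exact hne c' hc
    rw [hg] at hc hcomm
    obtain ⟨h1, h2⟩ := eq_of_qComm (p := q) (by rw [← map_mul, x_mul_h, map_smul, map_mul])
      (x_right_ne hn hm hij) (isUnit_map_h j) (ne_one_right hn hm hij) hr1 hc0 hc hcomm
    exact ⟨h1, hg, c, hc0, h2⟩

end Hom

section ScaleBialgHom

variable {k : Type u} [Field k] {q : k} {m : ℕ} [NeZero m] [hq : Fact (IsPrimitiveRoot q m)]

/-- The rescaling `x ↦ t x` as a bialgebra endomorphism. -/
noncomputable def scaleBialgHom (t : k) : TaftAlgebra q m →ₐc[k] TaftAlgebra q m :=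
  BialgHom.ofAlgHom (scale 1 t (one_pow m))
    (algHom_ext (by simp [scale_h, counit_h]) (by simp [scale_x, counit_x]))
    (algHom_ext (by simp [scale_h, comul_h])
      (by simp [scale_x, scale_h, comul_x, TensorProduct.smul_tmul', smul_add,
        TensorProduct.tmul_smul]))

theorem scaleBialgHom_h (t : k) : scaleBialgHom t (h q m) = h q m :=
  (scale_h _ _ _).trans (one_smul _ _)

theorem scaleBialgHom_x (t : k) : scaleBialgHom t (x q m) = t • x q m := scale_x ..

theorem scaleBialgHom_scaleBialgHom {t t' : k} (htt : t * t' = 1) (a : TaftAlgebra q m) :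
    scaleBialgHom t (scaleBialgHom t' a) = a := by
  have : (scale 1 t (one_pow m)).comp (scale 1 t' (one_pow m)) = AlgHom.id k (TaftAlgebra q m) :=
    algHom_ext (by simp [scale_h]) (by simp [scale_x, smul_smul, mul_comm t', htt])
  exact AlgHom.congr_fun this a

end ScaleBialgHom

end TaftAlgebra

/-! ### Classification of the bicrossed products up to isomorphism. -/

namespace TaftBicrossed

open TaftAlgebra (h x)

section Lift

variable {k : Type u} [Field k] {p q α l : k} {n m : ℕ} [NeZero n] [NeZero m]
  [hp : Fact (IsPrimitiveRoot p n)] [hq : Fact (IsPrimitiveRoot q m)]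
  {E : Type*} [Ring E] [Bialgebra k E]
  (f : TaftAlgebra p n →ₐc[k] E) (g : TaftAlgebra q m →ₐc[k] E)
  (hfg : MixedRelations α l (f : TaftAlgebra p n →ₐ[k] E) (g : TaftAlgebra q m →ₐ[k] E))

/-- The universal property for bialgebra homomorphisms. -/
noncomputable def liftBialgHom : TaftBicrossed p q α l n m →ₐc[k] E :=
  BialgHom.ofAlgHom (lift f g hfg)
    (algHom_ext
      (AlgHom.ext fun a => by simp [counit_inl])
      (AlgHom.ext fun a => by simp [counit_inr]))
    (algHom_ext
      (AlgHom.ext fun a => by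
        have e : (lift (f : TaftAlgebra p n →ₐ[k] E) (g : TaftAlgebra q m →ₐ[k] E) hfg).comp
          (inl p q α l n m) = f := lift_comp_inl ..
        have h1 := CoalgHomClass.map_comp_comul_apply f a
        simp only [AlgHom.comp_apply, Bialgebra.comulAlgHom_apply, comul_inl, lift_inl]
        rw [← AlgHom.comp_apply, ← Algebra.TensorProduct.map_comp, e]
        exact h1)
      (AlgHom.ext fun a => by
        have e : (lift (f : TaftAlgebra p n →ₐ[k] E) (g : TaftAlgebra q m →ₐ[k] E) hfg).comp
          (inr p q α l n m) = g := lift_comp_inr ..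
        have h1 := CoalgHomClass.map_comp_comul_apply g a
        simp only [AlgHom.comp_apply, Bialgebra.comulAlgHom_apply, comul_inr, lift_inr]
        rw [← AlgHom.comp_apply, ← Algebra.TensorProduct.map_comp, e]
        exact h1))

theorem liftBialgHom_inl (a : TaftAlgebra p n) :
    liftBialgHom f g hfg (inl p q α l n m a) = f a := lift_inl ..

theorem liftBialgHom_inr (b : TaftAlgebra q m) :
    liftBialgHom f g hfg (inr p q α l n m b) = g b := lift_inr ..

/-- It reduces bijectivity of the lifted map to that of the two product maps. -/
theorem liftBialgHom_mulMap (z : TaftAlgebra p n ⊗[k] TaftAlgebra q m) :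
    liftBialgHom f g hfg
      (mulMap (inlBialgHom p q α l n m) (inrBialgHom p q α l n m) z) = mulMap f g z := by
  induction z using TensorProduct.induction_on with
  | zero => simp
  | add a b ha hb => simp only [map_add, ha, hb]
  | tmul a b =>
    rw [mulMap_tmul, map_mul, inlBialgHom_apply, inrBialgHom_apply, liftBialgHom_inl,
      liftBialgHom_inr, mulMap_tmul]

end Lift

section Classification

variable {k : Type u} [Field k] [CharZero k] {p q : k} {n m : ℕ} [NeZero n] [NeZero m]
  [hp : Fact (IsPrimitiveRoot p n)] [hq : Fact (IsPrimitiveRoot q m)] (hn : 2 ≤ n) (hm : 2 ≤ m)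

include hn hm in
/-- Every factorization through two Taft algebras is one of the presented ones. -/
theorem exists_equiv_of_factorization {E : Type*} [Ring E] [Bialgebra k E]
    {i : TaftAlgebra p n →ₐc[k] E} {j : TaftAlgebra q m →ₐc[k] E}
    (hij : Function.Bijective (mulMap i j)) :
    ∃ α l : k, Admissible p q α l n m ∧ Nonempty (TaftBicrossed p q α l n m ≃ₐc[k] E) := by
  obtain ⟨α, l, h1, h2, h3, h4, r1, r2, r3, r4⟩ := TaftAlgebra.exists_relations hn hm hij
  have hα : Admissible p q α l n m := ⟨h1, h2, h3, h4⟩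
  refine ⟨α, l, hα, ⟨BialgEquiv.ofBijective (liftBialgHom i j ⟨r1, r2, r3, r4⟩) ?_⟩⟩
  have h5 : (liftBialgHom i j ⟨r1, r2, r3, r4⟩) ∘
      mulMap (inlBialgHom p q α l n m) (inrBialgHom p q α l n m) = mulMap i j :=
    funext fun z => liftBialgHom_mulMap _ _ _ z
  have h6 := mulMap_bijective hn hm hα
  rw [← Function.Bijective.of_comp_iff _ h6, h5]
  exact hij

variable {α l α' l' : k}

include hn hm in
theorem inlBialgHom_injective (hα : Admissible p q α l n m) :
    Function.Injective (inlBialgHom p q α l n m) := by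
  intro a b hab
  have h1 : a ⊗ₜ[k] (1 : TaftAlgebra q m) = b ⊗ₜ[k] 1 :=
    (mulMap_bijective hn hm hα).1 (by simp [hab])
  exact Algebra.TensorProduct.includeLeft_injective (R := k) (S := k) (FaithfulSMul.algebraMap_injective _ _) h1

include hn hm in
theorem inrBialgHom_injective (hα : Admissible p q α l n m) :
    Function.Injective (inrBialgHom p q α l n m) := by
  intro a b hab
  have h1 : (1 : TaftAlgebra p n) ⊗ₜ[k] a = 1 ⊗ₜ[k] b :=
    (mulMap_bijective hn hm hα).1 (by simp [hab])
  exact Algebra.TensorProduct.includeRight_injective (R := k) (FaithfulSMul.algebraMap_injective _ _) h1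

include hn hm in
/-- Isomorphic bicrossed products have the same parameters, up to rescaling and inversion. -/
theorem parameters_of_equiv (hα : Admissible p q α l n m) (hα' : Admissible p q α' l' n m)
    (φ : TaftBicrossed p q α l n m ≃ₐc[k] TaftBicrossed p q α' l' n m) :
    (l = 0 ↔ l' = 0) ∧ (α = α' ∨ (p = q ∧ α * α' = 1)) := by
  have hb := mulMap_bijective hn hm hα
  have hb' := mulMap_bijective hn hm hα'
  obtain ⟨r1, r2, r3, r4⟩ := mixedRelations (p := p) (q := q) (α := α) (l := l) (n := n) (m := m)
  obtain ⟨s1, s2, s3, s4⟩ :=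
    mixedRelations (p := p) (q := q) (α := α') (l := l') (n := n) (m := m)
  have hne : φ (inl p q α l n m (h p n)) ≠ φ (inr p q α l n m (h q m)) := fun h0 =>
    TaftAlgebra.left_ne_right hn hm hb (EquivLike.injective φ h0)
  have hX0 : inl p q α' l' n m (x p n) ≠ 0 := fun h0 =>
    TaftAlgebra.x_left_ne hn hm hb' 0 (h0.trans (zero_smul _ _).symm)
  have hx0 : inr p q α' l' n m (x q m) ≠ 0 := fun h0 =>
    TaftAlgebra.x_right_ne hn hm hb' 0 (h0.trans (zero_smul _ _).symm)
  have hHu : IsUnit (inl p q α' l' n m (h p n)) := TaftAlgebra.isUnit_h.map _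
  have hhu : IsUnit (inr p q α' l' n m (h q m)) := TaftAlgebra.isUnit_h.map _
  have hsub : 1 - inl p q α' l' n m (h p n) * inr p q α' l' n m (h q m) ≠ 0 :=
    sub_ne_zero.mpr (TaftAlgebra.mul_ne_one hn hm hb').symm
  have r2' := congrArg φ r2
  have r4' := congrArg φ r4
  simp only [map_mul, map_add, map_smul, map_sub, map_one] at r2' r4'
  -- Each Taft subalgebra lands in one of the two factors of the target. Landing in the same factor
  -- would identify the images of `H` and `h`, so only the identity and the exchange survive.
  rcases TaftAlgebra.hom_to_factorization hn hm hn hb'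
      ((φ : TaftBicrossed p q α l n m →ₐc[k] TaftBicrossed p q α' l' n m).comp (inlBialgHom p q α l n m))
      ((EquivLike.injective φ).comp (inlBialgHom_injective hn hm hα)) with
    ⟨-, e1, c, hc, e2⟩ | ⟨hpq, e1, c, hc, e2⟩ <;>
  rcases TaftAlgebra.hom_to_factorization hn hm hm hb'
      ((φ : TaftBicrossed p q α l n m →ₐc[k] TaftBicrossed p q α' l' n m).comp (inrBialgHom p q α l n m))
      ((EquivLike.injective φ).comp (inrBialgHom_injective hn hm hα)) with
    ⟨-, f1, c', hc', f2⟩ | ⟨-, f1, c', hc', f2⟩ <;>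
  simp only [BialgHom.comp_apply, inlBialgHom_apply, inrBialgHom_apply, BialgHom.coe_coe] at e1 e2 f1 f2
  · exact absurd (e1.trans f1.symm) hne
  · rw [e2, f1] at r2'
    rw [e1, e2, f1, f2] at r4'
    -- The factors are kept: `α` is read off the relation between `h` and `X`, and then `l` differs
    -- from `l'` by the nonzero factor `c * c'`.
    have hαα : α = α' := by
      rw [mul_smul_comm, s2, smul_mul_assoc, smul_comm c, ← sub_eq_zero, ← sub_smul] at r2'
      rcases smul_eq_zero.mp r2' with h1 | h1
      · exact (sub_eq_zero.mp h1).symm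
      · exact absurd (hhu.mul_left_eq_zero.mp ((smul_eq_zero.mp h1).resolve_left hc)) hX0
    refine ⟨?_, Or.inl hαα⟩
    rw [smul_mul_smul_comm, smul_mul_smul_comm, s4, smul_add, hαα, smul_comm α', mul_comm c,
      add_right_inj, smul_smul, ← sub_eq_zero, ← sub_smul] at r4'
    have h1 := (smul_eq_zero.mp r4').resolve_right hsub
    rw [← sub_eq_zero.mp h1]
    simp [hc, hc']
  · rw [e2, f1] at r2'
    rw [e1, e2, f1, f2] at r4'
    -- The factors are exchanged: the relation between `h` and `X` becomes the one between `H` and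
    -- `x` with the two sides interchanged, so `α` is inverted.
    have hαα : α * α' = 1 := by
      rw [mul_smul_comm, smul_mul_assoc, s3, smul_comm c] at r2'
      have h0 : (1 - α * α') • (c • (inl p q α' l' n m (h p n) * inr p q α' l' n m (x q m))) = 0 := by
        rw [sub_smul, one_smul, mul_smul, ← r2', sub_self]
      rcases smul_eq_zero.mp h0 with h1 | h1
      · exact (sub_eq_zero.mp h1).symm
      · exact absurd (hHu.mul_right_eq_zero.mp ((smul_eq_zero.mp h1).resolve_left hc)) hx0
    refine ⟨?_, Or.inr ⟨hpq, hαα⟩⟩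
    rw [smul_mul_smul_comm, smul_mul_smul_comm, s4, s1, mul_comm c', smul_add, smul_add,
      smul_comm _ α', smul_smul α, hαα, one_smul, add_assoc, left_eq_add, smul_smul, smul_smul,
      ← add_smul] at r4'
    have h1 := (smul_eq_zero.mp r4').resolve_right hsub
    have hα0 : α ≠ 0 := left_ne_zero_of_mul (hαα.trans_ne one_ne_zero)
    rw [eq_neg_of_add_eq_zero_right h1]
    simp [hc, hc', hα0]
  · exact absurd (e1.trans f1.symm) hne

end Classification

section Isomorphisms

variable {k : Type u} [Field k] {p q : k} {n m : ℕ} [NeZero n] [NeZero m]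
  [hp : Fact (IsPrimitiveRoot p n)] [hq : Fact (IsPrimitiveRoot q m)]

/-- Rescaling of `x`. -/
noncomputable def rescaleHom (α l l' t : k) (ht : l' * t = l) :
    TaftBicrossed p q α l n m →ₐc[k] TaftBicrossed p q α l' n m :=
  liftBialgHom (inlBialgHom p q α l' n m)
    ((inrBialgHom p q α l' n m).comp (TaftAlgebra.scaleBialgHom t)) (by
      obtain ⟨s1, s2, s3, s4⟩ :=
        mixedRelations (p := p) (q := q) (α := α) (l := l') (n := n) (m := m)
      constructor <;> simp only [BialgHom.coe_toAlgHom, BialgHom.comp_apply,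
        TaftAlgebra.scaleBialgHom_h, TaftAlgebra.scaleBialgHom_x, inlBialgHom_apply,
        inrBialgHom_apply, map_smul]
      · exact s1
      · exact s2
      · rw [smul_mul_assoc, s3, mul_smul_comm, smul_comm]
      · rw [smul_mul_assoc, s4, mul_smul_comm, smul_add, smul_comm t α, smul_smul t, mul_comm t, ht])

theorem rescaleHom_rescaleHom {α l l' t t' : k} (ht : l' * t = l) (ht' : l * t' = l')
    (htt : t * t' = 1) (e : TaftBicrossed p q α l n m) :
    rescaleHom α l' l t' ht' (rescaleHom α l l' t ht e) = e := by
  induction e using TaftBicrossed.induction with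
  | left a => simp [rescaleHom, liftBialgHom_inl, inlBialgHom_apply]
  | right b =>
    simp [rescaleHom, liftBialgHom_inr, inrBialgHom_apply,
      TaftAlgebra.scaleBialgHom_scaleBialgHom ((mul_comm t' t).trans htt)]
  | mul a b ha hb => rw [map_mul, map_mul, ha, hb]
  | add a b ha hb => rw [map_add, map_add, ha, hb]

theorem nonempty_equiv_one (α : k) {l : k} (hl : l ≠ 0) :
    Nonempty (TaftBicrossed p q α l n m ≃ₐc[k] TaftBicrossed p q α 1 n m) :=
  ⟨BialgEquiv.ofBialgHom (rescaleHom α l 1 l (one_mul l))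
    (rescaleHom α 1 l l⁻¹ (mul_inv_cancel₀ hl))
    (BialgHom.ext fun e => rescaleHom_rescaleHom (mul_inv_cancel₀ hl) (one_mul l)
      (inv_mul_cancel₀ hl) e)
    (BialgHom.ext fun e => rescaleHom_rescaleHom (one_mul l) (mul_inv_cancel₀ hl)
      (mul_inv_cancel₀ hl) e)⟩

/-- Exchange of the two factors. -/
noncomputable def swapHom {α α' : k} (hα : α * α' = 1) :
    TaftBicrossed p p α 0 n n →ₐc[k] TaftBicrossed p p α' 0 n n :=
  liftBialgHom (inrBialgHom p p α' 0 n n) (inlBialgHom p p α' 0 n n) (by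
      obtain ⟨s1, s2, s3, s4⟩ :=
        mixedRelations (p := p) (q := p) (α := α') (l := 0) (n := n) (m := n)
      constructor <;> simp only [BialgHom.coe_toAlgHom, inlBialgHom_apply, inrBialgHom_apply]
      · exact s1.symm
      · rw [s3, smul_smul, hα, one_smul]
      · rw [s2, smul_smul, hα, one_smul]
      · rw [s4, zero_smul, zero_smul, add_zero, add_zero, smul_smul, hα, one_smul])

theorem swapHom_swapHom {α α' : k} (hα : α * α' = 1) (hα' : α' * α = 1)
    (e : TaftBicrossed p p α 0 n n) : swapHom hα' (swapHom hα e) = e := by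
  induction e using TaftBicrossed.induction with
  | left a =>
    simp [swapHom, liftBialgHom_inl, liftBialgHom_inr, inlBialgHom_apply, inrBialgHom_apply]
  | right b =>
    simp [swapHom, liftBialgHom_inl, liftBialgHom_inr, inlBialgHom_apply, inrBialgHom_apply]
  | mul a b ha hb => rw [map_mul, map_mul, ha, hb]
  | add a b ha hb => rw [map_add, map_add, ha, hb]

theorem nonempty_equiv_swap {α α' : k} (hα : α * α' = 1) :
    Nonempty (TaftBicrossed p p α 0 n n ≃ₐc[k] TaftBicrossed p p α' 0 n n) :=
  have hα' : α' * α = 1 := by rw [mul_comm, hα]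
  ⟨BialgEquiv.ofBialgHom (swapHom hα) (swapHom hα')
    (BialgHom.ext fun e => swapHom_swapHom hα' hα e)
    (BialgHom.ext fun e => swapHom_swapHom hα hα' e)⟩

end Isomorphisms

end TaftBicrossed

/-! ### Counting -/

namespace TaftBicrossed

section Counting

variable {k : Type u} [Field k] [CharZero k] {p q : k} {n m : ℕ} [NeZero n] [NeZero m]
  [hp : Fact (IsPrimitiveRoot p n)] [hq : Fact (IsPrimitiveRoot q m)] (hn : 2 ≤ n) (hm : 2 ≤ m)

/-- The quotient of the Hopf algebras factoring through two Taft algebras by isomorphism. -/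
abbrev FactorizationType (p q : k) (n m : ℕ) [NeZero n] [NeZero m]
    [Fact (IsPrimitiveRoot p n)] [Fact (IsPrimitiveRoot q m)] : Type (u + 1) :=
  Quotient (factorizationSetoid (HopfAlgCat.of k (TaftAlgebra p n))
    (HopfAlgCat.of k (TaftAlgebra q m)))

/-- The isomorphism type of a bicrossed product. -/
noncomputable def typeOf {α l : k} (hα : Admissible p q α l n m) : FactorizationType p q n m :=
  Quotient.mk _ ⟨HopfAlgCat.of k (TaftBicrossed p q α l n m), inlBialgHom p q α l n m,
    inrBialgHom p q α l n m, inlBialgHom_injective hn hm hα, inrBialgHom_injective hn hm hα,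
    mulMap_bijective hn hm hα⟩

theorem typeOf_eq_iff {α l α' l' : k} (hα : Admissible p q α l n m)
    (hα' : Admissible p q α' l' n m) : typeOf hn hm hα = typeOf hn hm hα' ↔
      Nonempty (TaftBicrossed p q α l n m ≃ₐc[k] TaftBicrossed p q α' l' n m) :=
  Quotient.eq

theorem exists_typeOf (z : FactorizationType p q n m) :
    ∃ (α l : k) (hα : Admissible p q α l n m), z = typeOf hn hm hα := by
  obtain ⟨⟨E, i, j, hi, hj, hij⟩, rfl⟩ := Quotient.exists_rep z
  obtain ⟨α, l, hα, ⟨e⟩⟩ := exists_equiv_of_factorization (p := p) (q := q) hn hm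
    (i := i) (j := j) hij
  exact ⟨α, l, hα, Quotient.sound ⟨e.symm⟩⟩

theorem admissible_zero {α : k} (hα : α ^ n.gcd m = 1) : Admissible p q α 0 n m := by
  refine ⟨?_, ?_, by simp, by simp⟩
  · obtain ⟨c, hc⟩ := n.gcd_dvd_left m
    rw [hc, pow_mul, hα, one_pow]
  · obtain ⟨c, hc⟩ := n.gcd_dvd_right m
    rw [hc, pow_mul, hα, one_pow]

theorem Admissible.pow_gcd {α l : k} (hα : Admissible p q α l n m) : α ^ n.gcd m = 1 :=
  pow_gcd_eq_one.mpr ⟨hα.pow_left, hα.pow_right⟩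

theorem Admissible.eq_of_ne_zero {α l : k} (hα : Admissible p q α l n m) (hl : l ≠ 0) :
    α = q ∧ q * p = 1 := by
  have h1 := sub_eq_zero.mp ((mul_eq_zero.mp hα.eq_right).resolve_left hl)
  have h2 := sub_eq_zero.mp ((mul_eq_zero.mp hα.eq_left).resolve_left hl)
  exact ⟨h1, h1 ▸ h2⟩

theorem admissible_one (hqn : q ^ n = 1) (hqp : q * p = 1) : Admissible p q q 1 n m :=
  ⟨hqn, hq.out.pow_eq_one, by simp, by simp [hqp]⟩

/-- The isomorphism type with `l = 0`. -/
noncomputable def typeZero (α : {ω : k // ω ^ n.gcd m = 1}) : FactorizationType p q n m :=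
  typeOf hn hm (admissible_zero α.2)

theorem typeZero_eq {α β : {ω : k // ω ^ n.gcd m = 1}}
    (h : typeZero (p := p) (q := q) hn hm α = typeZero hn hm β) :
    α = β ∨ (p = q ∧ (α : k) * β = 1) := by
  obtain ⟨e⟩ := (typeOf_eq_iff hn hm _ _).mp h
  rcases (parameters_of_equiv hn hm (admissible_zero α.2) (admissible_zero β.2) e).2 with h1 | h1
  · exact Or.inl (Subtype.ext h1)
  · exact Or.inr h1

theorem exists_typeZero_or (z : FactorizationType p q n m) : (∃ α, z = typeZero hn hm α) ∨
    ∃ h : Admissible p q q 1 n m, z = typeOf hn hm h := by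
  obtain ⟨α, l, hα, rfl⟩ := exists_typeOf hn hm z
  by_cases hl : l = 0
  · subst hl
    exact Or.inl ⟨⟨α, hα.pow_gcd⟩, rfl⟩
  · right
    obtain ⟨rfl, h2⟩ := hα.eq_of_ne_zero hl
    exact ⟨admissible_one hα.pow_left h2, (typeOf_eq_iff hn hm _ _).mpr (nonempty_equiv_one _ hl)⟩

theorem typeZero_ne (α : {ω : k // ω ^ n.gcd m = 1}) (h : Admissible p q q 1 n m) :
    typeZero hn hm α ≠ typeOf hn hm h := fun h0 => by
  obtain ⟨e⟩ := (typeOf_eq_iff hn hm _ _).mp h0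
  exact one_ne_zero ((parameters_of_equiv hn hm (admissible_zero α.2) h e).1.mp rfl)

theorem finite_rootsOfUnity {d : ℕ} (hd : 0 < d) : Finite {ω : k // ω ^ d = 1} :=
  Set.Finite.to_subtype ((Polynomial.nthRootsFinset d (1 : k)).finite_toSet.subset fun _ hω =>
    (Polynomial.mem_nthRootsFinset hd 1).mpr hω)

/-- The isomorphism types live one universe above `k`, so the parameters are counted by `Nat.card`,
which is insensitive to universes. -/
theorem mk_eq_natCast {P : Type*} [Finite P] {Q : Type*} {f : P → Q} (hf : Function.Bijective f)
    {N : ℕ} (hN : Nat.card P = N) : Cardinal.mk Q = N := by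
  have : Finite Q := Finite.of_surjective f hf.2
  rw [← hN, Nat.card_eq_of_bijective f hf, Nat.cast_card]

-- The first hypothesis excludes `l ≠ 0`, the second excludes exchanging the factors.
include hn hm in
theorem card_of_mul_ne_one (hqp : q * p ≠ 1) (hpq : p ≠ q) :
    Cardinal.mk (FactorizationType p q n m) = Nat.card {ω : k // ω ^ n.gcd m = 1} := by
  have := finite_rootsOfUnity (k := k) (Nat.gcd_pos_of_pos_left m (Nat.pos_of_ne_zero (NeZero.ne n)))
  refine mk_eq_natCast (f := typeZero (p := p) (q := q) hn hm) ⟨fun α β h => ?_, fun z => ?_⟩ rfl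
  · exact (typeZero_eq hn hm h).resolve_right fun h1 => hpq h1.1
  · rcases exists_typeZero_or hn hm z with ⟨α, rfl⟩ | ⟨h, -⟩
    · exact ⟨α, rfl⟩
    · exact absurd (h.eq_of_ne_zero one_ne_zero).2 hqp

-- The hypothesis `hinv` covers two situations: `p ≠ q`, where no exchange exists, and `m = n = 2`,
-- where inverting `α` changes nothing.
include hn hm in
theorem card_of_mul_eq_one (hqn : q ^ n = 1) (hqp : q * p = 1)
    (hinv : p = q → ∀ α β : k, α ^ n.gcd m = 1 → α * β = 1 → α = β) :
    Cardinal.mk (FactorizationType p q n m) =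
      ((Nat.card {ω : k // ω ^ n.gcd m = 1} + 1 : ℕ) : Cardinal) := by
  have := finite_rootsOfUnity (k := k) (Nat.gcd_pos_of_pos_left m (Nat.pos_of_ne_zero (NeZero.ne n)))
  have h1 : Admissible p q q 1 n m := admissible_one hqn hqp
  -- The value `none` stands for the single type with `l = 1`.
  refine mk_eq_natCast (f := fun o : Option {ω : k // ω ^ n.gcd m = 1} =>
    o.elim (typeOf hn hm h1) (typeZero (p := p) (q := q) hn hm)) ⟨?_, fun z => ?_⟩
    Finite.card_option
  · rintro (_ | α) (_ | β) h
    · rfl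
    · exact absurd h.symm (typeZero_ne hn hm _ h1)
    · exact absurd h (typeZero_ne hn hm _ h1)
    · rcases typeZero_eq hn hm h with h2 | ⟨h2, h3⟩
      · rw [h2]
      · rw [Subtype.ext (hinv h2 α β α.2 h3)]
  · rcases exists_typeZero_or hn hm z with ⟨α, rfl⟩ | ⟨h, rfl⟩
    · exact ⟨some α, rfl⟩
    · exact ⟨none, rfl⟩

include hq in
theorem card_rootsOfUnity_eq : Nat.card {ω : k // ω ^ m = 1} = m := by
  have h1 : Function.Bijective (fun i : Fin m =>
      (⟨q ^ (i : ℕ), by rw [← pow_mul, mul_comm, pow_mul, hq.out.pow_eq_one, one_pow]⟩ :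
        {ω : k // ω ^ m = 1})) := by
    refine ⟨fun i j hij => TaftAlgebra.pow_fin_inj (q := q) (congrArg Subtype.val hij), ?_⟩
    rintro ⟨ω, hω⟩
    obtain ⟨i, hi, rfl⟩ := hq.out.eq_pow_of_pow_eq_one hω
    exact ⟨⟨i, hi⟩, rfl⟩
  rw [← Nat.card_eq_of_bijective _ h1, Nat.card_fin]

include hm in
/-- When the two Taft algebras coincide, the types are the orbits of inversion on the roots of
unity. -/
theorem card_of_eq (hm3 : 3 ≤ m) :
    Cardinal.mk (FactorizationType q q m m) = ((m / 2 + 1 : ℕ) : Cardinal) := by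
  have hpow : ∀ i : ℕ, (q ^ i) ^ m.gcd m = 1 := fun i => by
    rw [Nat.gcd_self, ← pow_mul, mul_comm, pow_mul, hq.out.pow_eq_one, one_pow]
  -- The exponents `0, …, m / 2` represent the orbits of `i ↦ -i` modulo `m`.
  refine mk_eq_natCast (f := fun i : Fin (m / 2 + 1) =>
    typeZero (p := q) (q := q) hm hm ⟨q ^ (i : ℕ), hpow i⟩) ⟨fun i j h => ?_, fun z => ?_⟩
    (Nat.card_fin _)
  · have hi := i.2
    have hj := j.2
    rcases typeZero_eq hm hm h with h1 | ⟨-, h1⟩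
    · exact Fin.ext (hq.out.pow_inj (by omega) (by omega) (congrArg Subtype.val h1))
    · rw [← pow_add, hq.out.pow_eq_one_iff_dvd] at h1
      obtain ⟨c, hc⟩ := h1
      -- Both exponents are at most `m / 2`, so their sum is `0` or `m`; in either case they
      -- coincide.
      have hc2 : c = 0 ∨ c = 1 := by
        have : m * c ≤ m * 1 := by omega
        have := Nat.le_of_mul_le_mul_left this (by omega)
        omega
      apply Fin.ext
      rcases hc2 with rfl | rfl <;> omega
  · rcases exists_typeZero_or hm hm z with ⟨⟨α, hα⟩, rfl⟩ | ⟨h, -⟩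
    · obtain ⟨i, hi, rfl⟩ := hq.out.eq_pow_of_pow_eq_one (by rwa [Nat.gcd_self] at hα)
      by_cases hi2 : i ≤ m / 2
      · exact ⟨⟨i, by omega⟩, rfl⟩
      · refine ⟨⟨m - i, by omega⟩, ?_⟩
        refine (typeOf_eq_iff hm hm _ _).mpr (nonempty_equiv_swap ?_)
        rw [← pow_add, Nat.sub_add_cancel hi.le, hq.out.pow_eq_one]
    -- A type with `l = 1` would require `q ^ 2 = 1`, impossible for order at least three.
    · have h1 := (h.eq_of_ne_zero one_ne_zero).2
      rw [← pow_two] at h1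
      exact absurd (Nat.le_of_dvd two_pos (hq.out.dvd_of_pow_eq_one _ h1)) (by omega)

end Counting

end TaftBicrossed

/-! ### The case distinction. -/

theorem mainTheorem4 {k : Type u} [Field k] [CharZero k] {m n : ℕ} (hm : 2 ≤ m) (hn : 2 ≤ n)
    {q qbar : k} (hq : IsPrimitiveRoot q m) (hqbar : IsPrimitiveRoot qbar n)
    (d ν : ℕ) (hd : d = Nat.gcd m n) (hν : ν = Nat.card {ω : k // ω ^ d = 1}) :
    (m = n → n = 2 → numFactorizationTypes (taftHopf hn hqbar) (taftHopf hm hq) = 3) ∧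
    ((m ≠ n ∨ (m = n ∧ 3 ≤ n ∧ qbar ≠ q ∧ qbar ≠ q ^ (n - 1))) →
      numFactorizationTypes (taftHopf hn hqbar) (taftHopf hm hq) = (ν : Cardinal)) ∧
    (m = n → 3 ≤ n → qbar = q → Even ν →
      numFactorizationTypes (taftHopf hn hqbar) (taftHopf hm hq) = ((ν / 2 + 1 : ℕ) : Cardinal)) ∧
    (m = n → 3 ≤ n → qbar = q → Odd ν →
      numFactorizationTypes (taftHopf hn hqbar) (taftHopf hm hq) =
        (((ν + 1) / 2 : ℕ) : Cardinal)) ∧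
    (m = n → 3 ≤ n → qbar = q ^ (n - 1) →
      numFactorizationTypes (taftHopf hn hqbar) (taftHopf hm hq) = ((ν + 1 : ℕ) : Cardinal)) := by
  have : NeZero m := ⟨by omega⟩
  have : NeZero n := ⟨by omega⟩
  have : Fact (IsPrimitiveRoot q m) := ⟨hq⟩
  have : Fact (IsPrimitiveRoot qbar n) := ⟨hqbar⟩
  -- The instances chosen inside `taftHopf` are proofs, so the two sides agree definitionally.
  have hnum : numFactorizationTypes (taftHopf hn hqbar) (taftHopf hm hq) =
      Cardinal.mk (TaftBicrossed.FactorizationType qbar q n m) := rfl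
  rw [Nat.gcd_comm] at hd
  subst hd
  rw [hnum]
  refine ⟨?_, ?_, ?_, ?_, ?_⟩
  · rintro rfl h2
    subst h2
    have hq1 := hq.eq_neg_one_of_two_right
    have hp1 := hqbar.eq_neg_one_of_two_right
    rw [TaftBicrossed.card_of_mul_eq_one hn hm hq.pow_eq_one (by rw [hq1, hp1]; ring),
      Nat.gcd_self, TaftBicrossed.card_rootsOfUnity_eq (q := q)]
    · norm_num
    -- Here `α ^ 2 = 1`, so `α` is its own inverse.
    · intro _ α β hα hαβ
      rw [Nat.gcd_self] at hα
      have hα0 : α ≠ 0 := left_ne_zero_of_mul (hαβ.trans_ne one_ne_zero)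
      exact mul_left_cancel₀ hα0 (by rw [hαβ, ← pow_two, hα])
  · intro hcase
    rw [hν]
    -- Mutually inverse roots of unity have the same order, so an extra type can only occur in the
    -- excluded case.
    have hqp : q * qbar = 1 → m = n ∧ qbar = q ^ (n - 1) := by
      intro h1
      have h2 : q = qbar⁻¹ := eq_inv_of_mul_eq_one_left h1
      have hmn : m = n := hq.unique (h2 ▸ hqbar.inv)
      refine ⟨hmn, mul_left_cancel₀ (hq.ne_zero (NeZero.ne m)) ?_⟩
      rw [h1, ← pow_succ', Nat.sub_add_cancel (by omega), ← hmn, hq.pow_eq_one]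
    refine TaftBicrossed.card_of_mul_ne_one hn hm (fun h1 => ?_) (fun h1 => ?_)
    · obtain ⟨h2, h3⟩ := hqp h1
      rcases hcase with h4 | h4
      · exact h4 h2
      · exact h4.2.2.2 h3
    · rcases hcase with h4 | h4
      · exact h4 (hq.unique (h1 ▸ hqbar))
      · exact h4.2.2.1 h1
  · rintro rfl h3 rfl heven
    rw [TaftBicrossed.card_of_eq hn h3]
    rw [Nat.gcd_self, TaftBicrossed.card_rootsOfUnity_eq (q := qbar)] at hν
    rw [hν]
  · rintro rfl h3 rfl hodd
    rw [TaftBicrossed.card_of_eq hn h3]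
    rw [Nat.gcd_self, TaftBicrossed.card_rootsOfUnity_eq (q := qbar)] at hν
    obtain ⟨c, hc⟩ := hodd
    congr 1
    omega
  · rintro rfl h3 hqq
    rw [hν]
    have hqp : q * qbar = 1 := by
      rw [hqq, ← pow_succ', Nat.sub_add_cancel (by omega), hq.pow_eq_one]
    -- If also `qbar = q`, then `q ^ 2 = 1`, against `n ≥ 3`; hence there is no exchange.
    refine TaftBicrossed.card_of_mul_eq_one hn hm hq.pow_eq_one hqp fun hpq => ?_
    rw [hpq, ← pow_two] at hqp
    exact absurd (Nat.le_of_dvd two_pos (hq.dvd_of_pow_eq_one _ hqp)) (by omega)
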